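/- \textbf{Conventions.} Let $\mathbb F$ be a field of characteristic different from $2$ and $3$. Algebras are commutative but not necessarily associative or unital. For $a$ in an algebra $A$, let $A_\lambda(a)=\{v: av=\lambda v\}$. An \emph{axis} for a fusion law $(\mathcal F,\star)$ is an idempotent $a$ with $A=\bigoplus_{\lambda\in\mathcal F}A_\lambda(a)$ and $A_\lambda(a)A_\mu(a)\subseteq\bigoplus_{\nu\in\lambda\star\mu}A_\nu(a)$; it is \emph{primitive} if $A_1(a)=\langle a\rangle$ is $1$-dimensional. An axis is \emph{of Jordan type $2$} if it satisfies the law on $\{1,0,2\}$ with $1\star1=\{1\}$, $0\star0=\{0\}$, $1\star0=\emptyset$, $1\star2=0\star2=\{2\}$, $2\star2=\{1,0\}$, and \emph{of Monster type $(2,\frac12)$} if it satisfies the law on $\{1,0,2,\frac12\}$ which extends this one by $1\star\frac12=0\star\frac12=2\star\frac12=\{\frac12\}$, $\frac12\star\frac12=\{1,0,2\}$ (both laws are symmetric). For an axis $x$ of Monster type $(2,\frac12)$, $\tau_x\in\mathrm{Aut}(A)$ is $-1$ on $A_{1/2}(x)$ and $1$ on the other eigenspaces of $x$; for an axis $c$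 of Jordan type $2$, $\sigma_c\in\mathrm{Aut}(A)$ is $-1$ on $A_2(c)$ and $1$ on $A_1(c)\oplus A_0(c)$. Let $A$ be generated by two axes $a,b$, let $X=a^{\langle\tau_a,\tau_b\rangle}\cup b^{\langle\tau_a,\tau_b\rangle}$, let all elements of $X$ be primitive axes of Monster type $(2,\frac12)$, and let $\mathrm{Miy}(X)=\langle\tau_x:x\in X\rangle$. Then $A$ \emph{has axet $X(N)$} if there is a bijection $e:\mathbb Z/N\to X$ with $\tau_{e(i)}(e(j))=e(2i-j)$ for all $i,j$. It has \emph{property (J)} if there is a primitive axis $c\notin X$ of Jordan type $2$ which is fixed by $\mathrm{Miy}(X)$ and such that $\sigma_c$ switches the two halves $a^{\mathrm{Miy}(X)}$ and $b^{\mathrm{Miy}(X)}$ of $X$. \textbf{The algebras.} Let $\hat{\mathcal H}$ be the algebra over $\mathbb F$ with basis $a_i$ ($i\in\mathbb Z$), $s_j$ ($j\ge1$), $p_{1,k},p_{2,k}$ ($k\ge 1$, $3\mid k$), the first index of $p$ being read in $\mathbb Z/3$. Put $s_0=0$, $p_{r,j}=0$ unless $j$ is a positive multiple of $3$, $p_{0,j}=-p_{1,j}-p_{2,j}$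 and $z_{r,j}=p_{r+1,j}-p_{r-1,j}$. The product is given, for $i,i'\in\mathbb Z$, $j,l\ge1$, $h,k\in3\mathbb N$ and $r,t\in\mathbb Z/3$, by $$a_ia_{i'}=\tfrac12(a_i+a_{i'})+s_{|i-i'|}+z_{i,|i-i'|},\qquad a_is_j=-\tfrac34a_i+\tfrac38(a_{i-j}+a_{i+j})+\tfrac32s_j-z_{i,j},$$ $$a_ip_{r,k}=\tfrac32p_{r,k}-p_{-(i+r),k},\qquad s_js_l=\tfrac34(s_j+s_l)-\tfrac38(s_{|j-l|}+s_{j+l}),$$ $$s_jp_{r,k}=\tfrac34(p_{r,j}+p_{r,k})-\tfrac38(p_{r,|j-k|}+p_{r,j+k}),$$ $$p_{r,h}p_{t,k}=\tfrac14(z_{-(r+t),h}+z_{-(r+t),k})-\tfrac18(z_{-(r+t),|h-k|}+z_{-(r+t),h+k}).$$ Let $J$ be the ideal spanned by all $p_{r,j}$; the Highwater algebra is $\mathcal H=\hat{\mathcal H}/J$. For $m\ge1$ let $I_m$ be the ideal of $\hat{\mathcal H}$ generated by $a_0-a_m$, and put $\hat{\mathcal H}_m=\hat{\mathcal H}/I_m$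 and $\mathcal H_m=\hat{\mathcal H}/(J+I_m)$. Quotients of these algebras are regarded as generated by the images of $a_0$ and $a_1$. A quotient $Q$ of $\mathcal H_{2n}$ (respectively $\hat{\mathcal H}_{2n}$) is called the \emph{universal} quotient with axet $X(2n)$ and property (J) if $Q$ has axet $X(2n)$ and property (J), and every quotient of $\mathcal H_{2n}$ (respectively $\hat{\mathcal H}_{2n}$) with axet $X(2n)$ and property (J) is a quotient of $Q$ (that is, its kernel contains the kernel of the map to $Q$). \textbf{Proposition.} Let $n\in\mathbb N$ be odd. \begin{enumerate} \item There is a universal quotient $\mathcal H_{2n}^J$ of $\mathcal H_{2n}$ with axet $X(2n)$ and property (J). It has dimension $n+\lceil\frac n2\rceil+1$. \item If $\mathbb F$ has characteristic $5$, there is a universal quotient $\hat{\mathcal H}_{2n}^J$ of $\hat{\mathcal H}_{2n}$ with axet $X(2n)$ and property (J). If $3\nmid n$, then $\hat{\mathcal H}_{2n}^J=\mathcal H_{2n}^J$ (the kernels of the maps from $\hat{\mathcal H}$ to these two algebras coincide). If $3\mid n$, then $\hat{\mathcal H}_{2n}^J$ has dimension $n+\lceil\frac n2\rceil+2\lceil\frac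 n6\rceil+1$. \end{enumerate} -/

import Mathlib

noncomputable section

/-! ### Commutative non-associative algebras: ideals and quotients -/

/-- An ideal of a commutative (non-associative, non-unital) `F`-algebra `A`: a subspace that absorbs
multiplication by `A`. -/
structure AlgIdeal (F A : Type*) [Field F] [NonUnitalNonAssocCommRing A] [Module F A]
    extends Submodule F A where
  mul_mem' : ∀ x y : A, y ∈ carrier → x * y ∈ carrier

namespace AlgIdeal

variable {F A : Type*} [Field F] [NonUnitalNonAssocCommRing A] [Module F A]

theorem toSubmodule_injective :
    Function.Injective (AlgIdeal.toSubmodule : AlgIdeal F A → Submodule F A) := by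
  rintro ⟨p, hp⟩ ⟨q, hq⟩ h
  simp only at h
  subst h
  rfl

/-- Ideals are ordered by inclusion. -/
instance : PartialOrder (AlgIdeal F A) :=
  PartialOrder.lift AlgIdeal.toSubmodule toSubmodule_injective

/-- The ideal generated by a set: the intersection of all ideals containing it. -/
def span (F : Type*) {A : Type*} [Field F] [NonUnitalNonAssocCommRing A] [Module F A]
    (S : Set A) : AlgIdeal F A where
  toSubmodule := sInf {p : Submodule F A | S ⊆ p ∧ ∀ x y : A, y ∈ p → x * y ∈ p}
  mul_mem' x y hy := by
    simp only [AddSubsemigroup.mem_carrier, AddSubmonoid.mem_toSubsemigroup,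
      Submodule.mem_toAddSubmonoid, Submodule.mem_sInf] at hy ⊢
    exact fun p hp => hp.2 x y (hy p hp)

variable [IsScalarTower F A A] [SMulCommClass F A A]

/-- The quotient algebra `A / I`. -/
def Quot (I : AlgIdeal F A) : Type _ := A ⧸ I.toSubmodule

instance (I : AlgIdeal F A) : AddCommGroup I.Quot :=
  inferInstanceAs (AddCommGroup (A ⧸ I.toSubmodule))

instance (I : AlgIdeal F A) : Module F I.Quot :=
  inferInstanceAs (Module F (A ⧸ I.toSubmodule))

/-- The quotient map `A → A / I`. -/
def toQuot (I : AlgIdeal F A) : A →ₗ[F] I.Quot := I.toSubmodule.mkQ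

theorem toQuot_surjective (I : AlgIdeal F A) : Function.Surjective I.toQuot :=
  I.toSubmodule.mkQ_surjective

theorem toQuot_eq_zero (I : AlgIdeal F A) {x : A} : I.toQuot x = 0 ↔ x ∈ I.toSubmodule :=
  Submodule.Quotient.mk_eq_zero I.toSubmodule

/-- The product of `A / I` as a bilinear map, induced by the product of `A`. -/
def mulQ (I : AlgIdeal F A) : I.Quot →ₗ[F] I.Quot →ₗ[F] I.Quot :=
  I.toSubmodule.liftQ
    ((Submodule.liftQ I.toSubmodule
      ((LinearMap.compr₂ (LinearMap.mul F A) I.toQuot).flip)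
      (fun y hy => by
        ext x
        exact I.toQuot_eq_zero.2 (I.mul_mem' x y hy))).flip)
    (fun x hx => by
      ext y
      obtain ⟨y, rfl⟩ := I.toQuot_surjective y
      refine I.toQuot_eq_zero.2 ?_
      rw [LinearMap.mul_apply', mul_comm]
      exact I.mul_mem' y x hx)

instance (I : AlgIdeal F A) : Mul I.Quot := ⟨fun x y => I.mulQ x y⟩

theorem toQuot_mul (I : AlgIdeal F A) (x y : A) : I.toQuot (x * y) = I.toQuot x * I.toQuot y := rfl

instance (I : AlgIdeal F A) : NonUnitalNonAssocCommRing I.Quot where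
  left_distrib x y z := (I.mulQ x).map_add y z
  right_distrib x y z := I.mulQ.map_add₂ x y z
  zero_mul x := I.mulQ.map_zero₂ x
  mul_zero x := (I.mulQ x).map_zero
  mul_comm x y := by
    obtain ⟨x, rfl⟩ := I.toQuot_surjective x
    obtain ⟨y, rfl⟩ := I.toQuot_surjective y
    rw [← toQuot_mul, ← toQuot_mul, mul_comm]

instance (I : AlgIdeal F A) : IsScalarTower F I.Quot I.Quot :=
  ⟨fun c x y => I.mulQ.map_smul₂ c x y⟩

instance (I : AlgIdeal F A) : SMulCommClass F I.Quot I.Quot :=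
  ⟨fun c x y => ((I.mulQ x).map_smul c y).symm⟩

end AlgIdeal

/-! ### Fusion laws, axes, Miyamoto involutions, axets, property (J) -/

/-- A fusion law: a set `vals` of scalars with a symmetric map `star : vals × vals → 2 ^ vals`
(the values of `star` outside `vals` are not used). -/
structure FusionLaw (F : Type*) where
  vals : Set F
  star : F → F → Set F
  star_comm : ∀ x ∈ vals, ∀ y ∈ vals, star x y = star y x
  star_subset : ∀ x ∈ vals, ∀ y ∈ vals, star x y ⊆ vals

/-- The Jordan fusion law `J(η)`; the listed triples `(x, y, z)` are those with `z ∈ x ⋆ y`. -/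
def jordanLaw {F : Type*} [Field F] (η : F) : FusionLaw F where
  vals := {1, 0, η}
  star x y := {z | (x, y, z) ∈ ({(1, 1, 1), (0, 0, 0),
    (1, η, η), (η, 1, η), (0, η, η), (η, 0, η),
    (η, η, 1), (η, η, 0)} : Set (F × F × F))}
  star_comm x _ y _ := by
    ext z
    simp only [Set.mem_insert_iff, Set.mem_singleton_iff, Prod.mk.injEq, Set.mem_ofPred_eq]
    constructor <;> intro h <;>
      rcases h with
        ⟨rfl, rfl, rfl⟩ | ⟨rfl, rfl, rfl⟩ | ⟨rfl, rfl, rfl⟩ | ⟨rfl, rfl, rfl⟩ | ⟨rfl, rfl, rfl⟩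
        | ⟨rfl, rfl, rfl⟩ | ⟨rfl, rfl, rfl⟩ | ⟨rfl, rfl, rfl⟩ <;>
      simp
  star_subset x _ y _ z h := by
    simp only [Set.mem_insert_iff, Set.mem_singleton_iff, Prod.mk.injEq, Set.mem_ofPred_eq] at h ⊢
    rcases h with
        ⟨rfl, rfl, rfl⟩ | ⟨rfl, rfl, rfl⟩ | ⟨rfl, rfl, rfl⟩ | ⟨rfl, rfl, rfl⟩ | ⟨rfl, rfl, rfl⟩
        | ⟨rfl, rfl, rfl⟩ | ⟨rfl, rfl, rfl⟩ | ⟨rfl, rfl, rfl⟩ <;>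
      simp

/-- The Monster fusion law `M(α, β)`; the listed triples `(x, y, z)` are those with `z ∈ x ⋆ y`. -/
def monsterLaw {F : Type*} [Field F] (α β : F) : FusionLaw F where
  vals := {1, 0, α, β}
  star x y := {z | (x, y, z) ∈ ({(1, 1, 1), (0, 0, 0),
    (1, α, α), (α, 1, α), (0, α, α), (α, 0, α),
    (1, β, β), (β, 1, β), (0, β, β), (β, 0, β), (α, β, β), (β, α, β),
    (α, α, 1), (α, α, 0),
    (β, β, 1), (β, β, 0), (β, β, α)} : Set (F × F × F))}
  star_comm x _ y _ := by
    ext z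
    simp only [Set.mem_insert_iff, Set.mem_singleton_iff, Prod.mk.injEq, Set.mem_ofPred_eq]
    constructor <;> intro h <;>
      rcases h with
        ⟨rfl, rfl, rfl⟩ | ⟨rfl, rfl, rfl⟩ | ⟨rfl, rfl, rfl⟩ | ⟨rfl, rfl, rfl⟩ | ⟨rfl, rfl, rfl⟩
        | ⟨rfl, rfl, rfl⟩ | ⟨rfl, rfl, rfl⟩ | ⟨rfl, rfl, rfl⟩ | ⟨rfl, rfl, rfl⟩ | ⟨rfl, rfl,
        rfl⟩ | ⟨rfl, rfl, rfl⟩ | ⟨rfl, rfl, rfl⟩ | ⟨rfl, rfl, rfl⟩ | ⟨rfl, rfl, rfl⟩ | ⟨rfl,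
        rfl, rfl⟩ | ⟨rfl, rfl, rfl⟩ | ⟨rfl, rfl, rfl⟩ <;>
      simp
  star_subset x _ y _ z h := by
    simp only [Set.mem_insert_iff, Set.mem_singleton_iff, Prod.mk.injEq, Set.mem_ofPred_eq] at h ⊢
    rcases h with
        ⟨rfl, rfl, rfl⟩ | ⟨rfl, rfl, rfl⟩ | ⟨rfl, rfl, rfl⟩ | ⟨rfl, rfl, rfl⟩ | ⟨rfl, rfl, rfl⟩
        | ⟨rfl, rfl, rfl⟩ | ⟨rfl, rfl, rfl⟩ | ⟨rfl, rfl, rfl⟩ | ⟨rfl, rfl, rfl⟩ | ⟨rfl, rfl,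
        rfl⟩ | ⟨rfl, rfl, rfl⟩ | ⟨rfl, rfl, rfl⟩ | ⟨rfl, rfl, rfl⟩ | ⟨rfl, rfl, rfl⟩ | ⟨rfl,
        rfl, rfl⟩ | ⟨rfl, rfl, rfl⟩ | ⟨rfl, rfl, rfl⟩ <;>
      simp

section Axial

variable {F A : Type*} [Field F] [NonUnitalNonAssocCommRing A] [Module F A]
  [IsScalarTower F A A] [SMulCommClass F A A]

/-- The eigenspace `A_x(a) = {v | a * v = x • v}` of multiplication by `a`. -/
def axEig (a : A) (x : F) : Submodule F A :=
  Module.End.eigenspace (LinearMap.mulLeft F a) x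

/-- `a` is an axis for the fusion law `L`: an idempotent, semisimple with eigenvalues in `L`, and
with eigenvectors multiplying according to `L`. (Eigenspaces for distinct eigenvalues are
independent, so the supremum is a direct sum.) -/
structure IsAxis (L : FusionLaw F) (a : A) : Prop where
  idem : a * a = a
  semisimple : ⨆ x ∈ L.vals, axEig a x = ⊤
  fusion : ∀ x ∈ L.vals, ∀ y ∈ L.vals, ∀ u ∈ axEig a x, ∀ v ∈ axEig a y,
    u * v ∈ ⨆ z ∈ L.star x y, axEig a z

/-- `a` is primitive: its `1`-eigenspace is one-dimensional and spanned by `a`. -/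
def IsPrimitiveAxis (F : Type*) {A : Type*} [Field F] [NonUnitalNonAssocCommRing A] [Module F A]
    [IsScalarTower F A A] [SMulCommClass F A A] (a : A) : Prop :=
  a ≠ 0 ∧ axEig a (1 : F) = Submodule.span F {a}

/-- `A` with the set `X` is a primitive `L`-axial algebra. -/
def IsPrimitiveAxialAlgebra (L : FusionLaw F) (X : Set A) : Prop :=
  NonUnitalAlgebra.adjoin F X = ⊤ ∧ ∀ x ∈ X, IsAxis L x ∧ IsPrimitiveAxis F x

/-- `t` is the algebra automorphism of `A` that is the identity on the eigenspaces of `a` for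
eigenvalues in `plus`, and minus the identity on those for eigenvalues in `minus`. If `A` is the
sum of these eigenspaces, there is at most one such `t`; if moreover `a` satisfies a fusion law
that is graded by `plus` and `minus`, there is one. -/
def IsMiyamoto (plus minus : Set F) (a : A) (t : A ≃ₗ[F] A) : Prop :=
  (∀ u v : A, t (u * v) = t u * t v) ∧
  (∀ x ∈ plus, ∀ v ∈ axEig a x, t v = v) ∧
  (∀ x ∈ minus, ∀ v ∈ axEig a x, t v = -v)

/-- `t` is the Miyamoto involution `τ_a` of an axis `a` of Monster type `(α, β)`. -/
def IsTau (α β : F) (a : A) (t : A ≃ₗ[F] A) : Prop := IsMiyamoto {1, 0, α} {β} a t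

/-- `s` is the Miyamoto automorphism `σ_a` of an axis `a` of Jordan type `η`. -/
def IsSigma (η : F) (a : A) (s : A ≃ₗ[F] A) : Prop := IsMiyamoto {1, 0} {η} a s

/-- The Miyamoto group generated by the `τ_x`, `x ∈ X`. -/
def miyGroup (α β : F) (X : Set A) : Subgroup (A ≃ₗ[F] A) :=
  Subgroup.closure {t | ∃ x ∈ X, IsTau α β x t}

/-- The orbit of `y` under the Miyamoto group of `X`. -/
def miyOrbit (α β : F) (X : Set A) (y : A) : Set A :=
  {z | ∃ g ∈ miyGroup α β X, g y = z}

/-- The axet `a ^ Miy ∪ b ^ Miy` of a 2-generated axial algebra with generating axes `a`, `b`. -/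
def axet₂ (α β : F) (a b : A) : Set A := miyOrbit α β {a, b} a ∪ miyOrbit α β {a, b} b

/-- The set of axes `X`, with its Miyamoto involutions, is isomorphic as a `C₂`-axet to the
`N`-gonal axet `X(N)`: the vertices `i ∈ ℤ/N` of the `N`-gon, where `τ_i` is the reflection
`j ↦ 2 i - j` fixing `i`. -/
def IsNGonalAxet (α β : F) (N : ℕ) (X : Set A) : Prop :=
  ∃ e : ZMod N ≃ X, ∀ i : ZMod N, ∃ t : A ≃ₗ[F] A, IsTau α β (e i : A) t ∧
    ∀ j : ZMod N, t (e j) = e (2 * i - j)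

/-- `A` is a primitive axial algebra of Monster type `(α, β)` generated by the two axes `a`, `b`,
and its axet is isomorphic to `X(N)`. -/
def HasAxet (α β : F) (a b : A) (N : ℕ) : Prop :=
  NonUnitalAlgebra.adjoin F {a, b} = ⊤ ∧
  IsPrimitiveAxialAlgebra (monsterLaw α β) (axet₂ α β a b) ∧
  IsNGonalAxet α β N (axet₂ α β a b)

/-- Property (J) of an algebra of Monster type `(α, β)` generated by the axes `a`, `b`, with axet
`X`: there is an additional primitive axis `c` of Jordan type `α`, fixed by the Miyamoto group
of `X`, such that `σ_c` switches the two halves (the orbits of `a` and `b`) of `X`. -/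
def PropertyJ (α β : F) (a b : A) : Prop :=
  ∃ c : A, c ∉ axet₂ α β a b ∧ IsAxis (jordanLaw α) c ∧ IsPrimitiveAxis F c ∧
    (∀ g ∈ miyGroup α β (axet₂ α β a b), g c = c) ∧
    ∃ s : A ≃ₗ[F] A, IsSigma α c s ∧
      s '' miyOrbit α β (axet₂ α β a b) a = miyOrbit α β (axet₂ α β a b) b ∧
      s '' miyOrbit α β (axet₂ α β a b) b = miyOrbit α β (axet₂ α β a b) a

end Axial

/-! ### The cover of the Highwater algebra -/

namespace Highwater

/-- The index set of the basis of the cover: `a_i` for `i ∈ ℤ`, `s_j` for `j ≥ 1`, and `p_{r,k}` for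
`r ∈ {1, 2} ⊆ ℤ/3` and `k ≥ 1` a multiple of `3`. -/
inductive Idx : Type
  | a (i : ℤ) : Idx
  | s (j : {j : ℕ // 0 < j}) : Idx
  | p (r : {r : ZMod 3 // r ≠ 0}) (k : {k : ℕ // 0 < k ∧ 3 ∣ k}) : Idx

/-- The cover of the Highwater algebra, as a vector space. -/
def Cover (F : Type*) [Field F] : Type _ := Idx →₀ F

variable (F : Type*) [Field F]

instance : AddCommGroup (Cover F) := inferInstanceAs (AddCommGroup (Idx →₀ F))

instance : Module F (Cover F) := inferInstanceAs (Module F (Idx →₀ F))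

/-- The basis of the cover. -/
def basis : Module.Basis Idx F (Cover F) := Finsupp.basisSingleOne

/-- The element `a_i`. -/
def a (i : ℤ) : Cover F := basis F (Idx.a i)

/-- The element `s_j`, with `s_0 = 0`. -/
def s (j : ℕ) : Cover F := if h : 0 < j then basis F (Idx.s ⟨j, h⟩) else 0

/-- The element `p_{r,j}`, with `p_{r,j} = 0` unless `j` is a positive multiple of `3`, and
`p_{0,j} = - p_{1,j} - p_{2,j}`. -/
def p (r : ZMod 3) (j : ℕ) : Cover F :=
  if hj : 0 < j ∧ 3 ∣ j then
    if hr : r ≠ 0 then basis F (Idx.p ⟨r, hr⟩ ⟨j, hj⟩)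
    else -basis F (Idx.p ⟨1, by decide⟩ ⟨j, hj⟩) - basis F (Idx.p ⟨2, by decide⟩ ⟨j, hj⟩)
  else 0

/-- `z_{r,j} = p_{r+1,j} - p_{r-1,j}`. -/
def z (r : ZMod 3) (j : ℕ) : Cover F := p F (r + 1) j - p F (r - 1) j

/-- The product `a_i a_j`. -/
def mulAA (i j : ℤ) : Cover F :=
  (1 / 2 : F) • (a F i + a F j) + s F (i - j).natAbs + z F i (i - j).natAbs

/-- The product `a_i s_j`. -/
def mulAS (i : ℤ) (j : ℕ) : Cover F :=
  -(3 / 4 : F) • a F i + (3 / 8 : F) • (a F (i - j) + a F (i + j)) + (3 / 2 : F) • s F j - z F i j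

/-- The product `a_i p_{r,j}`. -/
def mulAP (i : ℤ) (r : ZMod 3) (j : ℕ) : Cover F :=
  (3 / 2 : F) • p F r j - p F (-(i + r)) j

/-- The product `s_j s_l`. -/
def mulSS (j l : ℕ) : Cover F :=
  (3 / 4 : F) • (s F j + s F l) - (3 / 8 : F) • (s F ((j : ℤ) - l).natAbs + s F (j + l))

/-- The product `s_j p_{r,k}`. -/
def mulSP (j : ℕ) (r : ZMod 3) (k : ℕ) : Cover F :=
  (3 / 4 : F) • (p F r j + p F r k) - (3 / 8 : F) • (p F r ((j : ℤ) - k).natAbs + p F r (j + k))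

/-- The product `p_{r,h} p_{t,k}`. -/
def mulPP (r : ZMod 3) (h : ℕ) (t : ZMod 3) (k : ℕ) : Cover F :=
  (1 / 4 : F) • (z F (-(r + t)) h + z F (-(r + t)) k)
    - (1 / 8 : F) • (z F (-(r + t)) ((h : ℤ) - k).natAbs + z F (-(r + t)) (h + k))

/-- The product of two basis elements. -/
def mulBasis : Idx → Idx → Cover F
  | .a i, .a j => mulAA F i j
  | .a i, .s j => mulAS F i j
  | .s j, .a i => mulAS F i j
  | .a i, .p r k => mulAP F i r k
  | .p r k, .a i => mulAP F i r k
  | .s j, .s l => mulSS F j l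
  | .s j, .p r k => mulSP F j r k
  | .p r k, .s j => mulSP F j r k
  | .p r h, .p t k => mulPP F r h t k

theorem z_congr (i j : ℤ) : z F i (i - j).natAbs = z F j (i - j).natAbs := by
  by_cases h : 3 ∣ (i - j).natAbs
  · have h' : (i : ZMod 3) = j := by
      have h1 : ((3 : ℕ) : ℤ) ∣ i - j := Int.natCast_dvd.2 h
      have h2 := (ZMod.intCast_zmod_eq_zero_iff_dvd (i - j) 3).2 h1
      rw [Int.cast_sub] at h2
      exact sub_eq_zero.1 h2
    rw [h']
  · simp [z, p, h]

theorem natAbs_sub_swap (i j : ℤ) : (i - j).natAbs = (j - i).natAbs := by omega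

theorem mulBasis_comm (x y : Idx) : mulBasis F x y = mulBasis F y x := by
  rcases x with i | j | ⟨r, k⟩ <;> rcases y with i' | j' | ⟨r', k'⟩ <;> simp only [mulBasis]
  · simp only [mulAA]
    rw [z_congr, natAbs_sub_swap i i', add_comm (a F i)]
  · simp only [mulSS]
    rw [natAbs_sub_swap, add_comm (s F j), add_comm (j : ℕ)]
  · simp only [mulPP]
    rw [natAbs_sub_swap, add_comm (r : ZMod 3), add_comm (k : ℕ), add_comm (z F _ (k : ℕ))]

/-- The bilinear extension of the product of basis elements. -/
def mulLin : Cover F →ₗ[F] Cover F →ₗ[F] Cover F :=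
  (basis F).constr F fun x => (basis F).constr F fun y => mulBasis F x y

theorem mulLin_basis (x y : Idx) : mulLin F (basis F x) (basis F y) = mulBasis F x y := by
  simp [mulLin]

theorem mulLin_flip : (mulLin F).flip = mulLin F := by
  refine (basis F).ext fun x => (basis F).ext fun y => ?_
  rw [LinearMap.flip_apply, mulLin_basis, mulLin_basis, mulBasis_comm]

instance : Mul (Cover F) := ⟨fun x y => mulLin F x y⟩

theorem mul_def (x y : Cover F) : x * y = mulLin F x y := rfl

/-- The cover of the Highwater algebra, as a commutative non-associative algebra. -/
instance : NonUnitalNonAssocCommRing (Cover F) where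
  left_distrib x y w := (mulLin F x).map_add y w
  right_distrib x y w := (mulLin F).map_add₂ x y w
  zero_mul x := (mulLin F).map_zero₂ x
  mul_zero x := (mulLin F x).map_zero
  mul_comm x y := by
    rw [mul_def, mul_def, ← LinearMap.flip_apply, mulLin_flip]

instance : IsScalarTower F (Cover F) (Cover F) :=
  ⟨fun c x y => (mulLin F).map_smul₂ c x y⟩

instance : SMulCommClass F (Cover F) (Cover F) :=
  ⟨fun c x y => ((mulLin F x).map_smul c y).symm⟩

/-- The set of all `p_{r,j}`. Its span `J` is an ideal, and the Highwater algebra is the quotient of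
the cover by `J`. -/
def pSet : Set (Cover F) := {x | ∃ (r : ZMod 3) (j : ℕ), x = p F r j}

/-- The ideal `I_m` of the cover generated by `a_0 - a_m`; the cover quotient with axet `X(m)` is the
quotient of the cover by `I_m`. -/
def coverIdeal (m : ℕ) : AlgIdeal F (Cover F) := AlgIdeal.span F {a F 0 - a F m}

/-- The ideal `J + I_m` of the cover; the Highwater quotient with axet `X(m)` is the quotient of the
cover by `J + I_m`. -/
def highwaterIdeal (m : ℕ) : AlgIdeal F (Cover F) := AlgIdeal.span F (pSet F ∪ {a F 0 - a F m})

/-- The ideals `K` of the cover that contain the ideal `I` and whose quotient (a quotient of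
`Cover / I`), with the images of `a_0` and `a_1` as generating axes of Monster type `(2, 1/2)`,
has axet `X(m)` and property (J). -/
def idealsJ (m : ℕ) (I : AlgIdeal F (Cover F)) : Set (AlgIdeal F (Cover F)) :=
  {K | I ≤ K ∧ HasAxet (2 : F) (1 / 2) (K.toQuot (a F 0)) (K.toQuot (a F 1)) m ∧
    PropertyJ (2 : F) (1 / 2) (K.toQuot (a F 0)) (K.toQuot (a F 1))}

end Highwater

end

set_option linter.unusedSectionVars false
set_option linter.unnecessarySeqFocus false

noncomputable section

/-! ### Axes and their Miyamoto involutions from spanning sets of eigenvectors. -/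

section AxialGeneral

variable {F A : Type*} [Field F] [NonUnitalNonAssocCommRing A] [Module F A]
  [IsScalarTower F A A] [SMulCommClass F A A]

/-! Both universal quotients are written down explicitly, as one `Model` depending on a proposition
`b`: `b` is false for the quotient of the Highwater algebra and true for that of the cover when `3 ∣
n` and the characteristic is 5. Its basis consists of the Jordan axis c, of d_i (i mod n), of w_j (j
mod n up to sign) and, if `b` holds, of q_{r,j} for 3 ∣ j. The dimensions are then a count of
indices. These are coordinates adapted to c: up to the sign (-1)^i, d_i is a_i - a_{i+n}, while w_j
and q_{r,j} are, up to (-1)^j, s_j - s_n/2 and p_{r,j} - p_{r,n}/2. The d_i span the 2-eigenspace of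
c, the w_j and q_{r,j} its 0-eigenspace.

The model has the required properties. `toModel` is a surjective homomorphism (`toModel_mul`,
`toModel_surjective`); the terms in q leave defects that are multiples of 5, whence the condition on
the characteristic. Explicit eigenvectors, with their products, show that the image of each a_i is a
primitive axis (`isAxis_toQuot_a`), and so is c (`isAxis_fromModel_C`). The involution σ_c negates
the d_i, so it sends a_i to a_{i+n}; as n is odd, this exchanges the two parity classes, which are
the two halves of the axet.

The model is universal. In any quotient of the cover with the two properties, τ_{a_i} maps a_k to
a_{2i-k}, and the a_k have exact period 2n (`A_eq_iff_of_hasAxet`). Since σ_c commutes with all τ's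
and exchanges the halves, it is again the shift by n. As c is fixed by τ_{a_i}, the eigenvalues 1,
0, 2 leave only one possibility, s_n + z_{i,n} = -c + (a_i + a_{i+n})/2
(`exists_axis_of_propertyJ`). Multiplying this expression for c by a_k yields s_j + s_{j-n} = s_n,
and the same for the p_{r,j} with 3 ∣ j (`folding_relations`). These relations say that the signed
differences above depend only on classes modulo n, so they define a map from the model inverting the
change of coordinates (`exists_comp_toModel`), and the kernel of `toModel` lies in every admissible
ideal. If 3 does not divide n, the period 2n already kills every p_{r,j} (`idealsJ_coverIdeal`), so
the cover gives nothing new. -/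

theorem mem_axEig {a v : A} {x : F} : v ∈ axEig a x ↔ a * v = x • v := by
  rw [axEig, Module.End.mem_eigenspace_iff, LinearMap.mulLeft_apply]

theorem axEig_iSupIndep (a : A) : iSupIndep (fun x : F => axEig a x) :=
  Module.End.eigenspaces_iSupIndep _

/-- Subspaces of eigenspaces that together span are the full eigenspaces. -/
theorem axEig_eq_of_iSup_eq_top {a : A} {S : Set F} {U : F → Submodule F A}
    (hU : ∀ x ∈ S, U x ≤ axEig a x) (htop : ⨆ x ∈ S, U x = ⊤) {x : F} (hx : x ∈ S) :
    axEig a x = U x := by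
  -- Every `U y` lies in `U x` or in the sum of the other eigenspaces. Intersecting with the
  -- eigenspace of `x`, the modular law and independence leave only `U x`.
  have hle : (⨆ y ∈ S, U y) ≤ U x ⊔ ⨆ y ≠ x, axEig a y := by
    refine iSup₂_le fun y hy => ?_
    by_cases hyx : y = x
    · subst hyx
      exact le_sup_left
    · exact ((hU y hy).trans (le_iSup₂ (f := fun y (_ : y ≠ x) => axEig a y) y hyx)).trans
        le_sup_right
  have h1 : axEig a x ≤ (U x ⊔ ⨆ y ≠ x, axEig a y) ⊓ axEig a x :=
    le_inf (le_top.trans (htop.symm.le.trans hle)) le_rfl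
  rw [sup_inf_assoc_of_le _ (hU x hx), inf_comm, (axEig_iSupIndep a x).eq_bot, sup_bot_eq] at h1
  exact le_antisymm h1 (hU x hx)

/-- To check that `a` is an axis it suffices to look at a spanning set of eigenvectors. -/
theorem isAxis_of_generators {L : FusionLaw F} {a : A} (G : F → Set A) (hidem : a * a = a)
    (hG : ∀ x ∈ L.vals, ∀ g ∈ G x, a * g = x • g)
    (hspan : ⨆ x ∈ L.vals, Submodule.span F (G x) = ⊤)
    (hmul : ∀ x ∈ L.vals, ∀ y ∈ L.vals, ∀ g ∈ G x, ∀ h ∈ G y,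
      g * h ∈ ⨆ z ∈ L.star x y, axEig a z) :
    IsAxis L a ∧ ∀ x ∈ L.vals, axEig a x = Submodule.span F (G x) := by
  have hle : ∀ x ∈ L.vals, Submodule.span F (G x) ≤ axEig a x := fun x hx =>
    Submodule.span_le.2 fun g hg => mem_axEig.2 (hG x hx g hg)
  have heq : ∀ x ∈ L.vals, axEig a x = Submodule.span F (G x) := fun x hx =>
    axEig_eq_of_iSup_eq_top (U := fun x => Submodule.span F (G x)) hle hspan hx
  refine ⟨⟨hidem, ?_, ?_⟩, heq⟩
  · exact top_le_iff.1 (hspan.symm.le.trans (iSup₂_mono hle))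
  · intro x hx y hy u hu v hv
    rw [heq x hx] at hu
    rw [heq y hy] at hv
    induction hu, hv using Submodule.span_induction₂ with
    | mem_mem g h hg hh => exact hmul x hx y hy g hg h hh
    | zero_left => rw [zero_mul]; exact zero_mem _
    | zero_right => rw [mul_zero]; exact zero_mem _
    | add_left _ _ _ _ _ _ h1 h2 => rw [add_mul]; exact add_mem h1 h2
    | add_right _ _ _ _ _ _ h1 h2 => rw [mul_add]; exact add_mem h1 h2
    | smul_left r _ _ _ _ h => rw [smul_mul_assoc]; exact Submodule.smul_mem _ _ h
    | smul_right r _ _ _ _ h => rw [mul_smul_comm]; exact Submodule.smul_mem _ _ h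

theorem mem_iSup_axEig {a v : A} {S : Set F} {x : F} (hx : x ∈ S) (hv : v ∈ axEig a x) :
    v ∈ ⨆ z ∈ S, axEig a z :=
  (le_iSup₂ (f := fun z (_ : z ∈ S) => axEig a z) x hx) hv

/-- Any axis of a fusion law graded by `plus` and `minus` has a Miyamoto involution. -/
theorem IsAxis.exists_isMiyamoto {L : FusionLaw F} {a : A} (h : IsAxis L a) (plus minus : Set F)
    (hL : L.vals = plus ∪ minus) (hd : Disjoint plus minus)
    (hpp : ∀ x ∈ plus, ∀ y ∈ plus, L.star x y ⊆ plus)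
    (hpm : ∀ x ∈ plus, ∀ y ∈ minus, L.star x y ⊆ minus)
    (hmm : ∀ x ∈ minus, ∀ y ∈ minus, L.star x y ⊆ plus) :
    ∃ t : A ≃ₗ[F] A, IsMiyamoto plus minus a t := by
  have hmul : ∀ {S T R : Set F}, S ⊆ L.vals → T ⊆ L.vals →
      (∀ x ∈ S, ∀ y ∈ T, L.star x y ⊆ R) → ∀ u ∈ ⨆ x ∈ S, axEig a x, ∀ v ∈ ⨆ x ∈ T, axEig a x,
      u * v ∈ ⨆ x ∈ R, axEig a x := by
    intro S T R hS hT hR u hu v hv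
    induction hu using Submodule.iSup_induction' with
    | zero => rw [zero_mul]; exact zero_mem _
    | add _ _ _ _ h1 h2 => rw [add_mul]; exact add_mem h1 h2
    | mem x u hu =>
      induction hu using Submodule.iSup_induction' with
      | zero => rw [zero_mul]; exact zero_mem _
      | add _ _ _ _ h1 h2 => rw [add_mul]; exact add_mem h1 h2
      | mem hx u hu =>
        induction hv using Submodule.iSup_induction' with
        | zero => rw [mul_zero]; exact zero_mem _
        | add _ _ _ _ h1 h2 => rw [mul_add]; exact add_mem h1 h2
        | mem y v hv =>
          induction hv using Submodule.iSup_induction' with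
          | zero => rw [mul_zero]; exact zero_mem _
          | add _ _ _ _ h1 h2 => rw [mul_add]; exact add_mem h1 h2
          | mem hy v hv =>
            exact (show (⨆ z ∈ L.star x y, axEig a z) ≤ ⨆ z ∈ R, axEig a z from
              biSup_mono fun z hz => hR x hx y hy hz) (h.fusion x (hS hx) y (hT hy) u hu v hv)
  have hPs : plus ⊆ L.vals := hL ▸ Set.subset_union_left
  have hNs : minus ⊆ L.vals := hL ▸ Set.subset_union_right
  set P := ⨆ x ∈ plus, axEig a x with hP
  set N := ⨆ x ∈ minus, axEig a x with hN
  have hc : IsCompl P N := by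
    refine ⟨(axEig_iSupIndep a).disjoint_biSup_biSup hd, ?_⟩
    rw [codisjoint_iff, hP, hN, ← iSup_union, ← hL, h.semisimple]
  -- Twice the projection minus the identity is 1 on `P` and -1 on `N`; the grading of the fusion
  -- law makes it multiplicative.
  let f : A →ₗ[F] A := (2 : F) • P.projection N hc - LinearMap.id
  have fP : ∀ u ∈ P, f u = u := fun u hu => by
    have := Submodule.projection_apply_left hc ⟨u, hu⟩
    simp only [f, LinearMap.sub_apply, LinearMap.smul_apply, LinearMap.id_apply]
    rw [this, two_smul]
    abel
  have fN : ∀ u ∈ N, f u = -u := fun u hu => by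
    have := Submodule.projection_apply_right hc ⟨u, hu⟩
    simp only [f, LinearMap.sub_apply, LinearMap.smul_apply, LinearMap.id_apply]
    rw [this]
    simp
  have hdec : ∀ u : A, ∃ x ∈ P, ∃ y ∈ N, x + y = u := fun u =>
    Submodule.mem_sup.1 (hc.sup_eq_top ▸ Submodule.mem_top)
  have hinv : Function.Involutive f := by
    intro u
    obtain ⟨x, hx, y, hy, rfl⟩ := hdec u
    rw [map_add, fP x hx, fN y hy, map_add, map_neg, fP x hx, fN y hy, neg_neg]
  refine ⟨LinearEquiv.ofInvolutive f hinv, ?_, ?_, ?_⟩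
  · intro u v
    obtain ⟨x, hx, y, hy, rfl⟩ := hdec u
    obtain ⟨x', hx', y', hy', rfl⟩ := hdec v
    have h1 := fP _ (hmul hPs hPs hpp x hx x' hx')
    have h2 := fN _ (hmul hPs hNs hpm x hx y' hy')
    have h3 := fN _ (hmul hPs hNs hpm x' hx' y hy)
    have h4 := fP _ (hmul hNs hNs hmm y hy y' hy')
    rw [mul_comm x' y] at h3
    simp only [LinearEquiv.coe_ofInvolutive, map_add, add_mul, mul_add, fP x hx, fP x' hx',
      fN y hy, fN y' hy', h1, h2, h3, h4, neg_mul, mul_neg]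
    abel
  · exact fun x hx v hv => fP v (mem_iSup_axEig hx hv)
  · exact fun x hx v hv => fN v (mem_iSup_axEig hx hv)

theorem IsAxis.exists_isTau {α β : F} {a : A} (h : IsAxis (monsterLaw α β) a) (h1 : β ≠ 1)
    (h0 : β ≠ 0) (h2 : β ≠ α) : ∃ t : A ≃ₗ[F] A, IsTau α β a t := by
  refine h.exists_isMiyamoto {1, 0, α} {β} ?_ ?_ ?_ ?_ ?_
  · ext; simp [monsterLaw]; tauto
  · simp [h1, h0, h2]
  all_goals
    simp only [monsterLaw, Set.mem_insert_iff, Set.mem_singleton_iff, Prod.mk.injEq]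
    intro x hx y hy z hz
    simp only [Set.mem_ofPred_eq, Set.mem_insert_iff, Set.mem_singleton_iff] at hz ⊢
    grind

theorem IsAxis.exists_isSigma {η : F} {a : A} (h : IsAxis (jordanLaw η) a) (h1 : η ≠ 1)
    (h0 : η ≠ 0) : ∃ t : A ≃ₗ[F] A, IsSigma η a t := by
  refine h.exists_isMiyamoto {1, 0} {η} ?_ ?_ ?_ ?_ ?_
  · ext; simp [jordanLaw]; tauto
  · simp [h1, h0]
  all_goals
    simp only [jordanLaw, Set.mem_insert_iff, Set.mem_singleton_iff, Prod.mk.injEq]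
    intro x hx y hy z hz
    simp only [Set.mem_ofPred_eq, Set.mem_insert_iff, Set.mem_singleton_iff] at hz ⊢
    grind

theorem span_union_le_axEig {a : A} {S : Set F} {G : Set A}
    (h : ∀ g ∈ G, ∃ x ∈ S, a * g = x • g) : Submodule.span F G ≤ ⨆ z ∈ S, axEig a z :=
  Submodule.span_le.2 fun g hg => by
    obtain ⟨x, hx, hgx⟩ := h g hg
    exact mem_iSup_axEig hx (mem_axEig.2 hgx)

/-- A criterion for axes of Monster type in terms of spanning sets of eigenvectors. -/
theorem isAxis_monster_of_generators {α β : F} {a : A} (hα1 : α ≠ 1) (hα0 : α ≠ 0) (hβ1 : β ≠ 1)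
    (hβ0 : β ≠ 0) (hβα : β ≠ α) (G0 Gα Gβ : Set A) (hidem : a * a = a)
    (h0 : ∀ g ∈ G0, a * g = 0) (hα : ∀ g ∈ Gα, a * g = α • g) (hβ : ∀ g ∈ Gβ, a * g = β • g)
    (hspan : Submodule.span F ({a} ∪ G0 ∪ Gα ∪ Gβ) = ⊤)
    (h00 : ∀ g ∈ G0, ∀ h ∈ G0, g * h ∈ Submodule.span F G0)
    (h0α : ∀ g ∈ G0, ∀ h ∈ Gα, g * h ∈ Submodule.span F Gα)
    (h0β : ∀ g ∈ G0, ∀ h ∈ Gβ, g * h ∈ Submodule.span F Gβ)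
    (hαα : ∀ g ∈ Gα, ∀ h ∈ Gα, g * h ∈ Submodule.span F ({a} ∪ G0))
    (hαβ : ∀ g ∈ Gα, ∀ h ∈ Gβ, g * h ∈ Submodule.span F Gβ)
    (hββ : ∀ g ∈ Gβ, ∀ h ∈ Gβ, g * h ∈ Submodule.span F ({a} ∪ G0 ∪ Gα)) :
    IsAxis (monsterLaw α β) a ∧ axEig a (1 : F) = Submodule.span F {a} := by
  classical
  -- The spanning sets are packed into one function of the eigenvalue; the distinctness hypotheses
  -- are what allows each branch to be evaluated.
  let G : F → Set A := fun x => if x = 1 then {a} else if x = 0 then G0 else if x = α then Gα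
    else Gβ
  have e1 : G 1 = {a} := by simp [G]
  have e0 : G 0 = G0 := by simp [G]
  have eα : G α = Gα := by simp [G, hα1, hα0]
  have eβ : G β = Gβ := by simp [G, hβ1, hβ0, hβα]
  have l1 : ∀ g ∈ ({a} : Set A), a * g = (1 : F) • g := by
    rintro g rfl; rw [hidem, one_smul]
  have l0 : ∀ g ∈ G0, a * g = (0 : F) • g := fun g hg => by rw [h0 g hg, zero_smul]
  have hvals : ∀ {P : F → Prop}, (∀ x ∈ (monsterLaw α β).vals, P x) ↔ P 1 ∧ P 0 ∧ P α ∧ P β := by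
    intro P; simp [monsterLaw]
  have key := isAxis_of_generators (L := monsterLaw α β) (a := a) G hidem ?_ ?_ ?_
  · refine ⟨key.1, ?_⟩
    rw [key.2 1 (by simp [monsterLaw]), e1]
  · rw [hvals, e1, e0, eα, eβ]
    exact ⟨l1, l0, hα, hβ⟩
  · rw [← hspan]
    simp only [monsterLaw, iSup_insert, iSup_singleton, e1, e0, eα, eβ, Submodule.span_union,
      sup_assoc]
  · have s1 : ∀ {S : Set F} {x : F}, x ∈ S → ∀ {H : Set A} {v : A}, (∀ g ∈ H, a * g = x • g) →
        v ∈ Submodule.span F H → v ∈ ⨆ z ∈ S, axEig a z := fun hx _ _ hH hv =>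
      span_union_le_axEig (fun g hg => ⟨_, hx, hH g hg⟩) hv
    simp only [hvals, e1, e0, eα, eβ]
    have hs0 : ∀ {H : Set A} {x : F}, (∀ g ∈ H, a * g = x • g) → ∀ g ∈ ({a} : Set A), ∀ h ∈ H,
        g * h ∈ Submodule.span F H := by
      rintro H x hH g rfl h hh
      rw [hH h hh]; exact Submodule.smul_mem _ _ (Submodule.subset_span hh)
    have hcomm : ∀ {H K L : Set A}, (∀ g ∈ H, ∀ h ∈ K, g * h ∈ Submodule.span F L) →
        ∀ g ∈ K, ∀ h ∈ H, g * h ∈ Submodule.span F L := fun hh g hg h hk => by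
      rw [mul_comm]; exact hh h hk g hg
    refine ⟨⟨?_, ?_, ?_, ?_⟩, ⟨?_, ?_, ?_, ?_⟩, ⟨?_, ?_, ?_, ?_⟩, ?_, ?_, ?_, ?_⟩
    · exact fun g hg h hh => s1 (x := 1) (by simp [monsterLaw]) l1 (hs0 l1 g hg h hh)
    · rintro g rfl h hh
      rw [h0 h hh]; exact zero_mem _
    · exact fun g hg h hh => s1 (x := α) (by simp [monsterLaw]) hα (hs0 hα g hg h hh)
    · exact fun g hg h hh => s1 (x := β) (by simp [monsterLaw]) hβ (hs0 hβ g hg h hh)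
    · rintro g hg h rfl
      rw [mul_comm, h0 g hg]; exact zero_mem _
    · exact fun g hg h hh => s1 (x := 0) (by simp [monsterLaw]) l0 (h00 g hg h hh)
    · exact fun g hg h hh => s1 (x := α) (by simp [monsterLaw]) hα (h0α g hg h hh)
    · exact fun g hg h hh => s1 (x := β) (by simp [monsterLaw]) hβ (h0β g hg h hh)
    · exact fun g hg h hh => s1 (x := α) (by simp [monsterLaw]) hα (hcomm (hs0 hα) g hg h hh)
    · exact fun g hg h hh => s1 (x := α) (by simp [monsterLaw]) hα (hcomm h0α g hg h hh)
    · refine fun g hg h hh => span_union_le_axEig ?_ (hαα g hg h hh)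
      rintro k (hk | hk)
      · exact ⟨1, by simp [monsterLaw], l1 k hk⟩
      · exact ⟨0, by simp [monsterLaw], l0 k hk⟩
    · exact fun g hg h hh => s1 (x := β) (by simp [monsterLaw]) hβ (hαβ g hg h hh)
    · exact fun g hg h hh => s1 (x := β) (by simp [monsterLaw]) hβ (hcomm (hs0 hβ) g hg h hh)
    · exact fun g hg h hh => s1 (x := β) (by simp [monsterLaw]) hβ (hcomm h0β g hg h hh)
    · exact fun g hg h hh => s1 (x := β) (by simp [monsterLaw]) hβ (hcomm hαβ g hg h hh)
    · refine fun g hg h hh => span_union_le_axEig ?_ (hββ g hg h hh)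
      rintro k ((hk | hk) | hk)
      · exact ⟨1, by simp [monsterLaw], l1 k hk⟩
      · exact ⟨0, by simp [monsterLaw], l0 k hk⟩
      · exact ⟨α, by simp [monsterLaw], hα k hk⟩

/-- A criterion for axes of Jordan type in terms of spanning sets of eigenvectors. -/
theorem isAxis_jordan_of_generators {η : F} {a : A} (hη1 : η ≠ 1) (hη0 : η ≠ 0)
    (G0 Gη : Set A) (hidem : a * a = a)
    (h0 : ∀ g ∈ G0, a * g = 0) (hη : ∀ g ∈ Gη, a * g = η • g)
    (hspan : Submodule.span F ({a} ∪ G0 ∪ Gη) = ⊤)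
    (h00 : ∀ g ∈ G0, ∀ h ∈ G0, g * h ∈ Submodule.span F G0)
    (h0η : ∀ g ∈ G0, ∀ h ∈ Gη, g * h ∈ Submodule.span F Gη)
    (hηη : ∀ g ∈ Gη, ∀ h ∈ Gη, g * h ∈ Submodule.span F ({a} ∪ G0)) :
    IsAxis (jordanLaw η) a ∧ axEig a (1 : F) = Submodule.span F {a} := by
  classical
  let G : F → Set A := fun x => if x = 1 then {a} else if x = 0 then G0 else Gη
  have e1 : G 1 = {a} := by simp [G]
  have e0 : G 0 = G0 := by simp [G]
  have eη : G η = Gη := by simp [G, hη1, hη0]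
  have l1 : ∀ g ∈ ({a} : Set A), a * g = (1 : F) • g := by
    rintro g rfl; rw [hidem, one_smul]
  have l0 : ∀ g ∈ G0, a * g = (0 : F) • g := fun g hg => by rw [h0 g hg, zero_smul]
  have hvals : ∀ {P : F → Prop}, (∀ x ∈ (jordanLaw η).vals, P x) ↔ P 1 ∧ P 0 ∧ P η := by
    intro P; simp [jordanLaw]
  have key := isAxis_of_generators (L := jordanLaw η) (a := a) G hidem ?_ ?_ ?_
  · refine ⟨key.1, ?_⟩
    rw [key.2 1 (by simp [jordanLaw]), e1]
  · rw [hvals, e1, e0, eη]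
    exact ⟨l1, l0, hη⟩
  · rw [← hspan]
    simp only [jordanLaw, iSup_insert, iSup_singleton, e1, e0, eη, Submodule.span_union,
      sup_assoc]
  · have s1 : ∀ {S : Set F} {x : F}, x ∈ S → ∀ {H : Set A} {v : A}, (∀ g ∈ H, a * g = x • g) →
        v ∈ Submodule.span F H → v ∈ ⨆ z ∈ S, axEig a z := fun hx _ _ hH hv =>
      span_union_le_axEig (fun g hg => ⟨_, hx, hH g hg⟩) hv
    simp only [hvals, e1, e0, eη]
    have hs0 : ∀ {H : Set A} {x : F}, (∀ g ∈ H, a * g = x • g) → ∀ g ∈ ({a} : Set A), ∀ h ∈ H,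
        g * h ∈ Submodule.span F H := by
      rintro H x hH g rfl h hh
      rw [hH h hh]; exact Submodule.smul_mem _ _ (Submodule.subset_span hh)
    have hcomm : ∀ {H K L : Set A}, (∀ g ∈ H, ∀ h ∈ K, g * h ∈ Submodule.span F L) →
        ∀ g ∈ K, ∀ h ∈ H, g * h ∈ Submodule.span F L := fun hh g hg h hk => by
      rw [mul_comm]; exact hh h hk g hg
    refine ⟨⟨?_, ?_, ?_⟩, ⟨?_, ?_, ?_⟩, ?_, ?_, ?_⟩
    · exact fun g hg h hh => s1 (x := 1) (by simp [jordanLaw]) l1 (hs0 l1 g hg h hh)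
    · rintro g rfl h hh
      rw [h0 h hh]; exact zero_mem _
    · exact fun g hg h hh => s1 (x := η) (by simp [jordanLaw]) hη (hs0 hη g hg h hh)
    · rintro g hg h rfl
      rw [mul_comm, h0 g hg]; exact zero_mem _
    · exact fun g hg h hh => s1 (x := 0) (by simp [jordanLaw]) l0 (h00 g hg h hh)
    · exact fun g hg h hh => s1 (x := η) (by simp [jordanLaw]) hη (h0η g hg h hh)
    · exact fun g hg h hh => s1 (x := η) (by simp [jordanLaw]) hη (hcomm (hs0 hη) g hg h hh)
    · exact fun g hg h hh => s1 (x := η) (by simp [jordanLaw]) hη (hcomm h0η g hg h hh)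
    · refine fun g hg h hh => span_union_le_axEig ?_ (hηη g hg h hh)
      rintro k (hk | hk)
      · exact ⟨1, by simp [jordanLaw], l1 k hk⟩
      · exact ⟨0, by simp [jordanLaw], l0 k hk⟩

end AxialGeneral

/-! ### The multiplication table of the cover, with integer indices. -/

namespace Highwater

/-- Elements `A i`, `S j`, `P r j` (with integer indices) of an algebra that multiply like the
elements `a_i`, `s_|j|`, `p_{r,|j|}` of the cover of the Highwater algebra. -/
structure IsCoverImage (F : Type*) {Q : Type*} [Field F] [NonUnitalNonAssocCommRing Q] [Module F Q]
    (A S : ℤ → Q) (P : ZMod 3 → ℤ → Q) : Prop where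
  S_zero : S 0 = 0
  S_neg (j : ℤ) : S (-j) = S j
  P_zero (r : ZMod 3) : P r 0 = 0
  P_neg (r : ZMod 3) (j : ℤ) : P r (-j) = P r j
  P_eq_zero (r : ZMod 3) {j : ℤ} (h : ¬ 3 ∣ j) : P r j = 0
  P_sum (r : ZMod 3) (j : ℤ) : P r j + P (r + 1) j + P (r - 1) j = 0
  mul_AA (i k : ℤ) : A i * A k = (1 / 2 : F) • (A i + A k) + S (i - k)
    + (P (i + 1) (i - k) - P (i - 1) (i - k))
  mul_AS (i j : ℤ) : A i * S j = -(3 / 4 : F) • A i + (3 / 8 : F) • (A (i - j) + A (i + j))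
    + (3 / 2 : F) • S j - (P (i + 1) j - P (i - 1) j)
  mul_AP (i : ℤ) (r : ZMod 3) (j : ℤ) : A i * P r j = (3 / 2 : F) • P r j - P (-(i + r)) j
  mul_SS (j l : ℤ) : S j * S l = (3 / 4 : F) • (S j + S l) - (3 / 8 : F) • (S (j - l) + S (j + l))
  mul_SP (j : ℤ) (r : ZMod 3) {k : ℤ} (hk : 3 ∣ k) : S j * P r k = (3 / 4 : F) • (P r j + P r k)
    - (3 / 8 : F) • (P r (j - k) + P r (j + k))
  mul_PP (r : ZMod 3) {h : ℤ} (t : ZMod 3) {k : ℤ} (hh : 3 ∣ h) (hk : 3 ∣ k) : P r h * P t k =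
    (1 / 4 : F) • ((P (-(r + t) + 1) h - P (-(r + t) - 1) h)
      + (P (-(r + t) + 1) k - P (-(r + t) - 1) k))
    - (1 / 8 : F) • ((P (-(r + t) + 1) (h - k) - P (-(r + t) - 1) (h - k))
      + (P (-(r + t) + 1) (h + k) - P (-(r + t) - 1) (h + k)))

variable {F : Type*} [Field F]

theorem p_zero (r : ZMod 3) : p F r 0 = 0 := by simp [p]

theorem p_of_not_dvd (r : ZMod 3) {j : ℕ} (h : ¬ 3 ∣ j) : p F r j = 0 := by simp [p, h]

theorem p_sum (r : ZMod 3) (j : ℕ) : p F r j + p F (r + 1) j + p F (r - 1) j = 0 := by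
  have key : p F 0 j + p F 1 j + p F 2 j = 0 := by
    unfold p
    by_cases hj : 0 < j ∧ 3 ∣ j
    · simp only [hj, and_self, dif_pos, ne_eq, not_true_eq_false, dif_neg, not_false_eq_true]
      rw [dif_pos (by decide), dif_pos (by decide)]
      abel
    · simp [hj]
  have h3 : r = 0 ∨ r = 1 ∨ r = 2 := by revert r; decide
  rcases h3 with rfl | rfl | rfl
  · rw [← key, show (0 : ZMod 3) + 1 = 1 by decide, show (0 : ZMod 3) - 1 = 2 by decide]
  · rw [← key, show (1 : ZMod 3) + 1 = 2 by decide, show (1 : ZMod 3) - 1 = 0 by decide]; abel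
  · rw [← key, show (2 : ZMod 3) + 1 = 0 by decide, show (2 : ZMod 3) - 1 = 1 by decide]; abel

theorem s_eq_basis {j : ℕ} (h : 0 < j) : s F j = basis F (.s ⟨j, h⟩) := by simp [s, h]

theorem p_eq_basis {r : ZMod 3} (hr : r ≠ 0) {j : ℕ} (h : 0 < j ∧ 3 ∣ j) :
    p F r j = basis F (.p ⟨r, hr⟩ ⟨j, h⟩) := by simp [p, h, hr]

theorem p_zero_eq (j : ℕ) : p F 0 j = -p F 1 j - p F 2 j := by
  have := p_sum (F := F) 0 j
  rw [show (0 : ZMod 3) + 1 = 1 by decide, show (0 : ZMod 3) - 1 = 2 by decide] at this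
  rw [← sub_eq_zero, ← this]; abel

theorem basis_mul_basis (x y : Idx) : basis F x * basis F y = mulBasis F x y := mulLin_basis F x y

theorem a_mul_a (i k : ℤ) : a F i * a F k = mulAA F i k := basis_mul_basis _ _

theorem four_ne_zero_of_two (h2 : (2 : F) ≠ 0) : (4 : F) ≠ 0 := by
  rw [show (4 : F) = 2 * 2 by norm_num]; exact mul_ne_zero h2 h2

theorem eight_ne_zero_of_two (h2 : (2 : F) ≠ 0) : (8 : F) ≠ 0 := by
  rw [show (8 : F) = 2 * 4 by norm_num]; exact mul_ne_zero h2 (four_ne_zero_of_two h2)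

theorem s_zero : s F 0 = 0 := by simp [s]

/-- For j = 0 the coefficients -3/4 + 3/8 + 3/8 of a_i cancel, so the convention s_0 = 0 is
consistent with the table. -/
theorem a_mul_s (h2 : (2 : F) ≠ 0) (i : ℤ) (j : ℕ) : a F i * s F j = mulAS F i j := by
  have h4 := four_ne_zero_of_two h2
  have h8 := eight_ne_zero_of_two h2
  rcases Nat.eq_zero_or_pos j with rfl | hj
  · simp only [mulAS, s_zero, z, p_zero, mul_zero, Nat.cast_zero, sub_zero, add_zero]
    match_scalars <;> field_simp <;> ring
  · rw [s_eq_basis hj]; exact basis_mul_basis _ _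

/-- A bilinear identity in `p_{r,j}` can be checked on the basis elements `p_{1,j}`, `p_{2,j}`. -/
theorem forall_p {M : Type*} [AddCommGroup M] {f : ZMod 3 → M} {j : ℕ} (g : Cover F →+ M)
    (hj : 0 < j ∧ 3 ∣ j) (hf : f 0 = -f 1 - f 2)
    (h : ∀ (r : ZMod 3) (hr : r ≠ 0), g (basis F (.p ⟨r, hr⟩ ⟨j, hj⟩)) = f r) (r : ZMod 3) :
    g (p F r j) = f r := by
  by_cases hr : r = 0
  · subst hr
    rw [p_zero_eq, map_sub, map_neg, hf, ← h 1 (by decide), ← h 2 (by decide),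
      p_eq_basis (by decide) hj, p_eq_basis (by decide) hj]
  · rw [p_eq_basis hr hj, h r hr]

theorem z_zero_eq (j : ℕ) : z F 0 j = -z F 1 j - z F 2 j := by
  simp only [z]
  rw [show (0 : ZMod 3) + 1 = 1 by decide, show (0 : ZMod 3) - 1 = 2 by decide,
    show (1 : ZMod 3) + 1 = 2 by decide, show (1 : ZMod 3) - 1 = 0 by decide,
    show (2 : ZMod 3) + 1 = 0 by decide, show (2 : ZMod 3) - 1 = 1 by decide]
  abel

/-- The map r ↦ -(t + r) permutes ℤ/3. This transfers the rule for p_{0,j} to the right-hand sides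
of the table. -/
theorem sum_zmod_three {M : Type*} [AddCommGroup M] (f : ZMod 3 → M) (t : ZMod 3)
    (hf : f 0 + f 1 + f 2 = 0) : f (-(t + 0)) = -f (-(t + 1)) - f (-(t + 2)) := by
  have h3 : t = 0 ∨ t = 1 ∨ t = 2 := by revert t; decide
  rw [← sub_eq_zero, ← hf]
  rcases h3 with rfl | rfl | rfl
  · rw [show -((0 : ZMod 3) + 0) = 0 by decide, show -((0 : ZMod 3) + 1) = 2 by decide,
      show -((0 : ZMod 3) + 2) = 1 by decide]; abel
  · rw [show -((1 : ZMod 3) + 0) = 2 by decide, show -((1 : ZMod 3) + 1) = 1 by decide,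
      show -((1 : ZMod 3) + 2) = 0 by decide]; abel
  · rw [show -((2 : ZMod 3) + 0) = 1 by decide, show -((2 : ZMod 3) + 1) = 0 by decide,
      show -((2 : ZMod 3) + 2) = 2 by decide]; abel

theorem p_sum' (j : ℕ) : p F 0 j + p F 1 j + p F 2 j = 0 := by
  rw [p_zero_eq]; abel

theorem z_sum (j : ℕ) : z F 0 j + z F 1 j + z F 2 j = 0 := by
  rw [z_zero_eq]; abel

theorem a_mul_p (i : ℤ) (r : ZMod 3) (j : ℕ) : a F i * p F r j = mulAP F i r j := by
  by_cases hj : 0 < j ∧ 3 ∣ j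
  · refine forall_p (f := fun r => mulAP F i r j) (AddMonoidHom.mulLeft (a F i)) hj ?_
      (fun r hr => (basis_mul_basis _ _)) r
    simp only [mulAP]
    rw [sum_zmod_three (fun r => p F r j) (i : ZMod 3) (p_sum' j), p_zero_eq]
    module
  · simp [mulAP, p, hj]

theorem s_mul_s (h2 : (2 : F) ≠ 0) (j l : ℕ) : s F j * s F l = mulSS F j l := by
  have h4 := four_ne_zero_of_two h2
  have h8 := eight_ne_zero_of_two h2
  rcases Nat.eq_zero_or_pos j with rfl | hj
  · simp only [mulSS, s_zero, zero_mul, Nat.cast_zero, zero_sub, zero_add, Int.natAbs_neg,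
      Int.natAbs_natCast]
    match_scalars <;> field_simp <;> ring
  rcases Nat.eq_zero_or_pos l with rfl | hl
  · simp only [mulSS, s_zero, mul_zero, Nat.cast_zero, sub_zero, add_zero, Int.natAbs_natCast]
    match_scalars <;> field_simp <;> ring
  · rw [s_eq_basis hj, s_eq_basis hl]; exact basis_mul_basis _ _

/-- Divisibility of `k` cannot be dropped: otherwise p_{r,k} = 0, but p_{r,j} on the right may
survive. -/
theorem s_mul_p (h2 : (2 : F) ≠ 0) (j : ℕ) (r : ZMod 3) {k : ℕ} (hk : 3 ∣ k) :
    s F j * p F r k = mulSP F j r k := by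
  have h4 := four_ne_zero_of_two h2
  have h8 := eight_ne_zero_of_two h2
  rcases Nat.eq_zero_or_pos j with rfl | hj
  · simp only [mulSP, s_zero, p_zero, zero_mul, Nat.cast_zero, zero_sub, zero_add, Int.natAbs_neg,
      Int.natAbs_natCast]
    match_scalars <;> field_simp <;> ring
  rcases Nat.eq_zero_or_pos k with rfl | hk0
  · simp only [mulSP, p_zero, mul_zero, Nat.cast_zero, sub_zero, add_zero, Int.natAbs_natCast]
    match_scalars <;> field_simp <;> ring
  · rw [s_eq_basis hj]
    refine forall_p (f := fun r => mulSP F j r k) (AddMonoidHom.mulLeft _) ⟨hk0, hk⟩ ?_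
      (fun r hr => (basis_mul_basis _ _)) r
    simp only [mulSP, p_zero_eq]
    module

theorem p_mul_p (h2 : (2 : F) ≠ 0) (r : ZMod 3) {h : ℕ} (t : ZMod 3) {k : ℕ} (hh : 3 ∣ h)
    (hk : 3 ∣ k) : p F r h * p F t k = mulPP F r h t k := by
  have h4 := four_ne_zero_of_two h2
  have h8 := eight_ne_zero_of_two h2
  have z0 : ∀ r, z F r 0 = 0 := fun r => by simp [z, p_zero]
  rcases Nat.eq_zero_or_pos h with rfl | hh0
  · simp only [mulPP, p_zero, z0, zero_mul, Nat.cast_zero, zero_sub, zero_add, Int.natAbs_neg,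
      Int.natAbs_natCast]
    match_scalars <;> field_simp <;> ring
  rcases Nat.eq_zero_or_pos k with rfl | hk0
  · simp only [mulPP, p_zero, z0, mul_zero, Nat.cast_zero, sub_zero, add_zero, Int.natAbs_natCast]
    match_scalars <;> field_simp <;> ring
  · refine forall_p (f := fun t => mulPP F r h t k) (AddMonoidHom.mulLeft _) ⟨hk0, hk⟩ ?_ ?_ t
    · simp only [mulPP]
      rw [sum_zmod_three (fun r => z F r h) r (z_sum _),
        sum_zmod_three (fun r => z F r k) r (z_sum _),
        sum_zmod_three (fun t => z F t (h + k)) r (z_sum _),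
        sum_zmod_three (fun t => z F t ((h : ℤ) - k).natAbs) r (z_sum _)]
      module
    · intro t ht
      refine forall_p (f := fun r => mulPP F r h t k)
        (AddMonoidHom.mulRight (basis F (.p ⟨t, ht⟩ ⟨k, hk0, hk⟩))) ⟨hh0, hh⟩ ?_
        (fun r hr => (basis_mul_basis _ _)) r
      simp only [mulPP]
      rw [add_comm 0 t, add_comm 1 t, add_comm 2 t, sum_zmod_three (fun r => z F r h) t (z_sum _),
        sum_zmod_three (fun r => z F r k) t (z_sum _),
        sum_zmod_three (fun r => z F r (h + k)) t (z_sum _),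
        sum_zmod_three (fun r => z F r ((h : ℤ) - k).natAbs) t (z_sum _)]
      module

/-- Replacing j, l by their absolute values at most exchanges |j - l| and |j + l|. This is why s and
p can be indexed by all integers without case distinctions. -/
theorem add_natAbs_comm {M : Type*} [AddCommGroup M] (f : ℕ → M) (j l : ℤ) :
    f ((j.natAbs : ℤ) - l.natAbs).natAbs + f (j.natAbs + l.natAbs)
      = f (j - l).natAbs + f (j + l).natAbs := by
  have : (((j.natAbs : ℤ) - l.natAbs).natAbs = (j - l).natAbs ∧
      j.natAbs + l.natAbs = (j + l).natAbs) ∨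
      (((j.natAbs : ℤ) - l.natAbs).natAbs = (j + l).natAbs ∧
      j.natAbs + l.natAbs = (j - l).natAbs) := by omega
  rcases this with ⟨h1, h2⟩ | ⟨h1, h2⟩
  · rw [h1, h2]
  · rw [h1, h2, add_comm]

theorem isCoverImage_cover (h2 : (2 : F) ≠ 0) :
    IsCoverImage F (a F) (fun j => s F j.natAbs) (fun r j => p F r j.natAbs) where
  S_zero := s_zero
  S_neg j := by rw [Int.natAbs_neg]
  P_zero r := p_zero r
  P_neg r j := by rw [Int.natAbs_neg]
  P_eq_zero r j h := p_of_not_dvd r (by omega)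
  P_sum r j := p_sum r _
  mul_AA i k := a_mul_a i k
  mul_AS i j := by
    rw [a_mul_s h2, mulAS, ← z]
    rcases le_total 0 j with hj | hj
    · rw [Int.natAbs_of_nonneg hj]
    · rw [Int.ofNat_natAbs_of_nonpos hj, sub_neg_eq_add, ← sub_eq_add_neg, add_comm (a F (i + j))]
  mul_AP i r j := a_mul_p i r _
  mul_SS j l := by rw [s_mul_s h2, mulSS, add_natAbs_comm (fun j => s F j)]
  mul_SP j r k hk := by
    rw [s_mul_p h2 _ _ (by omega), mulSP, add_natAbs_comm (fun j => p F r j)]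
  mul_PP r h t k hh hk := by
    rw [p_mul_p h2 _ _ (by omega) (by omega), mulPP,
      add_natAbs_comm (fun j => z F (-(r + t)) j)]
    rfl

theorem IsCoverImage.toQuot {K : AlgIdeal F (Cover F)} {A S : ℤ → Cover F}
    {P : ZMod 3 → ℤ → Cover F} (h : IsCoverImage F A S P) :
    IsCoverImage F (fun i => K.toQuot (A i)) (fun j => K.toQuot (S j))
      (fun r j => K.toQuot (P r j)) where
  S_zero := by rw [h.S_zero, map_zero]
  S_neg j := by rw [h.S_neg]
  P_zero r := by rw [h.P_zero, map_zero]
  P_neg r j := by rw [h.P_neg]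
  P_eq_zero r j hj := by rw [h.P_eq_zero r hj, map_zero]
  P_sum r j := by rw [← map_add, ← map_add, h.P_sum, map_zero]
  mul_AA i k := by rw [← K.toQuot_mul, h.mul_AA]; simp only [map_add, map_sub, map_smul]
  mul_AS i j := by rw [← K.toQuot_mul, h.mul_AS]; simp only [map_add, map_sub, map_smul]
  mul_AP i r j := by rw [← K.toQuot_mul, h.mul_AP]; simp only [map_sub, map_smul]
  mul_SS j l := by rw [← K.toQuot_mul, h.mul_SS]; simp only [map_add, map_sub, map_smul]
  mul_SP j r k hk := by rw [← K.toQuot_mul, h.mul_SP j r hk]; simp only [map_add, map_sub, map_smul]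
  mul_PP r l t k hh hk := by
    rw [← K.toQuot_mul, h.mul_PP r t hh hk]; simp only [map_add, map_sub, map_smul]

end Highwater

/-! ### Miyamoto involutions, orbits and generation in an image of the cover. -/

namespace Highwater
namespace IsCoverImage

variable {F Q : Type*} [Field F] [NonUnitalNonAssocCommRing Q] [Module F Q]
  [IsScalarTower F Q Q] [SMulCommClass F Q Q] {A S : ℤ → Q} {P : ZMod 3 → ℤ → Q}

theorem P_sum' (h : IsCoverImage F A S P) (r : ZMod 3) (j : ℤ) :
    P r j = -P (r + 1) j - P (r - 1) j := by
  rw [← sub_eq_zero, ← h.P_sum r j]; abel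

/-- The map r ↦ -(i + r) exchanges i + 1 and i - 1, so a_i z_{i,j} = (5/2) z_{i,j}; the term
-z_{i,j} of a_i s_j lowers this to 3/2. Thus s_j + z_{i,j} behaves as s_j does in the Highwater
algebra. -/
theorem A_mul_b (h : IsCoverImage F A S P) (i j : ℤ) :
    A i * (S j + (P (i + 1) j - P (i - 1) j)) = -(3 / 4 : F) • A i
      + (3 / 8 : F) • (A (i - j) + A (i + j))
      + (3 / 2 : F) • (S j + (P (i + 1) j - P (i - 1) j)) := by
  have e1 : ∀ x : ZMod 3, -(x + (x + 1)) = x - 1 := by decide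
  have e2 : ∀ x : ZMod 3, -(x + (x - 1)) = x + 1 := by decide
  rw [mul_add, mul_sub, h.mul_AS, h.mul_AP, h.mul_AP, e1, e2]
  module

theorem A_idem (h2 : (2 : F) ≠ 0) (h : IsCoverImage F A S P) (i : ℤ) : A i * A i = A i := by
  rw [h.mul_AA, sub_self, h.S_zero, h.P_zero, h.P_zero]
  match_scalars; field_simp; ring

theorem A_mul_reflect (h2 : (2 : F) ≠ 0) (h : IsCoverImage F A S P) (i j : ℤ) :
    A i * (A (i - j) + A (i + j)) = A i + (1 / 2 : F) • (A (i - j) + A (i + j))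
      + (2 : F) • (S j + (P (i + 1) j - P (i - 1) j)) := by
  rw [mul_add, h.mul_AA, h.mul_AA, show i - (i - j) = j by ring, show i - (i + j) = -j by ring,
    h.S_neg, h.P_neg, h.P_neg]
  match_scalars <;> field_simp <;> ring

/-- The action of `τ_{a_i}` in any quotient of the cover. -/
theorem tau_apply (h2 : (2 : F) ≠ 0) (h : IsCoverImage F A S P) {i : ℤ} {t : Q ≃ₗ[F] Q}
    (ht : IsTau (2 : F) (1 / 2) (A i) t) (k : ℤ) : t (A k) = A (2 * i - k) := by
  have h4 := four_ne_zero_of_two h2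
  have h8 := eight_ne_zero_of_two h2
  obtain ⟨j, rfl⟩ : ∃ j, k = i + j := ⟨k - i, by ring⟩
  rw [show 2 * i - (i + j) = i - j by ring]
  set e := A (i - j) + A (i + j) with he
  set b := S j + (P (i + 1) j - P (i - 1) j) with hb
  have hab := h.A_mul_b i j
  have hae := h.A_mul_reflect h2 i j
  rw [← hb, ← he] at hab hae
  have e1 : t (A i) = A i := ht.2.1 1 (by simp) _ (mem_axEig.2 (by rw [h.A_idem h2, one_smul]))
  -- Modulo a_i, multiplication by a_i acts on the span of e and b with trace 2 and determinant 0.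
  -- This vector and the next are its eigenvectors for 0 and 2, corrected by multiples of a_i; their
  -- difference is 4e - 8a_i up to sign, so e is fixed.
  have eu : t ((4 : F) • b - (3 : F) • e + (6 : F) • A i)
      = (4 : F) • b - (3 : F) • e + (6 : F) • A i := by
    refine ht.2.1 0 (by simp) _ (mem_axEig.2 ?_)
    rw [mul_add, mul_sub, mul_smul_comm, mul_smul_comm, mul_smul_comm, hab, hae, h.A_idem h2]
    match_scalars <;> field_simp <;> ring
  have ev : t ((4 : F) • b + e - (2 : F) • A i) = (4 : F) • b + e - (2 : F) • A i := by
    refine ht.2.1 2 (by simp) _ (mem_axEig.2 ?_)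
    rw [mul_sub, mul_add, mul_smul_comm, mul_smul_comm, hab, hae, h.A_idem h2]
    match_scalars <;> field_simp <;> ring
  have em : t (A (i + j) - A (i - j)) = -(A (i + j) - A (i - j)) := by
    refine ht.2.2 (1 / 2) (by simp) _ (mem_axEig.2 ?_)
    rw [mul_sub, h.mul_AA, h.mul_AA, show i - (i - j) = j by ring, show i - (i + j) = -j by ring,
      h.S_neg, h.P_neg, h.P_neg]
    match_scalars <;> field_simp <;> ring
  have ee : (4 : F) • t e = (4 : F) • e := by
    simp only [map_add, map_sub, map_smul] at eu ev ⊢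
    linear_combination (norm := module) ev - eu + (8 : F) • e1
  have ee' := smul_right_injective _ h4 ee
  rw [he, map_add] at ee'
  rw [map_sub] at em
  have : (2 : F) • t (A (i + j)) = (2 : F) • A (i - j) := by
    linear_combination (norm := module) ee' + em
  exact smul_right_injective _ h2 this

/-- The generators act by the reflections k ↦ 2i - k, and the maps k ↦ ±k + 2m form a group. Only
even shifts occur, which confines each orbit to one parity class of indices. -/
theorem exists_signed_shift (h2 : (2 : F) ≠ 0) (h : IsCoverImage F A S P) {X : Set Q}
    (hX : X ⊆ Set.range A) {g : Q ≃ₗ[F] Q} (hg : g ∈ miyGroup (2 : F) (1 / 2) X) :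
    ∃ (u : ℤˣ) (m : ℤ), ∀ k, g (A k) = A (u * k + 2 * m) := by
  induction hg using Subgroup.closure_induction with
  | mem t ht =>
    obtain ⟨x, hx, ht⟩ := ht
    obtain ⟨i, rfl⟩ := hX hx
    refine ⟨-1, i, fun k => ?_⟩
    rw [h.tau_apply h2 ht]
    congr 1
    push_cast
    ring
  | one => exact ⟨1, 0, fun k => by simp⟩
  | mul x y _ _ hx hy =>
    obtain ⟨u, m, hu⟩ := hx
    obtain ⟨v, l, hv⟩ := hy
    refine ⟨u * v, u * l + m, fun k => ?_⟩
    rw [LinearEquiv.mul_apply, hv, hu]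
    congr 1
    push_cast
    ring
  | inv x _ hx =>
    obtain ⟨u, m, hu⟩ := hx
    refine ⟨u, -u * m, fun k => ?_⟩
    have huu : (u : ℤ) * u = 1 := by rw [← Units.val_mul, Int.units_mul_self, Units.val_one]
    rw [show x⁻¹ = x.symm from rfl, LinearEquiv.symm_apply_eq, hu]
    congr 1
    linear_combination (-k + 2 * m) * huu

theorem miyOrbit_eq (h2 : (2 : F) ≠ 0) (h : IsCoverImage F A S P) {X : Set Q}
    (hX : X ⊆ Set.range A) (h0 : A 0 ∈ X) (h1 : A 1 ∈ X)
    (ht0 : ∃ t : Q ≃ₗ[F] Q, IsTau (2 : F) (1 / 2) (A 0) t)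
    (ht1 : ∃ t : Q ≃ₗ[F] Q, IsTau (2 : F) (1 / 2) (A 1) t) (j : ℤ) :
    miyOrbit (2 : F) (1 / 2) X (A j) = {x | ∃ m : ℤ, A (j + 2 * m) = x} := by
  obtain ⟨t0, ht0⟩ := ht0
  obtain ⟨t1, ht1⟩ := ht1
  have m0 : t0 ∈ miyGroup (2 : F) (1 / 2) X := Subgroup.subset_closure ⟨_, h0, ht0⟩
  have m1 : t1 ∈ miyGroup (2 : F) (1 / 2) X := Subgroup.subset_closure ⟨_, h1, ht1⟩
  ext x
  constructor
  · rintro ⟨g, hg, rfl⟩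
    obtain ⟨u, m, hu⟩ := h.exists_signed_shift h2 hX hg
    rcases Int.units_eq_one_or u with rfl | rfl
    · exact ⟨m, by rw [hu]; congr 1; push_cast; ring⟩
    · exact ⟨m - j, by rw [hu]; congr 1; push_cast; ring⟩
  · rintro ⟨m, rfl⟩
    induction m using Int.induction_on with
    | zero => exact ⟨1, one_mem _, by simp⟩
    | succ m ih =>
      obtain ⟨g, hg, hgm⟩ := ih
      -- The reflection at 0 followed by the one at 1 is the shift k ↦ k + 2.
      refine ⟨t1 * (t0 * g), mul_mem m1 (mul_mem m0 hg), ?_⟩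
      rw [LinearEquiv.mul_apply, LinearEquiv.mul_apply, hgm, h.tau_apply h2 ht0,
        h.tau_apply h2 ht1]
      congr 1; ring
    | pred m ih =>
      obtain ⟨g, hg, hgm⟩ := ih
      refine ⟨t0 * (t1 * g), mul_mem m0 (mul_mem m1 hg), ?_⟩
      rw [LinearEquiv.mul_apply, LinearEquiv.mul_apply, hgm, h.tau_apply h2 ht1,
        h.tau_apply h2 ht0]
      congr 1; ring

theorem axet₂_eq (h2 : (2 : F) ≠ 0) (h : IsCoverImage F A S P)
    (ht0 : ∃ t : Q ≃ₗ[F] Q, IsTau (2 : F) (1 / 2) (A 0) t)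
    (ht1 : ∃ t : Q ≃ₗ[F] Q, IsTau (2 : F) (1 / 2) (A 1) t) :
    axet₂ (2 : F) (1 / 2) (A 0) (A 1) = Set.range A := by
  have hX : ({A 0, A 1} : Set Q) ⊆ Set.range A := by
    rintro x (rfl | rfl)
    exacts [⟨0, rfl⟩, ⟨1, rfl⟩]
  rw [axet₂, h.miyOrbit_eq h2 hX (by simp) (by simp) ht0 ht1,
    h.miyOrbit_eq h2 hX (by simp) (by simp) ht0 ht1]
  ext x
  constructor
  · rintro (⟨m, rfl⟩ | ⟨m, rfl⟩)
    exacts [⟨_, rfl⟩, ⟨_, rfl⟩]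
  · rintro ⟨k, rfl⟩
    rcases Int.even_or_odd' k with ⟨m, rfl | rfl⟩
    · exact .inl ⟨m, by rw [zero_add]⟩
    · exact .inr ⟨m, by rw [add_comm]⟩

/-- The product a_1 a_0 yields s_1, and a_i s_1 yields a_{i-1} + a_{i+1}, hence every a_i by
induction in both directions. Then a_i a_{i-j} yields s_j + z_{i,j} for all i, and since z_{r+1,j} -
z_{r-1,j} = -3 p_{r,j} with 3 invertible, p and s separate. -/
theorem adjoin_eq_top (h2 : (2 : F) ≠ 0) (h3 : (3 : F) ≠ 0) (h : IsCoverImage F A S P)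
    (hspan : Submodule.span F (Set.range A ∪ Set.range S ∪ Set.range fun x : ZMod 3 × ℤ => P x.1 x.2)
      = ⊤) : NonUnitalAlgebra.adjoin F {A 0, A 1} = ⊤ := by
  have h4 := four_ne_zero_of_two h2
  have h8 := eight_ne_zero_of_two h2
  set B := NonUnitalAlgebra.adjoin F {A 0, A 1} with hB
  have hsm : ∀ {x : Q}, x ∈ B → ∀ c : F, c • x ∈ B := fun hx c =>
    Submodule.smul_mem B.toSubmodule c hx
  have hA0 : A 0 ∈ B := NonUnitalAlgebra.subset_adjoin F (by simp)
  have hA1 : A 1 ∈ B := NonUnitalAlgebra.subset_adjoin F (by simp)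
  have n1 : ¬ (3 : ℤ) ∣ 1 := by decide
  have hS1 : S 1 ∈ B := by
    have : S 1 = A 1 * A 0 - (1 / 2 : F) • (A 1 + A 0) := by
      rw [h.mul_AA, sub_zero, h.P_eq_zero _ n1, h.P_eq_zero _ n1]; module
    rw [this]
    exact sub_mem (mul_mem hA1 hA0) (hsm (add_mem hA1 hA0) _)
  have hstep : ∀ i : ℤ, A i ∈ B → A (i - 1) + A (i + 1) ∈ B := by
    intro i hi
    have : A (i - 1) + A (i + 1) = (8 / 3 : F) • (A i * S 1 + (3 / 4 : F) • A i
        - (3 / 2 : F) • S 1) := by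
      rw [h.mul_AS, h.P_eq_zero _ n1, h.P_eq_zero _ n1]
      match_scalars <;> field_simp <;> ring
    rw [this]
    exact hsm (sub_mem (add_mem (mul_mem hi hS1) (hsm hi _)) (hsm hS1 _)) _
  have hA : ∀ i : ℤ, A i ∈ B ∧ A (i + 1) ∈ B := by
    intro i
    induction i using Int.induction_on with
    | zero => exact ⟨hA0, by simpa using hA1⟩
    | succ i ih =>
      refine ⟨ih.2, ?_⟩
      have := sub_mem (hstep _ ih.2) ih.1
      rwa [add_sub_cancel_right, add_sub_cancel_left] at this
    | pred i ih =>
      rw [sub_add_cancel]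
      refine ⟨?_, ih.1⟩
      have := sub_mem (hstep _ ih.1) ih.2
      rwa [add_sub_cancel_right] at this
  have hSZ : ∀ i j : ℤ, S j + (P (i + 1) j - P (i - 1) j) ∈ B := by
    intro i j
    have : S j + (P (i + 1) j - P (i - 1) j)
        = A i * A (i - j) - (1 / 2 : F) • (A i + A (i - j)) := by
      rw [h.mul_AA, sub_sub_cancel]; module
    rw [this]
    exact sub_mem (mul_mem (hA _).1 (hA _).1) (hsm (add_mem (hA _).1 (hA _).1) _)
  have hPB : ∀ (r : ZMod 3) (j : ℤ), P r j ∈ B := by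
    intro r j
    obtain ⟨i, rfl⟩ := ZMod.intCast_surjective r
    have e1 : ∀ x : ZMod 3, x + 1 + 1 = x - 1 := by decide
    have e2 : ∀ x : ZMod 3, x - 1 - 1 = x + 1 := by decide
    have : P (i : ZMod 3) j = (-1 / 3 : F) • ((S j + (P (((i + 1 : ℤ) : ZMod 3) + 1) j
        - P (((i + 1 : ℤ) : ZMod 3) - 1) j)) - (S j + (P (((i - 1 : ℤ) : ZMod 3) + 1) j
        - P (((i - 1 : ℤ) : ZMod 3) - 1) j))) := by
      push_cast
      rw [e1, e2, add_sub_cancel_right, sub_add_cancel, h.P_sum' i j]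
      match_scalars <;> field_simp <;> ring
    rw [this]
    exact hsm (sub_mem (hSZ _ _) (hSZ _ _)) _
  have hSB : ∀ j : ℤ, S j ∈ B := by
    intro j
    have := sub_mem (hSZ 0 j) (sub_mem (hPB (((0 : ℤ) : ZMod 3) + 1) j)
      (hPB (((0 : ℤ) : ZMod 3) - 1) j))
    rwa [add_sub_cancel_right] at this
  rw [eq_top_iff]
  intro x _
  have hle : Submodule.span F (Set.range A ∪ Set.range S ∪
      Set.range fun x : ZMod 3 × ℤ => P x.1 x.2) ≤ B.toSubmodule := by
    rw [Submodule.span_le]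
    rintro y ((⟨i, rfl⟩ | ⟨j, rfl⟩) | ⟨⟨r, j⟩, rfl⟩)
    exacts [(hA i).1, hSB j, hPB r j]
  exact hle (hspan ▸ Submodule.mem_top)

end IsCoverImage
end Highwater

/-! ### Signs, and integers modulo n up to sign. -/

namespace Highwater

/-- The sign `(-1) ^ i` as an element of `F`. -/
def sgn (F : Type*) [Field F] (i : ℤ) : F := ((i.negOnePow : ℤ) : F)

section Sign

variable {F : Type*} [Field F]

theorem sgn_add (i j : ℤ) : sgn F (i + j) = sgn F i * sgn F j := by
  simp [sgn, Int.negOnePow_add]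

theorem sgn_neg (i : ℤ) : sgn F (-i) = sgn F i := by simp [sgn]

theorem sgn_sub (i j : ℤ) : sgn F (i - j) = sgn F i * sgn F j := by
  rw [sub_eq_add_neg, sgn_add, sgn_neg]

theorem sgn_zero : sgn F 0 = 1 := by simp [sgn]

theorem sgn_mul_self (i : ℤ) : sgn F i * sgn F i = 1 := by
  rw [← sgn_sub, sub_self, sgn_zero]

theorem sgn_of_odd {i : ℤ} (h : Odd i) : sgn F i = -1 := by simp [sgn, Int.negOnePow_odd i h]

theorem sgn_of_even {i : ℤ} (h : Even i) : sgn F i = 1 := by simp [sgn, Int.negOnePow_even i h]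

theorem sgn_natAbs (j : ℤ) : sgn F j.natAbs = sgn F j := by
  rcases Int.natAbs_eq j with h | h
  · rw [← h]
  · conv_rhs => rw [h, sgn_neg]

end Sign

/-- The class of an integer modulo `n` and up to sign. -/
def absClass (n : ℕ) [NeZero n] (j : ℤ) : Fin (n / 2 + 1) :=
  ⟨((j : ZMod n).valMinAbs).natAbs, Nat.lt_succ_of_le (ZMod.natAbs_valMinAbs_le _)⟩

section AbsClass

variable {n : ℕ} [NeZero n]

theorem absClass_neg (j : ℤ) : absClass n (-j) = absClass n j := by
  ext; simp [absClass, ZMod.natAbs_valMinAbs_neg]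

theorem absClass_add (j m : ℤ) : absClass n (j + n * m) = absClass n j := by
  simp [absClass]

theorem absClass_natCast (u : Fin (n / 2 + 1)) : absClass n ((u : ℕ) : ℤ) = u := by
  ext
  simp only [absClass, Int.cast_natCast]
  rw [ZMod.valMinAbs_natCast_of_le_half (Nat.lt_succ_iff.1 u.2), Int.natAbs_natCast]

theorem exists_absClass_eq (j : ℤ) : ∃ m : ℤ, ((absClass n j : ℕ) : ℤ) = j + n * m ∨
    ((absClass n j : ℕ) : ℤ) = -j + n * m := by
  have h : (((j : ZMod n).valMinAbs : ℤ) : ZMod n) = j := ZMod.coe_valMinAbs _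
  rw [ZMod.intCast_eq_intCast_iff_dvd_sub] at h
  obtain ⟨m, hm⟩ := h
  have h' : ((absClass n j : ℕ) : ℤ) = (((j : ZMod n).valMinAbs).natAbs : ℤ) := rfl
  rw [h']
  rcases Int.natAbs_eq ((j : ZMod n).valMinAbs) with e | e
  · exact ⟨-m, .inl (by rw [← e]; linear_combination -hm)⟩
  · exact ⟨m, .inr (by linear_combination hm + e)⟩

/-- Sums over `j ± k` of an even `n`-periodic function only depend on the classes of `j`, `k`. -/
theorem add_absClass {M : Type*} [AddCommMonoid M] (f : ℤ → M) (hneg : ∀ j, f (-j) = f j)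
    (hper : ∀ j m, f (j + n * m) = f j) (j k : ℤ) :
    f ((absClass n j : ℕ) - (absClass n k : ℕ)) + f ((absClass n j : ℕ) + (absClass n k : ℕ))
      = f (j - k) + f (j + k) := by
  obtain ⟨m, hm⟩ := exists_absClass_eq (n := n) j
  obtain ⟨l, hl⟩ := exists_absClass_eq (n := n) k
  rcases hm with hm | hm <;> rcases hl with hl | hl <;> rw [hm, hl]
  · rw [show j + n * m - (k + n * l) = j - k + n * (m - l) by ring,
      show j + n * m + (k + n * l) = j + k + n * (m + l) by ring, hper, hper]
  · rw [show j + n * m - (-k + n * l) = j + k + n * (m - l) by ring,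
      show j + n * m + (-k + n * l) = j - k + n * (m + l) by ring, hper, hper, add_comm]
  · rw [show -j + n * m - (k + n * l) = -(j + k) + n * (m - l) by ring,
      show -j + n * m + (k + n * l) = -(j - k) + n * (m + l) by ring, hper, hper, hneg, hneg,
      add_comm]
  · rw [show -j + n * m - (-k + n * l) = -(j - k) + n * (m - l) by ring,
      show -j + n * m + (-k + n * l) = -(j + k) + n * (m + l) by ring, hper, hper, hneg, hneg]

end AbsClass

/-- The index set of the basis of the model of the universal quotient: one index for `c`, `n` indices
`d_i`, indices `w_j` for `j ∈ ℤ/n` up to sign, and, if `b` holds, indices `q_{r,j}` for the `j`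
divisible by `3`. -/
abbrev ModelIdx (n : ℕ) (b : Prop) : Type :=
  Unit ⊕ ZMod n ⊕ Fin (n / 2 + 1) ⊕
    ({r : ZMod 3 // r ≠ 0} × {u : Fin (n / 2 + 1) // b ∧ 3 ∣ u.val})

/-- The underlying space of the model of the universal quotient. -/
abbrev Model (F : Type*) [Field F] (n : ℕ) (b : Prop) : Type _ := ModelIdx n b →₀ F

/-! ### The model algebra and its multiplication table. -/

section Model

open Classical in
/-- The elements `q_{r,j}` of the model. -/
def modelQ (F : Type*) [Field F] (n : ℕ) [NeZero n] (b : Prop) (r : ZMod 3) (j : ℤ) :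
    Model F n b :=
  if h : b ∧ 3 ∣ (absClass n j).val then
    if hr : r ≠ 0 then Finsupp.single (.inr (.inr (.inr (⟨r, hr⟩, ⟨absClass n j, h⟩)))) 1
    else -Finsupp.single (.inr (.inr (.inr (⟨1, by decide⟩, ⟨absClass n j, h⟩)))) 1
      - Finsupp.single (.inr (.inr (.inr (⟨2, by decide⟩, ⟨absClass n j, h⟩)))) 1
  else 0

variable (F : Type*) [Field F] (n : ℕ) [NeZero n] (b : Prop)

/-- The element `c` of the model. -/
def modelC : Model F n b := Finsupp.single (.inl ()) 1

/-- The elements `d_i` of the model. -/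
def modelD (i : ℤ) : Model F n b := Finsupp.single (.inr (.inl (i : ZMod n))) 1

/-- The elements `w_j` of the model. -/
def modelW (j : ℤ) : Model F n b := Finsupp.single (.inr (.inr (.inl (absClass n j)))) 1

/-- The product of basis elements of the model. -/
def modelMulBasis : ModelIdx n b → ModelIdx n b → Model F n b
  | .inl _, .inl _ => modelC F n b
  | .inl _, .inr (.inl x) => (2 : F) • modelD F n b x.val
  | .inr (.inl x), .inl _ => (2 : F) • modelD F n b x.val
  | .inr (.inl x), .inr (.inl y) => (4 : F) • (modelW F n b (x.val - y.val)
      + (modelQ F n b ((x.val : ℤ) + 1) (x.val - y.val)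
        - modelQ F n b ((x.val : ℤ) - 1) (x.val - y.val)))
  | .inr (.inl x), .inr (.inr (.inl u)) =>
      (3 / 8 : F) • (modelD F n b (x.val - u.val) + modelD F n b (x.val + u.val))
  | .inr (.inr (.inl u)), .inr (.inl x) =>
      (3 / 8 : F) • (modelD F n b (x.val - u.val) + modelD F n b (x.val + u.val))
  | .inr (.inr (.inl u)), .inr (.inr (.inl v)) =>
      -(3 / 8 : F) • (modelW F n b (u.val - v.val) + modelW F n b (u.val + v.val))
  | .inr (.inr (.inl u)), .inr (.inr (.inr (r, v))) =>
      -(3 / 8 : F) • (modelQ F n b r (u.val - v.1.val) + modelQ F n b r (u.val + v.1.val))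
  | .inr (.inr (.inr (r, v))), .inr (.inr (.inl u)) =>
      -(3 / 8 : F) • (modelQ F n b r (u.val - v.1.val) + modelQ F n b r (u.val + v.1.val))
  | .inr (.inr (.inr (r, u))), .inr (.inr (.inr (t, v))) =>
      -(1 / 8 : F) • ((modelQ F n b (-(r.1 + t.1) + 1) (u.1.val - v.1.val)
          - modelQ F n b (-(r.1 + t.1) - 1) (u.1.val - v.1.val))
        + (modelQ F n b (-(r.1 + t.1) + 1) (u.1.val + v.1.val)
          - modelQ F n b (-(r.1 + t.1) - 1) (u.1.val + v.1.val)))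
  | _, _ => 0

/-- The product of the model as a bilinear map. -/
def modelMul : Model F n b →ₗ[F] Model F n b →ₗ[F] Model F n b :=
  Finsupp.basisSingleOne.constr F fun x =>
    Finsupp.basisSingleOne.constr F fun y => modelMulBasis F n b x y

variable {F n b}

theorem modelMul_single (x y : ModelIdx n b) :
    modelMul F n b (Finsupp.single x 1) (Finsupp.single y 1) = modelMulBasis F n b x y := by
  have h : ∀ x : ModelIdx n b, Finsupp.single x (1 : F) = Finsupp.basisSingleOne (R := F) x :=
    fun x => by simp
  rw [h x, h y, modelMul, Module.Basis.constr_basis, Module.Basis.constr_basis]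

theorem modelD_add (i m : ℤ) : modelD F n b (i + n * m) = modelD F n b i := by simp [modelD]

theorem modelW_neg (j : ℤ) : modelW F n b (-j) = modelW F n b j := by
  rw [modelW, absClass_neg]; rfl

theorem modelW_add (j m : ℤ) : modelW F n b (j + n * m) = modelW F n b j := by
  rw [modelW, absClass_add]; rfl

theorem modelQ_congr (r : ZMod 3) {j k : ℤ} (h : absClass n j = absClass n k) :
    modelQ F n b r j = modelQ F n b r k := by
  unfold modelQ
  generalize absClass n j = u at h ⊢
  subst h
  rfl

theorem modelQ_neg (r : ZMod 3) (j : ℤ) : modelQ F n b r (-j) = modelQ F n b r j :=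
  modelQ_congr r (absClass_neg j)

theorem modelQ_add (r : ZMod 3) (j m : ℤ) : modelQ F n b r (j + n * m) = modelQ F n b r j :=
  modelQ_congr r (absClass_add j m)

theorem modelQ_sum' (j : ℤ) : modelQ F n b 0 j + modelQ F n b 1 j + modelQ F n b 2 j = 0 := by
  unfold modelQ
  by_cases hj : b ∧ 3 ∣ (absClass n j).val
  · simp only [hj, and_self, dif_pos, ne_eq, not_true_eq_false, dif_neg, not_false_eq_true]
    rw [dif_pos (by decide), dif_pos (by decide)]
    abel
  · simp [hj]

theorem modelQ_sum (r : ZMod 3) (j : ℤ) :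
    modelQ F n b r j + modelQ F n b (r + 1) j + modelQ F n b (r - 1) j = 0 := by
  have key := modelQ_sum' (F := F) (n := n) (b := b) j
  have h3 : r = 0 ∨ r = 1 ∨ r = 2 := by revert r; decide
  rcases h3 with rfl | rfl | rfl
  · rw [← key, show (0 : ZMod 3) + 1 = 1 by decide, show (0 : ZMod 3) - 1 = 2 by decide]
  · rw [← key, show (1 : ZMod 3) + 1 = 2 by decide, show (1 : ZMod 3) - 1 = 0 by decide]; abel
  · rw [← key, show (2 : ZMod 3) + 1 = 0 by decide, show (2 : ZMod 3) - 1 = 1 by decide]; abel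

/-- The representative is ±j plus a multiple of n, hence of 3. So the support condition in `modelQ`
can be tested on j itself. -/
theorem three_dvd_absClass (hn : 3 ∣ n) (j : ℤ) : 3 ∣ (absClass n j).val ↔ 3 ∣ j := by
  obtain ⟨m, hm⟩ := exists_absClass_eq (n := n) j
  have hnm : (3 : ℤ) ∣ n * m := Dvd.dvd.mul_right (by exact_mod_cast hn) m
  have : (3 ∣ (absClass n j).val) ↔ (3 : ℤ) ∣ ((absClass n j).val : ℤ) := by omega
  rw [this]
  rcases hm with hm | hm <;> rw [hm] <;> omega

theorem modelQ_eq_zero (hb : b → 3 ∣ n) (r : ZMod 3) {j : ℤ} (hj : ¬ 3 ∣ j) :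
    modelQ F n b r j = 0 := by
  have : ¬ (b ∧ 3 ∣ (absClass n j).val) := fun h => hj ((three_dvd_absClass (hb h.1) j).1 h.2)
  simp [modelQ, this]

theorem modelQ_eq_zero_of_not (hb : ¬ b) (r : ZMod 3) (j : ℤ) : modelQ F n b r j = 0 := by
  simp [modelQ, hb]

theorem modelQ_eq_single {r : ZMod 3} (hr : r ≠ 0) {j : ℤ} (h : b ∧ 3 ∣ (absClass n j).val) :
    modelQ F n b r j = Finsupp.single (.inr (.inr (.inr (⟨r, hr⟩, ⟨absClass n j, h⟩)))) 1 := by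
  simp [modelQ, h, hr]

/-- A linear identity in `q_{r,j}` can be checked on basis elements. -/
theorem forall_modelQ {M : Type*} [AddCommGroup M] {f : ZMod 3 → M} {j : ℤ}
    (g : Model F n b →+ M) (hj : b ∧ 3 ∣ (absClass n j).val) (hf : f 0 + f 1 + f 2 = 0)
    (h : ∀ (r : ZMod 3) (hr : r ≠ 0),
      g (Finsupp.single (.inr (.inr (.inr (⟨r, hr⟩, ⟨absClass n j, hj⟩)))) 1) = f r)
    (r : ZMod 3) : g (modelQ F n b r j) = f r := by
  have hne : ∀ r : ZMod 3, r ≠ 0 → g (modelQ F n b r j) = f r := fun r hr => by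
    rw [modelQ_eq_single hr hj, h r hr]
  by_cases hr : r = 0
  · subst hr
    have := congrArg g (modelQ_sum' (F := F) (n := n) (b := b) j)
    rw [map_add, map_add, map_zero, hne 1 (by decide), hne 2 (by decide)] at this
    rw [← sub_eq_zero, ← sub_eq_zero.2 (this.trans hf.symm)]
    abel
  · exact hne r hr

theorem modelMul_CC : modelMul F n b (modelC F n b) (modelC F n b) = modelC F n b :=
  modelMul_single _ _

theorem exists_val_eq (i : ℤ) : ∃ m : ℤ, (((i : ZMod n).val : ℕ) : ℤ) = i + n * m := by
  rw [ZMod.val_intCast]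
  exact ⟨-(i / n), by rw [Int.emod_def]; ring⟩

theorem modelMul_CD (i : ℤ) :
    modelMul F n b (modelC F n b) (modelD F n b i) = (2 : F) • modelD F n b i := by
  obtain ⟨m, hm⟩ := exists_val_eq (n := n) i
  refine (modelMul_single _ _).trans ?_
  rw [modelMulBasis, hm, modelD_add]

theorem modelMul_CW (j : ℤ) : modelMul F n b (modelC F n b) (modelW F n b j) = 0 :=
  modelMul_single _ _

theorem modelMul_CQ (r : ZMod 3) (j : ℤ) :
    modelMul F n b (modelC F n b) (modelQ F n b r j) = 0 := by
  by_cases hj : b ∧ 3 ∣ (absClass n j).val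
  · exact forall_modelQ (f := fun _ => 0) (modelMul F n b (modelC F n b)).toAddMonoidHom hj
      (by simp) (fun r hr => modelMul_single _ _) r
  · simp [modelQ, hj]

/-- The left side depends on i modulo n, the first index of q on i modulo 3. These are compatible
because 3 ∣ n whenever q is present. -/
theorem modelMul_DD (hb : b → 3 ∣ n) (i k : ℤ) :
    modelMul F n b (modelD F n b i) (modelD F n b k) = (4 : F) • (modelW F n b (i - k)
      + (modelQ F n b (i + 1) (i - k) - modelQ F n b (i - 1) (i - k))) := by
  obtain ⟨m, hm⟩ := exists_val_eq (n := n) i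
  obtain ⟨l, hl⟩ := exists_val_eq (n := n) k
  refine (modelMul_single _ _).trans ?_
  rw [modelMulBasis, hm, hl, show i + n * m - (k + n * l) = i - k + n * (m - l) by ring,
    modelW_add, modelQ_add, modelQ_add]
  by_cases h : b
  · have h0 : ((n : ℤ) : ZMod 3) = 0 := by
      have := (ZMod.natCast_eq_zero_iff n 3).2 (hb h)
      exact_mod_cast this
    push_cast at h0 ⊢
    rw [h0, zero_mul, add_zero]
  · simp only [modelQ_eq_zero_of_not h]

theorem modelMul_DW (i j : ℤ) :
    modelMul F n b (modelD F n b i) (modelW F n b j)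
      = (3 / 8 : F) • (modelD F n b (i - j) + modelD F n b (i + j)) := by
  obtain ⟨m, hm⟩ := exists_val_eq (n := n) i
  refine (modelMul_single _ _).trans ?_
  rw [modelMulBasis, hm]
  congr 1
  obtain ⟨l, hl | hl⟩ := exists_absClass_eq (n := n) j
  · rw [hl, show i + n * m - (j + n * l) = i - j + n * (m - l) by ring,
      show i + n * m + (j + n * l) = i + j + n * (m + l) by ring, modelD_add, modelD_add]
  · rw [hl, show i + n * m - (-j + n * l) = i + j + n * (m - l) by ring,
      show i + n * m + (-j + n * l) = i - j + n * (m + l) by ring, modelD_add, modelD_add,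
      add_comm]

theorem modelMul_DQ (i : ℤ) (r : ZMod 3) (j : ℤ) :
    modelMul F n b (modelD F n b i) (modelQ F n b r j) = 0 := by
  by_cases hj : b ∧ 3 ∣ (absClass n j).val
  · exact forall_modelQ (f := fun _ => 0) (modelMul F n b (modelD F n b i)).toAddMonoidHom hj
      (by simp) (fun r hr => modelMul_single _ _) r
  · simp [modelQ, hj]

theorem modelMul_WW (j k : ℤ) :
    modelMul F n b (modelW F n b j) (modelW F n b k)
      = -(3 / 8 : F) • (modelW F n b (j - k) + modelW F n b (j + k)) := by
  refine (modelMul_single _ _).trans ?_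
  rw [modelMulBasis, add_absClass (modelW F n b) modelW_neg modelW_add]

theorem modelMul_WQ (hb : b → 3 ∣ n) (j : ℤ) (r : ZMod 3) {k : ℤ} (hk : 3 ∣ k) :
    modelMul F n b (modelW F n b j) (modelQ F n b r k)
      = -(3 / 8 : F) • (modelQ F n b r (j - k) + modelQ F n b r (j + k)) := by
  by_cases h : b
  · have hj : b ∧ 3 ∣ (absClass n k).val := ⟨h, (three_dvd_absClass (hb h) k).2 hk⟩
    refine forall_modelQ (f := fun r => -(3 / 8 : F) • (modelQ F n b r (j - k)
      + modelQ F n b r (j + k))) (modelMul F n b (modelW F n b j)).toAddMonoidHom hj ?_ ?_ r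
    · rw [← smul_add, ← smul_add, show ∀ x1 y1 x2 y2 x3 y3 : Model F n b,
        x1 + y1 + (x2 + y2) + (x3 + y3) = (x1 + x2 + x3) + (y1 + y2 + y3) by intros; abel,
        modelQ_sum', modelQ_sum', add_zero, smul_zero]
    · intro r hr
      refine (modelMul_single _ _).trans ?_
      rw [modelMulBasis, add_absClass (modelQ F n b r) (modelQ_neg r) (modelQ_add r)]
  · simp [modelQ_eq_zero_of_not h]

theorem sum_zmod_three_neg {M : Type*} [AddCommGroup M] (f : ZMod 3 → M) (t : ZMod 3)
    (hf : f 0 + f 1 + f 2 = 0) : f (-(t + 0)) + f (-(t + 1)) + f (-(t + 2)) = 0 := by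
  rw [sum_zmod_three f t hf]; abel

theorem modelMul_QQ (hb : b → 3 ∣ n) (r : ZMod 3) {j : ℤ} (t : ZMod 3) {k : ℤ} (hj : 3 ∣ j)
    (hk : 3 ∣ k) : modelMul F n b (modelQ F n b r j) (modelQ F n b t k)
      = -(1 / 8 : F) • ((modelQ F n b (-(r + t) + 1) (j - k) - modelQ F n b (-(r + t) - 1) (j - k))
        + (modelQ F n b (-(r + t) + 1) (j + k) - modelQ F n b (-(r + t) - 1) (j + k))) := by
  by_cases h : b
  · have hj : b ∧ 3 ∣ (absClass n j).val := ⟨h, (three_dvd_absClass (hb h) j).2 hj⟩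
    have hk : b ∧ 3 ∣ (absClass n k).val := ⟨h, (three_dvd_absClass (hb h) k).2 hk⟩
    let f : ZMod 3 → Model F n b := fun r => -(1 / 8 : F) •
      ((modelQ F n b (r + 1) (j - k) - modelQ F n b (r - 1) (j - k))
        + (modelQ F n b (r + 1) (j + k) - modelQ F n b (r - 1) (j + k)))
    have hf : f 0 + f 1 + f 2 = 0 := by
      have e1 := modelQ_sum' (F := F) (n := n) (b := b) (j - k)
      have e2 := modelQ_sum' (F := F) (n := n) (b := b) (j + k)
      simp only [f]
      rw [show (0 : ZMod 3) + 1 = 1 by decide, show (0 : ZMod 3) - 1 = 2 by decide,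
        show (1 : ZMod 3) + 1 = 2 by decide, show (1 : ZMod 3) - 1 = 0 by decide,
        show (2 : ZMod 3) + 1 = 0 by decide, show (2 : ZMod 3) - 1 = 1 by decide]
      module
    refine forall_modelQ (f := fun t => f (-(r + t)))
      (modelMul F n b (modelQ F n b r j)).toAddMonoidHom hk (sum_zmod_three_neg f r hf) ?_ t
    intro t ht
    refine forall_modelQ (f := fun r => f (-(r + t)))
      ((modelMul F n b).flip (Finsupp.single _ 1)).toAddMonoidHom hj ?_ ?_ r
    · rw [add_comm 0 t, add_comm 1 t, add_comm 2 t]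
      exact sum_zmod_three_neg f t hf
    · intro r hr
      refine (modelMul_single _ _).trans ?_
      rw [modelMulBasis, add_absClass (fun j => modelQ F n b (-(r + t) + 1) j
        - modelQ F n b (-(r + t) - 1) j) (fun j => by rw [modelQ_neg, modelQ_neg])
        (fun j m => by rw [modelQ_add, modelQ_add])]
  · simp [modelQ_eq_zero_of_not h]

theorem modelMul_comm (hb : b → 3 ∣ n) (x y : Model F n b) :
    modelMul F n b x y = modelMul F n b y x := by
  suffices h : modelMul F n b = (modelMul F n b).flip by
    conv_lhs => rw [h]
    rfl
  refine Finsupp.basisSingleOne.ext fun x => Finsupp.basisSingleOne.ext fun y => ?_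
  rw [LinearMap.flip_apply, Finsupp.coe_basisSingleOne, modelMul_single, modelMul_single]
  rcases x with x | x | x | ⟨r, x⟩ <;> rcases y with y | y | y | ⟨t, y⟩ <;> simp only [modelMulBasis]
  · rw [← neg_sub (x.val : ℤ), modelW_neg, modelQ_neg, modelQ_neg]
    -- The term z_{x,x-y} looks asymmetric, but either x and y agree modulo 3 or the q's of index x
    -- - y vanish.
    by_cases h : (3 : ℤ) ∣ (x.val : ℤ) - y.val
    · have := (ZMod.intCast_eq_intCast_iff_dvd_sub (y.val : ℤ) (x.val : ℤ) 3).2 h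
      rw [this]
    · simp only [modelQ_eq_zero hb _ h]
  · rw [← neg_sub (x.val : ℤ), modelW_neg, add_comm (x.val : ℤ)]
  · rw [← neg_sub (x.1.val : ℤ), modelQ_neg, modelQ_neg, add_comm (x.1.val : ℤ), add_comm r.1]

end Model

end Highwater

namespace Highwater

/-! ### The homomorphism from the cover to the model. -/

section ToModel

variable (F : Type*) [Field F] (n : ℕ) [NeZero n] (b : Prop)

/-- The difference `q_{r+1,j} - q_{r-1,j}`. -/
def modelZ (r : ZMod 3) (j : ℤ) : Model F n b :=
  modelQ F n b (r + 1) j - modelQ F n b (r - 1) j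

/-- The projection of the cover onto the model of the universal quotient. -/
def toModel : Cover F →ₗ[F] Model F n b :=
  (basis F).constr F fun
    | .a i => (sgn F i / 2) • modelD F n b i + modelC F n b - (2 : F) • modelW F n b 0
        - (2 : F) • modelZ F n b i 0
    | .s j => sgn F j • modelW F n b j - modelW F n b 0
    | .p r k => sgn F k • modelQ F n b r k - modelQ F n b r 0

variable {F n b}

theorem toModel_a (i : ℤ) : toModel F n b (a F i) = (sgn F i / 2) • modelD F n b i + modelC F n b
    - (2 : F) • modelW F n b 0 - (2 : F) • modelZ F n b i 0 :=
  (basis F).constr_basis F _ _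

theorem modelW_natAbs (j : ℤ) : modelW F n b j.natAbs = modelW F n b j := by
  rcases Int.natAbs_eq j with h | h
  · rw [← h]
  · conv_rhs => rw [h, modelW_neg]

theorem modelQ_natAbs (r : ZMod 3) (j : ℤ) : modelQ F n b r j.natAbs = modelQ F n b r j := by
  rcases Int.natAbs_eq j with h | h
  · rw [← h]
  · conv_rhs => rw [h, modelQ_neg]

theorem toModel_s (j : ℤ) : toModel F n b (s F j.natAbs)
    = sgn F j • modelW F n b j - modelW F n b 0 := by
  rcases eq_or_ne j 0 with rfl | hj
  · rw [Int.natAbs_zero, s_zero, map_zero, sgn_zero, one_smul, sub_self]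
  · rw [s_eq_basis (Int.natAbs_pos.2 hj)]
    refine ((basis F).constr_basis F _ _).trans ?_
    simp only [modelW_natAbs, sgn_natAbs]

theorem toModel_p (r : ZMod 3) {j : ℤ} (hj : 3 ∣ j) : toModel F n b (p F r j.natAbs)
    = sgn F j • modelQ F n b r j - modelQ F n b r 0 := by
  rcases eq_or_ne j 0 with rfl | hj0
  · rw [Int.natAbs_zero, p_zero, map_zero, sgn_zero, one_smul, sub_self]
  · refine forall_p (f := fun r => sgn F j • modelQ F n b r j - modelQ F n b r 0)
      (toModel F n b).toAddMonoidHom ⟨Int.natAbs_pos.2 hj0, by omega⟩ ?_ (fun r hr => ?_) r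
    · have e1 := modelQ_sum' (F := F) (n := n) (b := b) j
      have e2 := modelQ_sum' (F := F) (n := n) (b := b) 0
      linear_combination (norm := module) sgn F j • e1 - e2
    · refine ((basis F).constr_basis F _ _).trans ?_
      simp only [modelQ_natAbs, sgn_natAbs]

theorem toModel_p_of_not_dvd (r : ZMod 3) {j : ℤ} (hj : ¬ 3 ∣ j) :
    toModel F n b (p F r j.natAbs) = 0 := by
  rw [p_of_not_dvd r (by omega), map_zero]

/-- Either there are no q's or 5 = 0. This absorbs, uniformly in `b`, the defects of the identities
to come, which are multiples of 5. -/
theorem five_smul_modelQ (hb : b → (5 : F) = 0) (r : ZMod 3) (j : ℤ) :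
    (5 : F) • modelQ F n b r j = 0 := by
  by_cases h : b
  · rw [hb h, zero_smul]
  · rw [modelQ_eq_zero_of_not h, smul_zero]

theorem modelZ_neg (r : ZMod 3) (j : ℤ) : modelZ F n b r (-j) = modelZ F n b r j := by
  rw [modelZ, modelQ_neg, modelQ_neg]; rfl

theorem modelZ_eq_zero (hb : b → 3 ∣ n) (r : ZMod 3) {j : ℤ} (hj : ¬ 3 ∣ j) :
    modelZ F n b r j = 0 := by
  rw [modelZ, modelQ_eq_zero hb _ hj, modelQ_eq_zero hb _ hj, sub_self]

theorem modelZ_sum (r : ZMod 3) (j : ℤ) :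
    modelZ F n b r j + modelZ F n b (r + 1) j + modelZ F n b (r - 1) j = 0 := by
  have e1 : ∀ x : ZMod 3, x + 1 + 1 = x - 1 := by decide
  have e2 : ∀ x : ZMod 3, x - 1 - 1 = x + 1 := by decide
  simp only [modelZ, e1, e2, add_sub_cancel_right, sub_add_cancel]
  abel

theorem five_smul_modelZ (hb : b → (5 : F) = 0) (r : ZMod 3) (j : ℤ) :
    (5 : F) • modelZ F n b r j = 0 := by
  rw [modelZ, smul_sub, five_smul_modelQ hb, five_smul_modelQ hb, sub_zero]

theorem modelZ_sub (r : ZMod 3) (j : ℤ) :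
    modelZ F n b (r - 1) j - modelZ F n b (r + 1) j = (3 : F) • modelQ F n b r j := by
  have e1 : ∀ x : ZMod 3, x + 1 + 1 = x - 1 := by decide
  have e2 : ∀ x : ZMod 3, x - 1 - 1 = x + 1 := by decide
  simp only [modelZ, e1, e2, add_sub_cancel_right, sub_add_cancel]
  linear_combination (norm := module) -modelQ_sum (F := F) (n := n) (b := b) r j

theorem modelMul_CZ (r : ZMod 3) (j : ℤ) :
    modelMul F n b (modelC F n b) (modelZ F n b r j) = 0 := by
  rw [modelZ, map_sub, modelMul_CQ, modelMul_CQ, sub_zero]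

theorem modelMul_DZ (i : ℤ) (r : ZMod 3) (j : ℤ) :
    modelMul F n b (modelD F n b i) (modelZ F n b r j) = 0 := by
  rw [modelZ, map_sub, modelMul_DQ, modelMul_DQ, sub_zero]

theorem modelMul_WZ (hb : b → 3 ∣ n) (j : ℤ) (r : ZMod 3) {k : ℤ} (hk : 3 ∣ k) :
    modelMul F n b (modelW F n b j) (modelZ F n b r k)
      = -(3 / 8 : F) • (modelZ F n b r (j - k) + modelZ F n b r (j + k)) := by
  rw [modelZ, map_sub, modelMul_WQ hb _ _ hk, modelMul_WQ hb _ _ hk, modelZ, modelZ]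
  module

/-- The two halves of z move -(r + t) by -1 and +1, which leaves a difference of z's, that is 3q by
`modelZ_sub`. The coefficient 1/8 thereby becomes 3/8, matching that of products with w. -/
theorem modelMul_ZQ (hb : b → 3 ∣ n) (r : ZMod 3) {j : ℤ} (t : ZMod 3) {k : ℤ} (hj : 3 ∣ j)
    (hk : 3 ∣ k) : modelMul F n b (modelZ F n b r j) (modelQ F n b t k)
      = -(3 / 8 : F) • (modelQ F n b (-(r + t)) (j - k) + modelQ F n b (-(r + t)) (j + k)) := by
  have e1 : ∀ x y : ZMod 3, -(x + 1 + y) = -(x + y) - 1 := by decide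
  have e2 : ∀ x y : ZMod 3, -(x - 1 + y) = -(x + y) + 1 := by decide
  have m1 := modelZ_sub (F := F) (n := n) (b := b) (-(r + t)) (j - k)
  have m2 := modelZ_sub (F := F) (n := n) (b := b) (-(r + t)) (j + k)
  rw [modelZ, map_sub, LinearMap.sub_apply, modelMul_QQ hb _ _ hj hk, modelMul_QQ hb _ _ hj hk,
    e1, e2]
  change _ • (modelZ F n b _ _ + modelZ F n b _ _) - _ • (modelZ F n b _ _ + modelZ F n b _ _) = _
  linear_combination (norm := module) -(1 / 8 : F) • m1 - (1 / 8 : F) • m2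

theorem modelMul_ZZ (hb : b → 3 ∣ n) (r : ZMod 3) {j : ℤ} (t : ZMod 3) {k : ℤ} (hj : 3 ∣ j)
    (hk : 3 ∣ k) : modelMul F n b (modelZ F n b r j) (modelZ F n b t k)
      = (3 / 8 : F) • (modelZ F n b (-(r + t)) (j - k) + modelZ F n b (-(r + t)) (j + k)) := by
  have e1 : ∀ x y : ZMod 3, -(x + (y + 1)) = -(x + y) - 1 := by decide
  have e2 : ∀ x y : ZMod 3, -(x + (y - 1)) = -(x + y) + 1 := by decide
  rw [modelZ.eq_def F n b t, map_sub, modelMul_ZQ hb _ _ hj hk, modelMul_ZQ hb _ _ hj hk, e1, e2,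
    modelZ, modelZ]
  module

theorem toModel_mul_aa (h2 : (2 : F) ≠ 0) (hb : b → 3 ∣ n) (hb5 : b → (5 : F) = 0) (i k : ℤ) :
    toModel F n b (a F i * a F k)
      = modelMul F n b (toModel F n b (a F i)) (toModel F n b (a F k)) := by
  have h4 := four_ne_zero_of_two h2
  have h8 := eight_ne_zero_of_two h2
  have d0 : (3 : ℤ) ∣ 0 := by decide
  rw [(isCoverImage_cover h2).mul_AA]
  simp only [toModel_a, map_add, map_sub, map_smul, toModel_s, LinearMap.add_apply,
    LinearMap.sub_apply, LinearMap.smul_apply]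
  rw [modelMul_DD hb, modelMul_comm hb (modelD F n b i) (modelC F n b), modelMul_CD, modelMul_DW,
    modelMul_DZ, modelMul_CD, modelMul_CC, modelMul_CW, modelMul_CZ,
    modelMul_comm hb (modelW F n b 0) (modelD F n b k), modelMul_DW,
    modelMul_comm hb (modelW F n b 0) (modelC F n b), modelMul_CW, modelMul_WW,
    modelMul_WZ hb _ _ d0, modelMul_comm hb _ (modelD F n b k), modelMul_DZ,
    modelMul_comm hb _ (modelC F n b), modelMul_CZ, modelMul_comm hb _ (modelW F n b 0),
    modelMul_WZ hb _ _ d0, modelMul_ZZ hb _ _ d0 d0, sgn_sub]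
  simp only [sub_zero, add_zero]
  -- If 3 ∣ i - k, then z_{i,0} = z_{k,0} and both sides agree identically. Otherwise the q's of
  -- index i - k vanish, and z_{i,0} + z_{i+1,0} + z_{i-1,0} = 0 reduces the discrepancy to a
  -- multiple of 5z.
  by_cases h : (3 : ℤ) ∣ i - k
  · have hik : (k : ZMod 3) = i := (ZMod.intCast_eq_intCast_iff_dvd_sub k i 3).2 h
    have e : ∀ x : ZMod 3, -(x + x) = x := by decide
    rw [toModel_p _ h, toModel_p _ h, hik, e, sgn_sub]
    simp only [modelZ]
    match_scalars <;> field_simp <;> ring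
  · have hik : (k : ZMod 3) ≠ i := fun e => h ((ZMod.intCast_eq_intCast_iff_dvd_sub k i 3).1 e)
    have e : ∀ x y : ZMod 3, y ≠ x → (y = x + 1 ∧ -(x + y) = x - 1) ∨
      (y = x - 1 ∧ -(x + y) = x + 1) := by decide
    rw [toModel_p_of_not_dvd _ h, toModel_p_of_not_dvd _ h, modelQ_eq_zero hb _ h,
      modelQ_eq_zero hb _ h]
    have s := modelZ_sum (F := F) (n := n) (b := b) i 0
    have f := five_smul_modelZ (F := F) (n := n) hb5 (-(i + k)) 0
    rcases e _ _ hik with ⟨e1, e2⟩ | ⟨e1, e2⟩ <;> rw [e2] at f ⊢ <;> rw [e1]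
    · linear_combination (norm := (match_scalars <;> field_simp <;> ring)) (2 : F) • s - f
    · linear_combination (norm := (match_scalars <;> field_simp <;> ring)) (2 : F) • s - f

theorem toModel_mul_as (h2 : (2 : F) ≠ 0) (hb : b → 3 ∣ n) (hb5 : b → (5 : F) = 0) (i j : ℤ) :
    toModel F n b (a F i * s F j.natAbs)
      = modelMul F n b (toModel F n b (a F i)) (toModel F n b (s F j.natAbs)) := by
  have h4 := four_ne_zero_of_two h2
  have h8 := eight_ne_zero_of_two h2
  have d0 : (3 : ℤ) ∣ 0 := by decide
  rw [(isCoverImage_cover h2).mul_AS]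
  simp only [toModel_a, map_add, map_sub, map_smul, toModel_s, LinearMap.add_apply,
    LinearMap.sub_apply, LinearMap.smul_apply]
  rw [modelMul_DW, modelMul_DW, modelMul_CW, modelMul_CW, modelMul_WW, modelMul_WW,
    modelMul_comm hb _ (modelW F n b j), modelMul_comm hb _ (modelW F n b 0),
    modelMul_WZ hb _ _ d0, modelMul_WZ hb _ _ d0, sgn_sub, sgn_add, zero_sub, zero_add, modelW_neg]
  simp only [sub_zero, add_zero]
  by_cases h : (3 : ℤ) ∣ j
  · have hj : (j : ZMod 3) = 0 := (ZMod.intCast_zmod_eq_zero_iff_dvd j 3).2 h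
    have f1 := five_smul_modelZ (F := F) (n := n) hb5 i 0
    have f2 := five_smul_modelZ (F := F) (n := n) hb5 i j
    rw [toModel_p _ h, toModel_p _ h]
    push_cast
    rw [hj, sub_zero, add_zero]
    simp only [modelZ] at f1 f2 ⊢
    linear_combination (norm := (match_scalars <;> field_simp <;> ring))
      (1 / 2 : F) • f1 - (sgn F j / 2) • f2
  · have hj : (j : ZMod 3) ≠ 0 := fun e => h ((ZMod.intCast_zmod_eq_zero_iff_dvd j 3).1 e)
    have e : ∀ y : ZMod 3, y ≠ 0 → y = 1 ∨ y = -1 := by decide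
    have s := modelZ_sum (F := F) (n := n) (b := b) i 0
    have f := five_smul_modelZ (F := F) (n := n) hb5 i 0
    rw [toModel_p_of_not_dvd _ h, toModel_p_of_not_dvd _ h, modelZ_eq_zero hb _ h]
    push_cast
    rcases e _ hj with e1 | e1 <;> rw [e1]
    · linear_combination (norm := (match_scalars <;> field_simp <;> ring))
        -(3 / 4 : F) • s + (3 / 4 : F) • f
    · rw [sub_neg_eq_add, ← sub_eq_add_neg]
      linear_combination (norm := (match_scalars <;> field_simp <;> ring))
        -(3 / 4 : F) • s + (3 / 4 : F) • f

/-- The term -2w_0 of a_i accounts for the 3/2. The term -2z_{i,0} gives q_{-(i+r)} the coefficient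
3/2 where the cover has -1, and the gap 5/2 vanishes. -/
theorem toModel_mul_ap (h2 : (2 : F) ≠ 0) (hb : b → 3 ∣ n) (hb5 : b → (5 : F) = 0) (i : ℤ)
    (r : ZMod 3) {k : ℤ} (hk : 3 ∣ k) : toModel F n b (a F i * p F r k.natAbs)
      = modelMul F n b (toModel F n b (a F i)) (toModel F n b (p F r k.natAbs)) := by
  have h4 := four_ne_zero_of_two h2
  have h8 := eight_ne_zero_of_two h2
  have d0 : (3 : ℤ) ∣ 0 := by decide
  rw [(isCoverImage_cover h2).mul_AP]
  simp only [toModel_a, map_add, map_sub, map_smul, toModel_p _ hk, LinearMap.add_apply,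
    LinearMap.sub_apply, LinearMap.smul_apply]
  have f1 := five_smul_modelQ (F := F) (n := n) hb5 (-(i + r)) 0
  have f2 := five_smul_modelQ (F := F) (n := n) hb5 (-(i + r)) k
  rw [modelMul_DQ, modelMul_DQ, modelMul_CQ, modelMul_CQ, modelMul_WQ hb _ _ hk,
    modelMul_WQ hb _ _ d0, modelMul_ZQ hb _ _ d0 hk, modelMul_ZQ hb _ _ d0 d0]
  simp only [zero_sub, zero_add, modelQ_neg, neg_zero]
  linear_combination (norm := (match_scalars <;> field_simp <;> ring))
      (1 / 2 : F) • f1 - (sgn F k / 2) • f2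

theorem toModel_mul_ss (h2 : (2 : F) ≠ 0) (j k : ℤ) :
    toModel F n b (s F j.natAbs * s F k.natAbs)
      = modelMul F n b (toModel F n b (s F j.natAbs)) (toModel F n b (s F k.natAbs)) := by
  have h4 := four_ne_zero_of_two h2
  have h8 := eight_ne_zero_of_two h2
  rw [(isCoverImage_cover h2).mul_SS]
  simp only [toModel_s, map_add, map_sub, map_smul, LinearMap.sub_apply, LinearMap.smul_apply,
    modelMul_WW, sgn_sub, sgn_add, zero_sub, zero_add, modelW_neg, sub_zero, add_zero]
  match_scalars <;> field_simp <;> ring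

theorem toModel_mul_sp (h2 : (2 : F) ≠ 0) (hb : b → 3 ∣ n) (j : ℤ) (r : ZMod 3) {k : ℤ}
    (hk : 3 ∣ k) : toModel F n b (s F j.natAbs * p F r k.natAbs)
      = modelMul F n b (toModel F n b (s F j.natAbs)) (toModel F n b (p F r k.natAbs)) := by
  have h4 := four_ne_zero_of_two h2
  have h8 := eight_ne_zero_of_two h2
  have d0 : (3 : ℤ) ∣ 0 := by decide
  rw [(isCoverImage_cover h2).mul_SP _ _ hk]
  simp only [toModel_s, toModel_p _ hk, map_add, map_sub, map_smul, LinearMap.sub_apply,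
    LinearMap.smul_apply, modelMul_WQ hb _ _ hk, modelMul_WQ hb _ _ d0, zero_sub, zero_add,
    modelQ_neg, sub_zero, add_zero]
  by_cases h : (3 : ℤ) ∣ j
  · rw [toModel_p _ h, toModel_p _ (dvd_sub h hk), toModel_p _ (dvd_add h hk), sgn_sub, sgn_add]
    match_scalars <;> field_simp <;> ring
  · have hs : ¬ (3 : ℤ) ∣ j - k := by omega
    have ha : ¬ (3 : ℤ) ∣ j + k := by omega
    rw [toModel_p_of_not_dvd _ h, toModel_p_of_not_dvd _ hs, toModel_p_of_not_dvd _ ha,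
      modelQ_eq_zero hb _ h, modelQ_eq_zero hb _ hs, modelQ_eq_zero hb _ ha]
    match_scalars <;> field_simp <;> ring

theorem toModel_mul_pp (h2 : (2 : F) ≠ 0) (hb : b → 3 ∣ n) (r : ZMod 3) {j : ℤ} (t : ZMod 3) {k : ℤ}
    (hj : 3 ∣ j) (hk : 3 ∣ k) : toModel F n b (p F r j.natAbs * p F t k.natAbs)
      = modelMul F n b (toModel F n b (p F r j.natAbs)) (toModel F n b (p F t k.natAbs)) := by
  have h4 := four_ne_zero_of_two h2
  have h8 := eight_ne_zero_of_two h2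
  have d0 : (3 : ℤ) ∣ 0 := by decide
  rw [(isCoverImage_cover h2).mul_PP _ _ hj hk]
  simp only [toModel_p _ hj, toModel_p _ hk, toModel_p _ (dvd_sub hj hk),
    toModel_p _ (dvd_add hj hk), map_add, map_sub, map_smul, LinearMap.sub_apply,
    LinearMap.smul_apply, modelMul_QQ hb _ _ hj hk, modelMul_QQ hb _ _ d0 hk,
    modelMul_QQ hb _ _ hj d0, modelMul_QQ hb _ _ d0 d0, zero_sub, zero_add,
    modelQ_neg, sub_zero, add_zero, sgn_sub, sgn_add]
  match_scalars <;> field_simp <;> ring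

theorem toModel_mul (h2 : (2 : F) ≠ 0) (hb : b → 3 ∣ n) (hb5 : b → (5 : F) = 0) (x y : Cover F) :
    toModel F n b (x * y) = modelMul F n b (toModel F n b x) (toModel F n b y) := by
  have hs : ∀ j : {j : ℕ // 0 < j}, basis F (.s j) = s F ((j : ℕ) : ℤ).natAbs := fun j => by
    rw [Int.natAbs_natCast, s_eq_basis j.2]
  have hp : ∀ (r : {r : ZMod 3 // r ≠ 0}) (k : {k : ℕ // 0 < k ∧ 3 ∣ k}),
      basis F (.p r k) = p F r ((k : ℕ) : ℤ).natAbs := fun r k => by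
    rw [Int.natAbs_natCast, p_eq_basis r.2 k.2]
  have h3 : ∀ (k : {k : ℕ // 0 < k ∧ 3 ∣ k}), (3 : ℤ) ∣ ((k : ℕ) : ℤ) := fun k => by
    exact_mod_cast k.2.2
  suffices h : (LinearMap.mul F (Cover F)).compr₂ (toModel F n b)
      = (modelMul F n b).compl₁₂ (toModel F n b) (toModel F n b) from LinearMap.congr_fun₂ h x y
  refine (basis F).ext fun x => (basis F).ext fun y => ?_
  simp only [LinearMap.compr₂_apply, LinearMap.mul_apply', LinearMap.compl₁₂_apply]
  have key : ∀ x y, toModel F n b (x * y) = modelMul F n b (toModel F n b x) (toModel F n b y) →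
      toModel F n b (y * x) = modelMul F n b (toModel F n b y) (toModel F n b x) := by
    intro x y h
    rw [mul_comm, h, modelMul_comm hb]
  rcases x with i | j | ⟨r, k⟩ <;> rcases y with i' | j' | ⟨t, l⟩ <;>
    simp only [hs, hp, ← a.eq_def]
  · exact toModel_mul_aa h2 hb hb5 i i'
  · exact toModel_mul_as h2 hb hb5 i _
  · exact toModel_mul_ap h2 hb hb5 i _ (h3 l)
  · exact key _ _ (toModel_mul_as h2 hb hb5 i' _)
  · exact toModel_mul_ss h2 _ _
  · exact toModel_mul_sp h2 hb _ _ (h3 l)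
  · exact key _ _ (toModel_mul_ap h2 hb hb5 i' _ (h3 k))
  · exact key _ _ (toModel_mul_sp h2 hb _ _ (h3 k))
  · exact toModel_mul_pp h2 hb _ _ (h3 k) (h3 l)

end ToModel

end Highwater

namespace Highwater

/-! ### Eigenvectors of the axes a_i in the model, and their products. -/

section ModelEigenvectors

variable {F : Type*} [Field F] {n : ℕ} [NeZero n] {b : Prop}

theorem eq_top_of_mem_model {N : Submodule F (Model F n b)} (hc : modelC F n b ∈ N)
    (hd : ∀ i, modelD F n b i ∈ N) (hw : ∀ j, modelW F n b j ∈ N)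
    (hq : ∀ r j, modelQ F n b r j ∈ N) : N = ⊤ := by
  rw [eq_top_iff, ← Finsupp.basisSingleOne.span_eq, Submodule.span_le]
  rintro x ⟨x, rfl⟩
  rw [Finsupp.coe_basisSingleOne]
  rcases x with x | x | u | ⟨⟨r, hr⟩, ⟨u, hu⟩⟩
  · exact hc
  · have := hd (x.val : ℤ)
    simpa [modelD] using this
  · have := hw (u.val : ℤ)
    simpa [modelW, absClass_natCast] using this
  · have := hq r (u.val : ℤ)
    have hu' : b ∧ 3 ∣ (absClass n (u.val : ℤ)).val := by rwa [absClass_natCast]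
    rw [modelQ_eq_single hr hu'] at this
    simpa [absClass_natCast] using this

variable (F n b)

/-- The elements `(-1)^i (d_{i+j} + d_{i-j})`. -/
def modelE (i j : ℤ) : Model F n b := sgn F i • (modelD F n b (i + j) + modelD F n b (i - j))

/-- The elements `w_j + z_{i,j}`. -/
def modelT (i j : ℤ) : Model F n b := modelW F n b j + modelZ F n b i j

/-- The elements `d_{i+j} - d_{i-j}`. -/
def modelM (i j : ℤ) : Model F n b := modelD F n b (i + j) - modelD F n b (i - j)

open Classical in
/-- The indicator function of the integers not divisible by `3`. -/
def ind (F : Type*) [Field F] (j : ℤ) : F := if 3 ∣ j then 0 else 1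

variable {F n b}

/-- For 3 ∣ j both terms equal z_{i,x}. Otherwise i ± j are the two other residues, and the three
z's sum to zero. -/
theorem modelZ_add_sub (i j x : ℤ) :
    modelZ F n b ((i + j : ℤ) : ZMod 3) x + modelZ F n b ((i - j : ℤ) : ZMod 3) x
      = (2 - 3 * ind F j) • modelZ F n b i x := by
  by_cases h : (3 : ℤ) ∣ j
  · have hj : (j : ZMod 3) = 0 := (ZMod.intCast_zmod_eq_zero_iff_dvd j 3).2 h
    push_cast
    rw [hj, ind, if_pos h, add_zero, sub_zero]
    module
  · have hj : (j : ZMod 3) ≠ 0 := fun e => h ((ZMod.intCast_zmod_eq_zero_iff_dvd j 3).1 e)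
    have e : ∀ y : ZMod 3, y ≠ 0 → y = 1 ∨ y = -1 := by decide
    have s := modelZ_sum (F := F) (n := n) (b := b) i x
    rw [ind, if_neg h]
    push_cast
    rcases e _ hj with e1 | e1 <;> rw [e1]
    · linear_combination (norm := module) s
    · rw [sub_neg_eq_add, ← sub_eq_add_neg]
      linear_combination (norm := module) s

/-- The constant is 0, 3 or -3 according to j modulo 3; later only its vanishing for 3 ∣ j and its
independence of `x` matter. -/
theorem exists_modelZ_sub (i j : ℤ) : ∃ c : F, (3 ∣ j → c = 0) ∧ ∀ x : ℤ,
    modelZ F n b ((i + j : ℤ) : ZMod 3) x - modelZ F n b ((i - j : ℤ) : ZMod 3) x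
      = c • modelQ F n b i x := by
  by_cases h : (3 : ℤ) ∣ j
  · have hj : (j : ZMod 3) = 0 := (ZMod.intCast_zmod_eq_zero_iff_dvd j 3).2 h
    refine ⟨0, fun _ => rfl, fun x => ?_⟩
    push_cast
    rw [hj, add_zero, sub_zero, sub_self, zero_smul]
  · have hj : (j : ZMod 3) ≠ 0 := fun e => h ((ZMod.intCast_zmod_eq_zero_iff_dvd j 3).1 e)
    have e : ∀ y : ZMod 3, y ≠ 0 → y = 1 ∨ y = -1 := by decide
    rcases e _ hj with e1 | e1
    · refine ⟨-3, fun h' => absurd h' h, fun x => ?_⟩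
      have s := modelZ_sub (F := F) (n := n) (b := b) i x
      push_cast
      rw [e1]
      linear_combination (norm := module) -s
    · refine ⟨3, fun h' => absurd h' h, fun x => ?_⟩
      push_cast
      rw [e1, sub_neg_eq_add, ← sub_eq_add_neg, modelZ_sub]

theorem modelMul_EE (hb : b → 3 ∣ n) (i j k : ℤ) :
    modelMul F n b (modelE F n b i j) (modelE F n b i k)
      = (8 : F) • (modelT F n b i (j - k) + modelT F n b i (j + k))
        - (12 * ind F j) • (modelZ F n b i (j - k) + modelZ F n b i (j + k)) := by
  have e := sgn_mul_self (F := F) i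
  have s1 := modelZ_add_sub (F := F) (n := n) (b := b) i j (j - k)
  have s2 := modelZ_add_sub (F := F) (n := n) (b := b) i j (j + k)
  simp only [modelE, map_add, map_smul, LinearMap.add_apply, LinearMap.smul_apply, modelMul_DD hb]
  simp only [show i + j - (i + k) = j - k by ring, show i - j - (i + k) = -(j + k) by ring,
    show i + j - (i - k) = j + k by ring, show i - j - (i - k) = -(j - k) by ring, ← modelZ.eq_def,
    modelW_neg, modelZ_neg, modelT]
  rw [← smul_add, smul_smul, e, one_smul]
  linear_combination (norm := module) (4 : F) • s1 + (4 : F) • s2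

/-- Since w is even in its index, the w-terms cancel, and only differences of z's with first indices
i + j and i - j remain. -/
theorem modelMul_ME (hb : b → 3 ∣ n) (i j : ℤ) : ∃ c : F, (3 ∣ j → c = 0) ∧ ∀ k : ℤ,
    modelMul F n b (modelM F n b i j) (modelE F n b i k)
      = c • (modelQ F n b i (j - k) + modelQ F n b i (j + k)) := by
  obtain ⟨c, hc, h⟩ := exists_modelZ_sub (F := F) (n := n) (b := b) i j
  refine ⟨4 * sgn F i * c, fun hj => by rw [hc hj, mul_zero], fun k => ?_⟩
  simp only [modelE, modelM, map_add, map_sub, map_smul, LinearMap.sub_apply, modelMul_DD hb]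
  simp only [show i + j - (i + k) = j - k by ring, show i - j - (i + k) = -(j + k) by ring,
    show i + j - (i - k) = j + k by ring, show i - j - (i - k) = -(j - k) by ring, ← modelZ.eq_def,
    modelW_neg, modelZ_neg]
  linear_combination (norm := module) (4 * sgn F i) • h (j - k) + (4 * sgn F i) • h (j + k)

theorem modelMul_MM (hb : b → 3 ∣ n) (i j k : ℤ) :
    modelMul F n b (modelM F n b i j) (modelM F n b i k)
      = (8 : F) • (modelT F n b i (j - k) - modelT F n b i (j + k))
        - (12 * ind F j) • (modelZ F n b i (j - k) - modelZ F n b i (j + k)) := by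
  have s1 := modelZ_add_sub (F := F) (n := n) (b := b) i j (j - k)
  have s2 := modelZ_add_sub (F := F) (n := n) (b := b) i j (j + k)
  simp only [modelM, map_sub, LinearMap.sub_apply, modelMul_DD hb]
  simp only [show i + j - (i + k) = j - k by ring, show i - j - (i + k) = -(j + k) by ring,
    show i + j - (i - k) = j + k by ring, show i - j - (i - k) = -(j - k) by ring, ← modelZ.eq_def,
    modelW_neg, modelZ_neg, modelT]
  linear_combination (norm := module) (4 : F) • s1 - (4 : F) • s2

theorem modelMul_EZ (i j : ℤ) (r : ZMod 3) (k : ℤ) :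
    modelMul F n b (modelE F n b i j) (modelZ F n b r k) = 0 := by
  rw [modelE, map_smul, LinearMap.smul_apply, map_add, LinearMap.add_apply, modelMul_DZ,
    modelMul_DZ, add_zero, smul_zero]

theorem modelMul_EQ (i j : ℤ) (r : ZMod 3) (k : ℤ) :
    modelMul F n b (modelE F n b i j) (modelQ F n b r k) = 0 := by
  rw [modelE, map_smul, LinearMap.smul_apply, map_add, LinearMap.add_apply, modelMul_DQ,
    modelMul_DQ, add_zero, smul_zero]

theorem modelMul_MZ (i j : ℤ) (r : ZMod 3) (k : ℤ) :
    modelMul F n b (modelM F n b i j) (modelZ F n b r k) = 0 := by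
  rw [modelM, map_sub, LinearMap.sub_apply, modelMul_DZ, modelMul_DZ, sub_zero]

theorem modelMul_MQ (i j : ℤ) (r : ZMod 3) (k : ℤ) :
    modelMul F n b (modelM F n b i j) (modelQ F n b r k) = 0 := by
  rw [modelM, map_sub, LinearMap.sub_apply, modelMul_DQ, modelMul_DQ, sub_zero]

theorem modelMul_ET (i j k : ℤ) : modelMul F n b (modelE F n b i j) (modelT F n b i k)
    = (3 / 8 : F) • (modelE F n b i (j - k) + modelE F n b i (j + k)) := by
  rw [modelT, map_add, modelMul_EZ, modelE, map_smul, LinearMap.smul_apply, map_add,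
    LinearMap.add_apply, modelMul_DW, modelMul_DW, modelE, modelE, show i + j - k = i + (j - k) by ring,
    show i + j + k = i + (j + k) by ring, show i - j - k = i - (j + k) by ring,
    show i - j + k = i - (j - k) by ring]
  module

theorem modelMul_MT (i j k : ℤ) : modelMul F n b (modelM F n b i j) (modelT F n b i k)
    = (3 / 8 : F) • (modelM F n b i (j - k) + modelM F n b i (j + k)) := by
  rw [modelT, map_add, modelMul_MZ, modelM, map_sub,
    LinearMap.sub_apply, modelMul_DW, modelMul_DW, modelM, modelM, show i + j - k = i + (j - k) by ring,
    show i + j + k = i + (j + k) by ring, show i - j - k = i - (j + k) by ring,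
    show i - j + k = i - (j - k) by ring]
  module

theorem neg_add_self_zmod_three (x : ZMod 3) : -(x + x) = x := by revert x; decide

/-- The coefficient -3/8 from multiplication by w cancels 3/8 from multiplication by z when 3
divides both j and k; in the other cases every q involved is zero. -/
theorem modelMul_ZT (hb : b → 3 ∣ n) (i j k : ℤ) :
    modelMul F n b (modelZ F n b i j) (modelT F n b i k) = 0 := by
  by_cases hj : (3 : ℤ) ∣ j
  · rw [modelT, map_add, modelMul_comm hb _ (modelW F n b k), modelMul_WZ hb _ _ hj]
    by_cases hk : (3 : ℤ) ∣ k
    · rw [modelMul_ZZ hb _ _ hj hk, neg_add_self_zmod_three, ← neg_sub j k, modelZ_neg, add_comm k j]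
      module
    · rw [modelZ_eq_zero hb _ hk, modelZ_eq_zero hb (j := k - j) _ (by omega),
        modelZ_eq_zero hb (j := k + j) _ (by omega), map_zero]
      simp
  · rw [modelZ_eq_zero hb _ hj, map_zero, LinearMap.zero_apply]

theorem modelMul_TT (hb : b → 3 ∣ n) (i j k : ℤ) :
    modelMul F n b (modelT F n b i j) (modelT F n b i k)
      = -(3 / 8 : F) • (modelT F n b i (j - k) + modelT F n b i (j + k))
        + (3 / 8 * ind F j) • (modelZ F n b i (j - k) + modelZ F n b i (j + k)) := by
  rw [modelT, map_add, LinearMap.add_apply, modelMul_ZT hb, modelT, map_add, modelMul_WW]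
  simp only [modelT]
  by_cases hk : (3 : ℤ) ∣ k
  · rw [modelMul_WZ hb _ _ hk]
    by_cases hj : (3 : ℤ) ∣ j
    · rw [ind, if_pos hj]
      module
    · rw [modelZ_eq_zero hb (j := j - k) _ (by omega), modelZ_eq_zero hb (j := j + k) _ (by omega)]
      module
  · rw [modelZ_eq_zero hb _ hk, map_zero]
    by_cases hj : (3 : ℤ) ∣ j
    · rw [modelZ_eq_zero hb (j := j - k) _ (by omega), modelZ_eq_zero hb (j := j + k) _ (by omega)]
      module
    · rw [ind, if_neg hj]
      module

/-- Here the contributions of w and z have the same sign and add up, in contrast to `modelMul_ZT`.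
-/
theorem modelMul_QT (hb : b → 3 ∣ n) (i : ℤ) {j : ℤ} (hj : 3 ∣ j) (k : ℤ) :
    modelMul F n b (modelQ F n b i j) (modelT F n b i k) = -(3 / 8 * 2 : F) •
      (modelQ F n b i (j - k) + modelQ F n b i (j + k)) := by
  rw [modelT, map_add, modelMul_comm hb _ (modelW F n b k), modelMul_WQ hb _ _ hj]
  by_cases hk : (3 : ℤ) ∣ k
  · rw [modelMul_comm hb _ (modelZ F n b i k), modelMul_ZQ hb _ _ hk hj, neg_add_self_zmod_three,
      ← neg_sub j k, modelQ_neg, add_comm k j]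
    module
  · rw [modelZ_eq_zero hb _ hk, modelQ_eq_zero hb (j := k - j) _ (by omega),
      modelQ_eq_zero hb (j := k + j) _ (by omega), modelQ_eq_zero hb (j := j - k) _ (by omega),
      modelQ_eq_zero hb (j := j + k) _ (by omega), map_zero]
    simp

variable (F n b)

/-- Eigenvectors of `a_i` for the eigenvalue `0`. -/
def modelU (i j : ℤ) : Model F n b := (8 : F) • modelT F n b i j - (3 : F) • modelE F n b i j

/-- Eigenvectors of `a_i` for the eigenvalue `2`. -/
def modelV (i j : ℤ) : Model F n b := (8 : F) • modelT F n b i j + modelE F n b i j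

variable {F n b}

theorem toModel_a_eq (h2 : (2 : F) ≠ 0) (i : ℤ) : toModel F n b (a F i)
    = (1 / 4 : F) • modelE F n b i 0 + modelC F n b - (2 : F) • modelT F n b i 0 := by
  have h4 := four_ne_zero_of_two h2
  rw [toModel_a, modelE, modelT, add_zero, sub_zero]
  match_scalars <;> field_simp <;> ring

theorem modelMul_CE (i j : ℤ) : modelMul F n b (modelC F n b) (modelE F n b i j)
    = (2 : F) • modelE F n b i j := by
  rw [modelE, map_smul, map_add, modelMul_CD, modelMul_CD]
  module

theorem modelMul_CM (i j : ℤ) : modelMul F n b (modelC F n b) (modelM F n b i j)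
    = (2 : F) • modelM F n b i j := by
  rw [modelM, map_sub, modelMul_CD, modelMul_CD]
  module

theorem modelMul_CT (i j : ℤ) : modelMul F n b (modelC F n b) (modelT F n b i j) = 0 := by
  rw [modelT, map_add, modelMul_CW, modelMul_CZ, add_zero]

theorem modelT_neg (i j : ℤ) : modelT F n b i (-j) = modelT F n b i j := by
  rw [modelT, modelW_neg, modelZ_neg, modelT]

theorem modelE_neg (i j : ℤ) : modelE F n b i (-j) = modelE F n b i j := by
  rw [modelE, modelE, ← sub_eq_add_neg, sub_neg_eq_add, add_comm (modelD F n b (i - j))]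

theorem ind_zero : ind F 0 = 0 := by simp [ind]

/-- Together with `modelMul_AT`, this describes a_i on the span of E_{i,j} and T_{i,j} by a matrix
with trace 2 and determinant 0. Its eigenvectors for 0 and 2 are `modelU` and `modelV`. -/
theorem modelMul_AE (h2 : (2 : F) ≠ 0) (hb : b → 3 ∣ n) (i j : ℤ) :
    modelMul F n b (toModel F n b (a F i)) (modelE F n b i j)
      = (4 : F) • modelT F n b i j + (1 / 2 : F) • modelE F n b i j := by
  have h4 := four_ne_zero_of_two h2
  have h8 := eight_ne_zero_of_two h2
  rw [toModel_a_eq h2, map_sub, map_add, map_smul, map_smul, LinearMap.sub_apply,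
    LinearMap.add_apply, LinearMap.smul_apply, LinearMap.smul_apply, modelMul_EE hb, modelMul_CE,
    modelMul_comm hb _ (modelE F n b i j), modelMul_ET, zero_sub, zero_add, modelT_neg, ind_zero,
    sub_zero, add_zero]
  match_scalars <;> field_simp <;> ring

theorem modelMul_AT (h2 : (2 : F) ≠ 0) (hb : b → 3 ∣ n) (i j : ℤ) :
    modelMul F n b (toModel F n b (a F i)) (modelT F n b i j)
      = (3 / 2 : F) • modelT F n b i j + (3 / 16 : F) • modelE F n b i j := by
  have h4 := four_ne_zero_of_two h2
  have h8 := eight_ne_zero_of_two h2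
  have h16 : (16 : F) ≠ 0 := by rw [show (16 : F) = 4 * 4 by norm_num]; exact mul_ne_zero h4 h4
  rw [toModel_a_eq h2, map_sub, map_add, map_smul, map_smul, LinearMap.sub_apply,
    LinearMap.add_apply, LinearMap.smul_apply, LinearMap.smul_apply, modelMul_ET, modelMul_CT,
    modelMul_TT hb, zero_sub, zero_add, modelT_neg, modelE_neg, ind_zero]
  match_scalars <;> field_simp <;> ring

theorem modelMul_AU (h2 : (2 : F) ≠ 0) (hb : b → 3 ∣ n) (i j : ℤ) :
    modelMul F n b (toModel F n b (a F i)) (modelU F n b i j) = 0 := by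
  have h4 := four_ne_zero_of_two h2
  have h16 : (16 : F) ≠ 0 := by rw [show (16 : F) = 4 * 4 by norm_num]; exact mul_ne_zero h4 h4
  rw [modelU, map_sub, map_smul, map_smul, modelMul_AE h2 hb, modelMul_AT h2 hb]
  match_scalars <;> field_simp <;> ring

theorem modelMul_AV (h2 : (2 : F) ≠ 0) (hb : b → 3 ∣ n) (i j : ℤ) :
    modelMul F n b (toModel F n b (a F i)) (modelV F n b i j) = (2 : F) • modelV F n b i j := by
  have h4 := four_ne_zero_of_two h2
  have h16 : (16 : F) ≠ 0 := by rw [show (16 : F) = 4 * 4 by norm_num]; exact mul_ne_zero h4 h4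
  rw [modelV, map_add, map_smul, modelMul_AE h2 hb, modelMul_AT h2 hb]
  match_scalars <;> field_simp <;> ring

theorem modelMul_AZ (h2 : (2 : F) ≠ 0) (hb : b → 3 ∣ n) (i j : ℤ) :
    modelMul F n b (toModel F n b (a F i)) (modelZ F n b i j) = 0 := by
  rw [toModel_a_eq h2, map_sub, map_add, map_smul, map_smul, LinearMap.sub_apply,
    LinearMap.add_apply, LinearMap.smul_apply, LinearMap.smul_apply, modelMul_EZ, modelMul_CZ,
    modelMul_comm hb _ (modelZ F n b i j), modelMul_ZT hb]
  simp

theorem modelMul_AM (h2 : (2 : F) ≠ 0) (hb : b → 3 ∣ n) (i j : ℤ) :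
    modelMul F n b (toModel F n b (a F i)) (modelM F n b i j)
      = (1 / 2 : F) • modelM F n b i j := by
  have h4 := four_ne_zero_of_two h2
  have h8 := eight_ne_zero_of_two h2
  obtain ⟨c, hc, h⟩ := modelMul_ME (F := F) hb i j
  -- The product is a multiple of q_{i,j}: for 3 ∣ j the constant is zero, otherwise q_{i,j} is.
  have h0 : modelMul F n b (modelM F n b i j) (modelE F n b i 0) = 0 := by
    rw [h]
    by_cases hj : (3 : ℤ) ∣ j
    · rw [hc hj, zero_smul]
    · rw [sub_zero, add_zero, modelQ_eq_zero hb _ hj, add_zero, smul_zero]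
  rw [modelMul_comm hb, toModel_a_eq h2, map_sub, map_add, map_smul, map_smul, h0,
    modelMul_comm hb _ (modelC F n b), modelMul_CM, modelMul_MT, sub_zero, add_zero]
  match_scalars; field_simp; ring

/-- Only -2T_{i,0} acts, and for 3 ∣ j it multiplies q_{i,j} by 3; this agrees with 1/2 exactly
because (5/2) q_{i,j} = 0. -/
theorem modelMul_AQ (h2 : (2 : F) ≠ 0) (hb : b → 3 ∣ n) (hb5 : b → (5 : F) = 0) (i j : ℤ) :
    modelMul F n b (toModel F n b (a F i)) (modelQ F n b i j)
      = (1 / 2 : F) • modelQ F n b i j := by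
  have h4 := four_ne_zero_of_two h2
  have h8 := eight_ne_zero_of_two h2
  by_cases hj : (3 : ℤ) ∣ j
  · rw [modelMul_comm hb, toModel_a_eq h2, map_sub, map_add, map_smul, map_smul,
      modelMul_comm hb _ (modelE F n b i 0), modelMul_EQ, modelMul_comm hb _ (modelC F n b),
      modelMul_CQ, modelMul_QT hb _ hj]
    simp only [sub_zero, add_zero]
    linear_combination (norm := (match_scalars <;> field_simp <;> ring))
      (1 / 2 : F) • five_smul_modelQ (F := F) (n := n) hb5 i j
  · rw [modelQ_eq_zero hb _ hj, map_zero, smul_zero]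

theorem modelMul_TE (hb : b → 3 ∣ n) (i j k : ℤ) :
    modelMul F n b (modelT F n b i k) (modelE F n b i j)
      = (3 / 8 : F) • (modelE F n b i (j - k) + modelE F n b i (j + k)) := by
  rw [modelMul_comm hb, modelMul_ET]

theorem modelE_sub_comm (i j k : ℤ) : modelE F n b i (j - k) = modelE F n b i (k - j) := by
  rw [← neg_sub, modelE_neg]

theorem modelMul_UU (h2 : (2 : F) ≠ 0) (hb : b → 3 ∣ n) (i j k : ℤ) :
    modelMul F n b (modelU F n b i j) (modelU F n b i k)
      = (6 : F) • (modelU F n b i (j - k) + modelU F n b i (j + k))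
        - (84 * ind F j) • (modelZ F n b i (j - k) + modelZ F n b i (j + k)) := by
  have h8 := eight_ne_zero_of_two h2
  simp only [modelU, map_sub, map_smul, LinearMap.sub_apply, LinearMap.smul_apply, modelMul_TT hb,
    modelMul_ET, modelMul_TE hb, modelMul_EE hb, modelE_sub_comm i k j, add_comm k j]
  match_scalars <;> field_simp <;> ring

/-- The products leave z-terms, which are 0-eigenvectors and would violate 0 ⋆ 2 = {2}; their
coefficients are multiples of 5. -/
theorem modelMul_UV (h2 : (2 : F) ≠ 0) (hb : b → 3 ∣ n) (hb5 : b → (5 : F) = 0) (i j k : ℤ) :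
    modelMul F n b (modelU F n b i j) (modelV F n b i k)
      = -(6 : F) • (modelV F n b i (j - k) + modelV F n b i (j + k)) := by
  have h8 := eight_ne_zero_of_two h2
  have f1 := five_smul_modelZ (F := F) (n := n) hb5 i (j - k)
  have f2 := five_smul_modelZ (F := F) (n := n) hb5 i (j + k)
  simp only [modelU, modelV, map_sub, map_add, map_smul, LinearMap.sub_apply, LinearMap.smul_apply,
    modelMul_TT hb, modelMul_ET, modelMul_TE hb, modelMul_EE hb, modelE_sub_comm i k j,
    add_comm k j]
  linear_combination (norm := (match_scalars <;> field_simp <;> ring))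
    (12 * ind F j) • f1 + (12 * ind F j) • f2

theorem modelMul_VV (h2 : (2 : F) ≠ 0) (hb : b → 3 ∣ n) (i j k : ℤ) :
    modelMul F n b (modelV F n b i j) (modelV F n b i k)
      = -(2 : F) • (modelU F n b i (j - k) + modelU F n b i (j + k))
        + (12 * ind F j) • (modelZ F n b i (j - k) + modelZ F n b i (j + k)) := by
  have h8 := eight_ne_zero_of_two h2
  simp only [modelU, modelV, map_add, map_smul, LinearMap.add_apply, LinearMap.smul_apply,
    modelMul_TT hb, modelMul_ET, modelMul_TE hb, modelMul_EE hb, modelE_sub_comm i k j,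
    add_comm k j]
  match_scalars <;> field_simp <;> ring

variable (F n b)

/-- A spanning set of the `0`-eigenspace of `a_i`. -/
def gen0 (i : ℤ) : Set (Model F n b) :=
  Set.range (modelU F n b i) ∪ Set.range (modelZ F n b i)

/-- A spanning set of the `2`-eigenspace of `a_i`. -/
def gen2 (i : ℤ) : Set (Model F n b) := Set.range (modelV F n b i)

/-- A spanning set of the `1/2`-eigenspace of `a_i`. -/
def genHalf (i : ℤ) : Set (Model F n b) :=
  Set.range (modelM F n b i) ∪ Set.range (modelQ F n b i)

variable {F n b}

theorem modelU_mem (i j : ℤ) : modelU F n b i j ∈ Submodule.span F (gen0 F n b i) :=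
  Submodule.subset_span (.inl ⟨j, rfl⟩)

theorem modelZ_mem (i j : ℤ) : modelZ F n b i j ∈ Submodule.span F (gen0 F n b i) :=
  Submodule.subset_span (.inr ⟨j, rfl⟩)

theorem modelV_mem (i j : ℤ) : modelV F n b i j ∈ Submodule.span F (gen2 F n b i) :=
  Submodule.subset_span ⟨j, rfl⟩

theorem modelM_mem (i j : ℤ) : modelM F n b i j ∈ Submodule.span F (genHalf F n b i) :=
  Submodule.subset_span (.inl ⟨j, rfl⟩)

theorem modelQ_mem (i j : ℤ) : modelQ F n b i j ∈ Submodule.span F (genHalf F n b i) :=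
  Submodule.subset_span (.inr ⟨j, rfl⟩)

theorem modelMul_ZU (hb : b → 3 ∣ n) (i j k : ℤ) :
    modelMul F n b (modelZ F n b i j) (modelU F n b i k) = 0 := by
  rw [modelU, map_sub, map_smul, map_smul, modelMul_ZT hb, modelMul_comm hb _ (modelE F n b i k),
    modelMul_EZ, smul_zero, smul_zero, sub_zero]

theorem modelMul_ZV (hb : b → 3 ∣ n) (i j k : ℤ) :
    modelMul F n b (modelZ F n b i j) (modelV F n b i k) = 0 := by
  rw [modelV, map_add, map_smul, modelMul_ZT hb, modelMul_comm hb _ (modelE F n b i k),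
    modelMul_EZ, smul_zero, add_zero]

theorem mul_gen0_gen0 (h2 : (2 : F) ≠ 0) (hb : b → 3 ∣ n) (i : ℤ) :
    ∀ g ∈ gen0 F n b i, ∀ h ∈ gen0 F n b i,
      modelMul F n b g h ∈ Submodule.span F (gen0 F n b i) := by
  rintro g (⟨j, rfl⟩ | ⟨j, rfl⟩) h (⟨k, rfl⟩ | ⟨k, rfl⟩)
  · rw [modelMul_UU h2 hb]
    exact sub_mem (Submodule.smul_mem _ _ (add_mem (modelU_mem _ _) (modelU_mem _ _)))
      (Submodule.smul_mem _ _ (add_mem (modelZ_mem _ _) (modelZ_mem _ _)))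
  · rw [modelMul_comm hb, modelMul_ZU hb]; exact zero_mem _
  · rw [modelMul_ZU hb]; exact zero_mem _
  · by_cases hj : (3 : ℤ) ∣ j
    · by_cases hk : (3 : ℤ) ∣ k
      · rw [modelMul_ZZ hb _ _ hj hk, neg_add_self_zmod_three]
        exact Submodule.smul_mem _ _ (add_mem (modelZ_mem _ _) (modelZ_mem _ _))
      · rw [modelZ_eq_zero hb _ hk, map_zero]; exact zero_mem _
    · rw [modelZ_eq_zero hb _ hj, map_zero, LinearMap.zero_apply]; exact zero_mem _

theorem mul_gen0_gen2 (h2 : (2 : F) ≠ 0) (hb : b → 3 ∣ n) (hb5 : b → (5 : F) = 0) (i : ℤ) :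
    ∀ g ∈ gen0 F n b i, ∀ h ∈ gen2 F n b i,
      modelMul F n b g h ∈ Submodule.span F (gen2 F n b i) := by
  rintro g (⟨j, rfl⟩ | ⟨j, rfl⟩) h ⟨k, rfl⟩
  · rw [modelMul_UV h2 hb hb5]
    exact Submodule.smul_mem _ _ (add_mem (modelV_mem _ _) (modelV_mem _ _))
  · rw [modelMul_ZV hb]; exact zero_mem _

theorem mul_gen2_gen2 (h2 : (2 : F) ≠ 0) (hb : b → 3 ∣ n) (i : ℤ) :
    ∀ g ∈ gen2 F n b i, ∀ h ∈ gen2 F n b i,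
      modelMul F n b g h ∈ Submodule.span F (gen0 F n b i) := by
  rintro g ⟨j, rfl⟩ h ⟨k, rfl⟩
  rw [modelMul_VV h2 hb]
  exact add_mem (Submodule.smul_mem _ _ (add_mem (modelU_mem _ _) (modelU_mem _ _)))
    (Submodule.smul_mem _ _ (add_mem (modelZ_mem _ _) (modelZ_mem _ _)))

theorem mul_T_genHalf (hb : b → 3 ∣ n) (i j : ℤ) : ∀ h ∈ genHalf F n b i,
    modelMul F n b (modelT F n b i j) h ∈ Submodule.span F (genHalf F n b i) := by
  rintro h (⟨k, rfl⟩ | ⟨k, rfl⟩)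
  · rw [modelMul_comm hb, modelMul_MT]
    exact Submodule.smul_mem _ _ (add_mem (modelM_mem _ _) (modelM_mem _ _))
  · by_cases hk : (3 : ℤ) ∣ k
    · rw [modelMul_comm hb, modelMul_QT hb _ hk]
      exact Submodule.smul_mem _ _ (add_mem (modelQ_mem _ _) (modelQ_mem _ _))
    · rw [modelQ_eq_zero hb _ hk, map_zero]; exact zero_mem _

theorem mul_E_genHalf (hb : b → 3 ∣ n) (i j : ℤ) : ∀ h ∈ genHalf F n b i,
    modelMul F n b (modelE F n b i j) h ∈ Submodule.span F (genHalf F n b i) := by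
  rintro h (⟨k, rfl⟩ | ⟨k, rfl⟩)
  · obtain ⟨c, -, hc⟩ := modelMul_ME (F := F) hb i k
    rw [modelMul_comm hb, hc]
    exact Submodule.smul_mem _ _ (add_mem (modelQ_mem _ _) (modelQ_mem _ _))
  · rw [modelMul_EQ]; exact zero_mem _

theorem mul_gen0_genHalf (hb : b → 3 ∣ n) (i : ℤ) :
    ∀ g ∈ gen0 F n b i, ∀ h ∈ genHalf F n b i,
      modelMul F n b g h ∈ Submodule.span F (genHalf F n b i) := by
  rintro g (⟨j, rfl⟩ | ⟨j, rfl⟩) h hh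
  · rw [modelU, map_sub, map_smul, map_smul]
    exact sub_mem (Submodule.smul_mem _ _ (mul_T_genHalf hb _ _ h hh))
      (Submodule.smul_mem _ _ (mul_E_genHalf hb _ _ h hh))
  · rcases hh with ⟨k, rfl⟩ | ⟨k, rfl⟩
    · rw [modelMul_comm hb, modelMul_MZ]; exact zero_mem _
    · by_cases hj : (3 : ℤ) ∣ j
      · by_cases hk : (3 : ℤ) ∣ k
        · rw [modelMul_ZQ hb _ _ hj hk, neg_add_self_zmod_three]
          exact Submodule.smul_mem _ _ (add_mem (modelQ_mem _ _) (modelQ_mem _ _))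
        · rw [modelQ_eq_zero hb _ hk, map_zero]; exact zero_mem _
      · rw [modelZ_eq_zero hb _ hj, map_zero, LinearMap.zero_apply]; exact zero_mem _

theorem mul_gen2_genHalf (hb : b → 3 ∣ n) (i : ℤ) :
    ∀ g ∈ gen2 F n b i, ∀ h ∈ genHalf F n b i,
      modelMul F n b g h ∈ Submodule.span F (genHalf F n b i) := by
  rintro g ⟨j, rfl⟩ h hh
  rw [modelV, map_add, map_smul]
  exact add_mem (Submodule.smul_mem _ _ (mul_T_genHalf hb _ _ h hh)) (mul_E_genHalf hb _ _ h hh)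

theorem modelT_mem (h2 : (2 : F) ≠ 0) (i j : ℤ) :
    modelT F n b i j ∈ Submodule.span F (gen0 F n b i ∪ gen2 F n b i) := by
  have h8 := eight_ne_zero_of_two h2
  have h4 := four_ne_zero_of_two h2
  have hu := Submodule.span_mono Set.subset_union_left (t := gen0 F n b i ∪ gen2 F n b i)
    (modelU_mem (F := F) (n := n) (b := b) i j)
  have hv := Submodule.span_mono Set.subset_union_right (t := gen0 F n b i ∪ gen2 F n b i)
    (modelV_mem (F := F) (n := n) (b := b) i j)
  have h32 : (32 : F) ≠ 0 := by rw [show (32 : F) = 4 * 8 by norm_num]; exact mul_ne_zero h4 h8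
  -- In U + 3V the E-terms cancel and 8T + 24T remains.
  have : modelT F n b i j = (1 / 32 : F) • (modelU F n b i j + (3 : F) • modelV F n b i j) := by
    rw [modelU, modelV]
    match_scalars <;> field_simp <;> ring
  rw [this]
  exact Submodule.smul_mem _ _ (add_mem hu (Submodule.smul_mem _ _ hv))

theorem modelE_mem (h2 : (2 : F) ≠ 0) (i j : ℤ) :
    modelE F n b i j ∈ Submodule.span F (gen0 F n b i ∪ gen2 F n b i) := by
  have hv := Submodule.span_mono Set.subset_union_right (t := gen0 F n b i ∪ gen2 F n b i)
    (modelV_mem (F := F) (n := n) (b := b) i j)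
  have : modelE F n b i j = modelV F n b i j - (8 : F) • modelT F n b i j := by
    rw [modelV]; module
  rw [this]
  exact sub_mem hv (Submodule.smul_mem _ _ (modelT_mem h2 i j))

theorem modelZ_mem' (i j : ℤ) :
    modelZ F n b i j ∈ Submodule.span F (gen0 F n b i ∪ gen2 F n b i) :=
  Submodule.span_mono Set.subset_union_left (modelZ_mem i j)

theorem mul_genHalf_genHalf (h2 : (2 : F) ≠ 0) (hb : b → 3 ∣ n) (i : ℤ) :
    ∀ g ∈ genHalf F n b i, ∀ h ∈ genHalf F n b i,
      modelMul F n b g h ∈ Submodule.span F (gen0 F n b i ∪ gen2 F n b i) := by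
  rintro g (⟨j, rfl⟩ | ⟨j, rfl⟩) h (⟨k, rfl⟩ | ⟨k, rfl⟩)
  · rw [modelMul_MM hb]
    exact sub_mem (Submodule.smul_mem _ _ (sub_mem (modelT_mem h2 _ _) (modelT_mem h2 _ _)))
      (Submodule.smul_mem _ _ (sub_mem (modelZ_mem' _ _) (modelZ_mem' _ _)))
  · rw [modelMul_MQ]; exact zero_mem _
  · rw [modelMul_comm hb, modelMul_MQ]; exact zero_mem _
  · by_cases hj : (3 : ℤ) ∣ j
    · by_cases hk : (3 : ℤ) ∣ k
      · rw [modelMul_QQ hb _ _ hj hk, neg_add_self_zmod_three]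
        exact Submodule.smul_mem _ _ (add_mem (modelZ_mem' _ _) (modelZ_mem' _ _))
      · rw [modelQ_eq_zero hb _ hk, map_zero]; exact zero_mem _
    · rw [modelQ_eq_zero hb _ hj, map_zero, LinearMap.zero_apply]; exact zero_mem _

/-- Solving the formula for a_i for c puts c in the sum of the eigenspaces for 1, 0 and 2. Hence
τ_{a_i} fixes c. -/
theorem modelC_mem (h2 : (2 : F) ≠ 0) (i : ℤ) : modelC F n b ∈
    Submodule.span F ({toModel F n b (a F i)} ∪ (gen0 F n b i ∪ gen2 F n b i)) := by
  have h4 := four_ne_zero_of_two h2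
  have hl := Submodule.span_mono (R := F) (Set.subset_union_right (s := {toModel F n b (a F i)})
    (t := gen0 F n b i ∪ gen2 F n b i))
  have : modelC F n b = toModel F n b (a F i) - (1 / 4 : F) • modelE F n b i 0
      + (2 : F) • modelT F n b i 0 := by
    rw [toModel_a_eq h2]; module
  rw [this]
  exact add_mem (sub_mem (Submodule.subset_span (.inl rfl))
    (Submodule.smul_mem _ _ (hl (modelE_mem h2 i 0))))
    (Submodule.smul_mem _ _ (hl (modelT_mem h2 i 0)))

theorem span_gen (h2 : (2 : F) ≠ 0) (i : ℤ) : Submodule.span F ({toModel F n b (a F i)}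
    ∪ gen0 F n b i ∪ gen2 F n b i ∪ genHalf F n b i) = ⊤ := by
  set N := Submodule.span F ({toModel F n b (a F i)} ∪ gen0 F n b i ∪ gen2 F n b i
    ∪ genHalf F n b i) with hN
  have l1 : Submodule.span F ({toModel F n b (a F i)} ∪ (gen0 F n b i ∪ gen2 F n b i)) ≤ N :=
    Submodule.span_mono (by rw [← Set.union_assoc]; exact Set.subset_union_left)
  have l2 := (Submodule.span_mono (R := F) (Set.subset_union_right
    (s := {toModel F n b (a F i)}) (t := gen0 F n b i ∪ gen2 F n b i))).trans l1
  have l3 : Submodule.span F (genHalf F n b i) ≤ N := Submodule.span_mono Set.subset_union_right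
  -- The vectors q_{i,j} and z_{i,j} determine all three q_{r,j}, because these sum to zero and 2 is
  -- invertible.
  have hq : ∀ r j, modelQ F n b r j ∈ N := by
    intro r j
    have hq0 : modelQ F n b i j ∈ N := l3 (modelQ_mem i j)
    have hz : modelZ F n b i j ∈ N := l2 (modelZ_mem' i j)
    have s := modelQ_sum (F := F) (n := n) (b := b) i j
    have e : ∀ x y : ZMod 3, y = x ∨ y = x + 1 ∨ y = x - 1 := by decide
    rcases e i r with rfl | rfl | rfl
    · exact hq0
    · have : modelQ F n b (i + 1) j = (1 / 2 : F) • (modelZ F n b i j - modelQ F n b i j) := by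
        rw [modelZ]
        linear_combination (norm := (match_scalars <;> field_simp <;> ring)) (1 / 2 : F) • s
      rw [this]
      exact Submodule.smul_mem _ _ (sub_mem hz hq0)
    · have : modelQ F n b (i - 1) j = -(1 / 2 : F) • (modelZ F n b i j + modelQ F n b i j) := by
        rw [modelZ]
        linear_combination (norm := (match_scalars <;> field_simp <;> ring)) (1 / 2 : F) • s
      rw [this]
      exact Submodule.smul_mem _ _ (add_mem hz hq0)
  refine eq_top_of_mem_model (l1 (modelC_mem h2 i)) (fun k => ?_) (fun j => ?_) hq
  · obtain ⟨j, rfl⟩ : ∃ j, k = i + j := ⟨k - i, by ring⟩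
    have e := sgn_mul_self (F := F) i
    have : modelD F n b (i + j) = (1 / 2 : F) • (sgn F i • modelE F n b i j + modelM F n b i j) := by
      rw [modelE, modelM, smul_smul, e]
      match_scalars <;> field_simp <;> ring
    rw [this]
    exact Submodule.smul_mem _ _ (add_mem (Submodule.smul_mem _ _ (l2 (modelE_mem h2 i j)))
      (l3 (modelM_mem i j)))
  · have : modelW F n b j = modelT F n b i j - modelZ F n b i j := by rw [modelT]; abel
    rw [this]
    exact sub_mem (l2 (modelT_mem h2 i j)) (l2 (modelZ_mem' i j))

end ModelEigenvectors

end Highwater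

namespace Highwater

/-! ### The model as a quotient of the cover: axes, axet, property (J), dimension. -/

section ModelQuotient

variable {F : Type*} [Field F] {n : ℕ} [NeZero n] {b : Prop}

/-- Because (-1)^n = -1, the images of s_n, p_{r,n} (when `b` holds) and a_i - a_{i+n} are -2w_0,
-2q_{r,0} and (-1)^i d_i. The remaining basis vectors are obtained by subtracting these. -/
theorem toModel_surjective (h2 : (2 : F) ≠ 0) (hn : Odd n) (hb : b → 3 ∣ n) :
    Function.Surjective (toModel F n b) := by
  rw [← LinearMap.range_eq_top]
  set N := LinearMap.range (toModel F n b) with hN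
  have hm : ∀ x, toModel F n b x ∈ N := fun x => ⟨x, rfl⟩
  have hsn : sgn F n = -1 := sgn_of_odd (by exact_mod_cast hn)
  have hw0 : modelW F n b 0 ∈ N := by
    have := hm (s F (n : ℤ).natAbs)
    have e := modelW_add (F := F) (n := n) (b := b) 0 1
    rw [zero_add, mul_one] at e
    rw [toModel_s, hsn, e] at this
    have h' : modelW F n b 0 = -(1 / 2 : F) • ((-1 : F) • modelW F n b 0 - modelW F n b 0) := by
      match_scalars; field_simp; ring
    rw [h']
    exact Submodule.smul_mem _ _ this
  have hw : ∀ j, modelW F n b j ∈ N := fun j => by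
    have := hm (s F j.natAbs)
    rw [toModel_s] at this
    have h' := Submodule.smul_mem _ (sgn F j) (add_mem this hw0)
    rwa [sub_add_cancel, smul_smul, sgn_mul_self, one_smul] at h'
  have hq0 : ∀ r, modelQ F n b r 0 ∈ N := fun r => by
    by_cases h : b
    · have := hm (p F r (n : ℤ).natAbs)
      have e := modelQ_add (F := F) (n := n) (b := b) r 0 1
      rw [zero_add, mul_one] at e
      rw [toModel_p _ (by exact_mod_cast hb h), hsn, e] at this
      have h' : modelQ F n b r 0 = -(1 / 2 : F) • ((-1 : F) • modelQ F n b r 0 - modelQ F n b r 0) := by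
        match_scalars; field_simp; ring
      rw [h']
      exact Submodule.smul_mem _ _ this
    · rw [modelQ_eq_zero_of_not h]; exact zero_mem _
  have hq : ∀ r j, modelQ F n b r j ∈ N := fun r j => by
    by_cases hj : (3 : ℤ) ∣ j
    · have := hm (p F r j.natAbs)
      rw [toModel_p _ hj] at this
      have h' := Submodule.smul_mem _ (sgn F j) (add_mem this (hq0 r))
      rwa [sub_add_cancel, smul_smul, sgn_mul_self, one_smul] at h'
    · rw [modelQ_eq_zero hb _ hj]; exact zero_mem _
  have hz : ∀ r, modelZ F n b r 0 ∈ N := fun r => sub_mem (hq0 _) (hq0 _)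
  have hdc : ∀ i, (sgn F i / 2) • modelD F n b i + modelC F n b ∈ N := fun i => by
    have := add_mem (add_mem (hm (a F i)) (Submodule.smul_mem _ (2 : F) (hz i)))
      (Submodule.smul_mem _ (2 : F) hw0)
    rwa [toModel_a, sub_add_cancel, sub_add_cancel] at this
  have hd : ∀ i, modelD F n b i ∈ N := fun i => by
    have h1 := sub_mem (hdc i) (hdc (i + n * 1))
    rw [modelD_add, sgn_add, mul_one, hsn] at h1
    have h' : modelD F n b i = sgn F i • ((sgn F i / 2) • modelD F n b i + modelC F n b
        - ((sgn F i * -1 / 2) • modelD F n b i + modelC F n b)) := by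
      have e := sgn_mul_self (F := F) i
      rw [add_sub_add_right_eq_sub, ← sub_smul, smul_smul,
        show sgn F i * (sgn F i / 2 - sgn F i * -1 / 2) = sgn F i * sgn F i by field_simp; ring, e,
        one_smul]
    rw [h']
    exact Submodule.smul_mem _ _ h1
  refine eq_top_of_mem_model ?_ hd hw hq
  have := sub_mem (hdc 0) (Submodule.smul_mem _ (sgn F 0 / 2) (hd 0))
  rwa [add_sub_cancel_left] at this

/-- The kernel of the projection of the cover onto the model. -/
def modelIdeal (F : Type*) [Field F] (n : ℕ) [NeZero n] (b : Prop) (h2 : (2 : F) ≠ 0)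
    (hb : b → 3 ∣ n) (hb5 : b → (5 : F) = 0) : AlgIdeal F (Cover F) where
  toSubmodule := LinearMap.ker (toModel F n b)
  mul_mem' x y hy := by
    have hy' : toModel F n b y = 0 := hy
    change toModel F n b (x * y) = 0
    rw [toModel_mul h2 hb hb5, hy', map_zero]

/-- The identification of the model with the quotient by its ideal. -/
def fromModel (h2 : (2 : F) ≠ 0) (hn : Odd n) (hb : b → 3 ∣ n)
    (hb5 : b → (5 : F) = 0) : Model F n b ≃ₗ[F] (modelIdeal F n b h2 hb hb5).Quot :=
  (LinearMap.quotKerEquivOfSurjective (toModel F n b) (toModel_surjective h2 hn hb)).symm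

theorem fromModel_toModel (h2 : (2 : F) ≠ 0) (hn : Odd n) (hb : b → 3 ∣ n)
    (hb5 : b → (5 : F) = 0) (x : Cover F) :
    fromModel h2 hn hb hb5 (toModel F n b x) = (modelIdeal F n b h2 hb hb5).toQuot x :=
  (LinearEquiv.symm_apply_eq _).2 rfl

theorem fromModel_mul (h2 : (2 : F) ≠ 0) (hn : Odd n) (hb : b → 3 ∣ n)
    (hb5 : b → (5 : F) = 0) (x y : Model F n b) : fromModel h2 hn hb hb5 (modelMul F n b x y)
    = fromModel h2 hn hb hb5 x * fromModel h2 hn hb hb5 y := by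
  obtain ⟨x, rfl⟩ := toModel_surjective h2 hn hb x
  obtain ⟨y, rfl⟩ := toModel_surjective h2 hn hb y
  rw [← toModel_mul h2 hb hb5, fromModel_toModel, fromModel_toModel, fromModel_toModel,
    AlgIdeal.toQuot_mul]

theorem fromModel_mem_span (h2 : (2 : F) ≠ 0) (hn : Odd n) (hb : b → 3 ∣ n)
    (hb5 : b → (5 : F) = 0) {S : Set (Model F n b)} {x : Model F n b}
    (hx : x ∈ Submodule.span F S) :
    fromModel h2 hn hb hb5 x ∈ Submodule.span F (fromModel h2 hn hb hb5 '' S) := by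
  have := Submodule.mem_map_of_mem (f := (fromModel h2 hn hb hb5).toLinearMap) hx
  rwa [Submodule.map_span] at this

theorem span_fromModel (h2 : (2 : F) ≠ 0) (hn : Odd n) (hb : b → 3 ∣ n)
    (hb5 : b → (5 : F) = 0) {S : Set (Model F n b)} (hS : Submodule.span F S = ⊤) :
    Submodule.span F (fromModel h2 hn hb hb5 '' S) = ⊤ := by
  have := Submodule.map_span (fromModel h2 hn hb hb5).toLinearMap S
  rw [hS, Submodule.map_top, LinearEquiv.range] at this
  exact this.symm

theorem two_ne_one : (2 : F) ≠ 1 := fun h => one_ne_zero (α := F) (by linear_combination h)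

theorem half_ne_one (h2 : (2 : F) ≠ 0) : (1 / 2 : F) ≠ 1 := fun h => by
  field_simp at h
  exact two_ne_one h.symm

theorem half_ne_two (h2 : (2 : F) ≠ 0) (h3 : (3 : F) ≠ 0) : (1 / 2 : F) ≠ 2 := fun h => by
  field_simp at h
  exact h3 (by linear_combination -h)

theorem modelQ_apply_inl (r : ZMod 3) (j : ℤ) (u : Unit) : modelQ F n b r j (.inl u) = 0 := by
  unfold modelQ
  split_ifs <;> simp

theorem modelQ_apply_D (r : ZMod 3) (j : ℤ) (x : ZMod n) :
    modelQ F n b r j (.inr (.inl x)) = 0 := by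
  unfold modelQ
  split_ifs <;> simp

theorem toModel_a_apply_C (i : ℤ) : toModel F n b (a F i) (.inl ()) = 1 := by
  rw [toModel_a]
  simp [modelZ, modelQ_apply_inl, modelC, modelD, modelW]

theorem toModel_a_apply_D (i k : ℤ) : toModel F n b (a F i) (.inr (.inl (k : ZMod n)))
    = if (i : ZMod n) = k then sgn F i / 2 else 0 := by
  rw [toModel_a]
  simp [modelZ, modelQ_apply_D, modelC, modelD, modelW, Finsupp.single_apply]

theorem isAxis_toQuot_a (h2 : (2 : F) ≠ 0) (hn : Odd n) (hb : b → 3 ∣ n)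
    (hb5 : b → (5 : F) = 0) (h3 : (3 : F) ≠ 0) (i : ℤ) :
    IsAxis (monsterLaw (2 : F) (1 / 2)) ((modelIdeal F n b h2 hb hb5).toQuot (a F i)) ∧
      IsPrimitiveAxis F ((modelIdeal F n b h2 hb hb5).toQuot (a F i)) := by
  have key := isAxis_monster_of_generators (α := (2 : F)) (β := 1 / 2)
    (a := (modelIdeal F n b h2 hb hb5).toQuot (a F i)) two_ne_one h2 (half_ne_one h2)
    (one_div_ne_zero h2) (half_ne_two h2 h3) (fromModel h2 hn hb hb5 '' gen0 F n b i)
    (fromModel h2 hn hb hb5 '' gen2 F n b i) (fromModel h2 hn hb hb5 '' genHalf F n b i)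
    ?_ ?_ ?_ ?_ ?_ ?_ ?_ ?_ ?_ ?_ ?_
  · refine ⟨key.1, fun h => ?_, key.2⟩
    rw [← fromModel_toModel h2 hn hb hb5, LinearEquiv.map_eq_zero_iff] at h
    have := toModel_a_apply_C (F := F) (n := n) (b := b) i
    rw [h] at this
    simp at this
  · exact (isCoverImage_cover h2).toQuot.A_idem h2 i
  · rintro _ ⟨g, hg, rfl⟩
    rw [← fromModel_toModel h2 hn hb hb5, ← fromModel_mul]
    rcases hg with ⟨j, rfl⟩ | ⟨j, rfl⟩
    · rw [modelMul_AU h2 hb, map_zero]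
    · rw [modelMul_AZ h2 hb, map_zero]
  · rintro _ ⟨g, ⟨j, rfl⟩, rfl⟩
    rw [← fromModel_toModel h2 hn hb hb5, ← fromModel_mul, modelMul_AV h2 hb, map_smul]
  · rintro _ ⟨g, hg, rfl⟩
    rw [← fromModel_toModel h2 hn hb hb5, ← fromModel_mul]
    rcases hg with ⟨j, rfl⟩ | ⟨j, rfl⟩
    · rw [modelMul_AM h2 hb, map_smul]
    · rw [modelMul_AQ h2 hb hb5, map_smul]
  · rw [← fromModel_toModel h2 hn hb hb5, ← Set.image_singleton, ← Set.image_union,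
      ← Set.image_union, ← Set.image_union]
    exact span_fromModel h2 hn hb hb5 (span_gen h2 i)
  · rintro _ ⟨g, hg, rfl⟩ _ ⟨h, hh, rfl⟩
    rw [← fromModel_mul]
    exact fromModel_mem_span _ _ _ _ (mul_gen0_gen0 h2 hb i g hg h hh)
  · rintro _ ⟨g, hg, rfl⟩ _ ⟨h, hh, rfl⟩
    rw [← fromModel_mul]
    exact fromModel_mem_span _ _ _ _ (mul_gen0_gen2 h2 hb hb5 i g hg h hh)
  · rintro _ ⟨g, hg, rfl⟩ _ ⟨h, hh, rfl⟩
    rw [← fromModel_mul]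
    exact fromModel_mem_span _ _ _ _ (mul_gen0_genHalf hb i g hg h hh)
  · rintro _ ⟨g, hg, rfl⟩ _ ⟨h, hh, rfl⟩
    rw [← fromModel_mul]
    exact Submodule.span_mono Set.subset_union_right
      (fromModel_mem_span _ _ _ _ (mul_gen2_gen2 h2 hb i g hg h hh))
  · rintro _ ⟨g, hg, rfl⟩ _ ⟨h, hh, rfl⟩
    rw [← fromModel_mul]
    exact fromModel_mem_span _ _ _ _ (mul_gen2_genHalf hb i g hg h hh)
  · rintro _ ⟨g, hg, rfl⟩ _ ⟨h, hh, rfl⟩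
    rw [← fromModel_mul, Set.union_assoc, ← Set.image_union]
    exact Submodule.span_mono Set.subset_union_right
      (fromModel_mem_span _ _ _ _ (mul_genHalf_genHalf h2 hb i g hg h hh))

theorem isAxis_fromModel_C (h2 : (2 : F) ≠ 0) (hn : Odd n) (hb : b → 3 ∣ n)
    (hb5 : b → (5 : F) = 0) : IsAxis (jordanLaw (2 : F)) (fromModel h2 hn hb hb5 (modelC F n b)) ∧
    IsPrimitiveAxis F (fromModel h2 hn hb hb5 (modelC F n b)) := by
  let G0 : Set (Model F n b) := Set.range (modelW F n b)
    ∪ Set.range fun x : ZMod 3 × ℤ => modelQ F n b x.1 x.2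
  let G2 : Set (Model F n b) := Set.range (modelD F n b)
  have mW : ∀ j, modelW F n b j ∈ Submodule.span F G0 := fun j => Submodule.subset_span (.inl ⟨j, rfl⟩)
  have mQ : ∀ r j, modelQ F n b r j ∈ Submodule.span F G0 := fun r j =>
    Submodule.subset_span (.inr ⟨(r, j), rfl⟩)
  have mD : ∀ i, modelD F n b i ∈ Submodule.span F G2 := fun i => Submodule.subset_span ⟨i, rfl⟩
  have WQ : ∀ j r k, modelMul F n b (modelW F n b j) (modelQ F n b r k) ∈ Submodule.span F G0 := by
    intro j r k
    by_cases hk : (3 : ℤ) ∣ k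
    · rw [modelMul_WQ hb _ _ hk]
      exact Submodule.smul_mem _ _ (add_mem (mQ _ _) (mQ _ _))
    · rw [modelQ_eq_zero hb _ hk, map_zero]; exact zero_mem _
  have key := isAxis_jordan_of_generators (η := (2 : F))
    (a := fromModel h2 hn hb hb5 (modelC F n b)) two_ne_one h2 (fromModel h2 hn hb hb5 '' G0)
    (fromModel h2 hn hb hb5 '' G2) ?_ ?_ ?_ ?_ ?_ ?_ ?_
  · refine ⟨key.1, fun h => ?_, key.2⟩
    rw [LinearEquiv.map_eq_zero_iff, modelC] at h
    simp at h
  · rw [← fromModel_mul, modelMul_CC]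
  · rintro _ ⟨g, hg, rfl⟩
    rw [← fromModel_mul]
    rcases hg with ⟨j, rfl⟩ | ⟨j, rfl⟩
    · rw [modelMul_CW, map_zero]
    · rw [modelMul_CQ, map_zero]
  · rintro _ ⟨g, ⟨j, rfl⟩, rfl⟩
    rw [← fromModel_mul, modelMul_CD, map_smul]
  · rw [← Set.image_singleton, ← Set.image_union, ← Set.image_union]
    refine span_fromModel h2 hn hb hb5 (eq_top_of_mem_model ?_ ?_ ?_ ?_)
    · exact Submodule.subset_span (.inl (.inl rfl))
    · exact fun i => Submodule.span_mono Set.subset_union_right (mD i)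
    · exact fun j => Submodule.span_mono
        (Set.subset_union_right.trans Set.subset_union_left) (mW j)
    · exact fun r j => Submodule.span_mono
        (Set.subset_union_right.trans Set.subset_union_left) (mQ r j)
  · rintro _ ⟨g, hg, rfl⟩ _ ⟨h, hh, rfl⟩
    rw [← fromModel_mul]
    refine fromModel_mem_span _ _ _ _ ?_
    rcases hg with ⟨j, rfl⟩ | ⟨⟨r, j⟩, rfl⟩ <;> rcases hh with ⟨k, rfl⟩ | ⟨⟨t, k⟩, rfl⟩
    · rw [modelMul_WW]
      exact Submodule.smul_mem _ _ (add_mem (mW _) (mW _))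
    · exact WQ _ _ _
    · rw [modelMul_comm hb]; exact WQ _ _ _
    · dsimp only
      by_cases hj : (3 : ℤ) ∣ j
      · by_cases hk : (3 : ℤ) ∣ k
        · rw [modelMul_QQ hb _ _ hj hk]
          exact Submodule.smul_mem _ _ (add_mem (sub_mem (mQ _ _) (mQ _ _))
            (sub_mem (mQ _ _) (mQ _ _)))
        · rw [modelQ_eq_zero hb _ hk, map_zero]; exact zero_mem _
      · rw [modelQ_eq_zero hb _ hj, map_zero, LinearMap.zero_apply]; exact zero_mem _
  · rintro _ ⟨g, hg, rfl⟩ _ ⟨h, ⟨i, rfl⟩, rfl⟩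
    rw [← fromModel_mul, modelMul_comm hb]
    refine fromModel_mem_span _ _ _ _ ?_
    rcases hg with ⟨j, rfl⟩ | ⟨⟨r, j⟩, rfl⟩
    · rw [modelMul_DW]
      exact Submodule.smul_mem _ _ (add_mem (mD _) (mD _))
    · rw [modelMul_DQ]; exact zero_mem _
  · rintro _ ⟨g, ⟨i, rfl⟩, rfl⟩ _ ⟨h, ⟨k, rfl⟩, rfl⟩
    rw [← fromModel_mul, modelMul_DD hb]
    exact Submodule.span_mono Set.subset_union_right (fromModel_mem_span _ _ _ _
      (Submodule.smul_mem _ _ (add_mem (mW _) (sub_mem (mQ _ _) (mQ _ _)))))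

theorem modelZ_intCast_add (hb : b → 3 ∣ n) (i m j : ℤ) :
    modelZ F n b ((i + n * m : ℤ) : ZMod 3) j = modelZ F n b i j := by
  by_cases h : b
  · have h0 : ((n : ℤ) : ZMod 3) = 0 := by
      have := (ZMod.natCast_eq_zero_iff n 3).2 (hb h)
      exact_mod_cast this
    push_cast at h0 ⊢
    rw [h0, zero_mul, add_zero]
  · simp only [modelZ, modelQ_eq_zero_of_not h]

theorem toModel_a_add (hb : b → 3 ∣ n) (i m : ℤ) : toModel F n b (a F (i + n * m))
    = (sgn F (i + n * m) / 2) • modelD F n b i + modelC F n b - (2 : F) • modelW F n b 0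
      - (2 : F) • modelZ F n b i 0 := by
  rw [toModel_a, modelD_add, modelZ_intCast_add hb]

/-- The position of the d-coordinate records k modulo n and its sign records the parity of k; as n
is odd, together they give k modulo 2n. -/
theorem toModel_a_eq_iff (h2 : (2 : F) ≠ 0) (hn : Odd n) (hb : b → 3 ∣ n) (k l : ℤ) :
    toModel F n b (a F k) = toModel F n b (a F l) ↔ ((2 * n : ℕ) : ℤ) ∣ k - l := by
  constructor
  · intro h
    have h1 := DFunLike.congr_fun h (.inr (.inl (k : ZMod n)))
    rw [toModel_a_apply_D, toModel_a_apply_D, if_pos rfl] at h1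
    have hk : sgn F k ≠ 0 := fun e => by
      have := sgn_mul_self (F := F) k
      rw [e, zero_mul] at this
      exact zero_ne_one this
    have hlk : (l : ZMod n) = k := by
      by_contra hne
      rw [if_neg hne, div_eq_zero_iff] at h1
      exact h1.elim hk h2
    rw [if_pos hlk, div_left_inj' h2] at h1
    have d1 : (n : ℤ) ∣ k - l := (ZMod.intCast_eq_intCast_iff_dvd_sub l k n).1 hlk
    have d2 : Even (k - l) := by
      by_contra hodd
      rw [Int.not_even_iff_odd] at hodd
      have := sgn_of_odd (F := F) hodd
      rw [sgn_sub, ← h1, sgn_mul_self] at this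
      exact h2 (by linear_combination this)
    push_cast
    exact IsCoprime.mul_dvd (by
      rw [Int.isCoprime_iff_gcd_eq_one]
      exact (Nat.coprime_two_left.2 hn)) d2.two_dvd d1
  · rintro ⟨m, hm⟩
    have : k = l + n * (2 * m) := by push_cast at hm; linear_combination hm
    have he : sgn F (l + n * (2 * m)) = sgn F l := by
      rw [sgn_add, sgn_of_even (i := n * (2 * m)) ((even_two_mul m).mul_left _), mul_one]
    rw [this, toModel_a_add hb, he, toModel_a]

theorem toQuot_a_eq_iff (h2 : (2 : F) ≠ 0) (hn : Odd n) (hb : b → 3 ∣ n)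
    (hb5 : b → (5 : F) = 0) (k l : ℤ) : (modelIdeal F n b h2 hb hb5).toQuot (a F k)
    = (modelIdeal F n b h2 hb hb5).toQuot (a F l) ↔ ((2 * n : ℕ) : ℤ) ∣ k - l := by
  rw [← fromModel_toModel h2 hn hb hb5, ← fromModel_toModel h2 hn hb hb5,
    (fromModel h2 hn hb hb5).injective.eq_iff, toModel_a_eq_iff h2 hn hb]

theorem span_toQuot (K : AlgIdeal F (Cover F)) :
    Submodule.span F (Set.range (fun i : ℤ => K.toQuot (a F i))
      ∪ Set.range (fun j : ℤ => K.toQuot (s F j.natAbs))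
      ∪ Set.range fun x : ZMod 3 × ℤ => K.toQuot (p F x.1 x.2.natAbs)) = ⊤ := by
  set N := Submodule.span F (Set.range (fun i : ℤ => K.toQuot (a F i))
      ∪ Set.range (fun j : ℤ => K.toQuot (s F j.natAbs))
      ∪ Set.range fun x : ZMod 3 × ℤ => K.toQuot (p F x.1 x.2.natAbs)) with hN
  have : N.comap K.toQuot = ⊤ := by
    rw [eq_top_iff, ← (basis F).span_eq, Submodule.span_le]
    rintro _ ⟨x | j | ⟨r, k⟩, rfl⟩
    · exact Submodule.subset_span (.inl (.inl ⟨x, rfl⟩))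
    · exact Submodule.subset_span (.inl (.inr ⟨j, by
        dsimp only
        rw [Int.natAbs_natCast, s_eq_basis j.2]⟩))
    · exact Submodule.subset_span (.inr ⟨(r, k), by
        dsimp only
        rw [Int.natAbs_natCast, p_eq_basis r.2 k.2]⟩)
  rw [eq_top_iff]
  intro x _
  obtain ⟨x, rfl⟩ := K.toQuot_surjective x
  have hx : x ∈ N.comap K.toQuot := this ▸ Submodule.mem_top
  exact hx

theorem hasAxet_modelIdeal (h2 : (2 : F) ≠ 0) (hn : Odd n) (hb : b → 3 ∣ n)
    (hb5 : b → (5 : F) = 0) (h3 : (3 : F) ≠ 0) :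
    HasAxet (2 : F) (1 / 2) ((modelIdeal F n b h2 hb hb5).toQuot (a F 0))
      ((modelIdeal F n b h2 hb hb5).toQuot (a F 1)) (2 * n) := by
  set K := modelIdeal F n b h2 hb hb5 with hK
  have hI := (isCoverImage_cover h2).toQuot (K := K)
  have hτ : ∀ i, ∃ t : K.Quot ≃ₗ[F] K.Quot, IsTau (2 : F) (1 / 2) (K.toQuot (a F i)) t := fun i =>
    (isAxis_toQuot_a h2 hn hb hb5 h3 i).1.exists_isTau (half_ne_one h2) (one_div_ne_zero h2)
      (half_ne_two h2 h3)
  have hadj := hI.adjoin_eq_top h2 h3 (span_toQuot K)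
  have hX := hI.axet₂_eq h2 (hτ 0) (hτ 1)
  refine ⟨hadj, ⟨?_, ?_⟩, ?_⟩
  · rw [hX, eq_top_iff, ← hadj]
    refine NonUnitalAlgebra.adjoin_mono ?_
    rintro x (rfl | rfl)
    exacts [⟨0, rfl⟩, ⟨1, rfl⟩]
  · rw [hX]
    rintro x ⟨i, rfl⟩
    exact isAxis_toQuot_a h2 hn hb hb5 h3 i
  · rw [hX]
    let f : ZMod (2 * n) → Set.range fun i : ℤ => K.toQuot (a F i) := fun i =>
      ⟨K.toQuot (a F (i.val : ℤ)), ⟨_, rfl⟩⟩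
    have hf : ∀ k : ℤ, (f k : K.Quot) = K.toQuot (a F k) := fun k => by
      refine (toQuot_a_eq_iff h2 hn hb hb5 _ _).2 ?_
      rw [ZMod.val_intCast]
      exact ⟨-(k / (2 * n : ℕ)), by rw [Int.emod_def]; ring⟩
    have hbij : Function.Bijective f := by
      constructor
      · intro i j hij
        obtain ⟨i, rfl⟩ := ZMod.intCast_surjective i
        obtain ⟨j, rfl⟩ := ZMod.intCast_surjective j
        have h' := congrArg Subtype.val hij
        rw [hf, hf, toQuot_a_eq_iff h2 hn] at h'
        exact ((ZMod.intCast_eq_intCast_iff_dvd_sub _ _ _).2 h').symm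
      · rintro ⟨_, i, rfl⟩
        exact ⟨i, Subtype.ext (hf i)⟩
    refine ⟨Equiv.ofBijective f hbij, fun i => ?_⟩
    obtain ⟨i, rfl⟩ := ZMod.intCast_surjective i
    obtain ⟨t, ht⟩ := hτ i
    refine ⟨t, ?_, fun j => ?_⟩
    · rw [Equiv.ofBijective_apply, hf]; exact ht
    · obtain ⟨j, rfl⟩ := ZMod.intCast_surjective j
      rw [Equiv.ofBijective_apply, Equiv.ofBijective_apply, hf, hI.tau_apply h2 ht]
      have := hf (2 * i - j)
      push_cast at this
      exact this.symm

/-- The axis is c. Negating d_k in the formula for a_k amounts to replacing k by k + n, since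
(-1)^{k+n} = -(-1)^k; and a shift by the odd number n exchanges the parity classes. -/
theorem propertyJ_modelIdeal (h2 : (2 : F) ≠ 0) (hn : Odd n) (hb : b → 3 ∣ n)
    (hb5 : b → (5 : F) = 0) (h3 : (3 : F) ≠ 0) :
    PropertyJ (2 : F) (1 / 2) ((modelIdeal F n b h2 hb hb5).toQuot (a F 0))
      ((modelIdeal F n b h2 hb hb5).toQuot (a F 1)) := by
  set K := modelIdeal F n b h2 hb hb5 with hK
  have hI := (isCoverImage_cover h2).toQuot (K := K)
  have hτ : ∀ i, ∃ t : K.Quot ≃ₗ[F] K.Quot, IsTau (2 : F) (1 / 2) (K.toQuot (a F i)) t := fun i =>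
    (isAxis_toQuot_a h2 hn hb hb5 h3 i).1.exists_isTau (half_ne_one h2) (one_div_ne_zero h2)
      (half_ne_two h2 h3)
  have hX := hI.axet₂_eq h2 (hτ 0) (hτ 1)
  obtain ⟨hc, hcp⟩ := isAxis_fromModel_C h2 hn hb hb5
  obtain ⟨σ, hσ⟩ := hc.exists_isSigma two_ne_one h2
  have hσa : ∀ k, σ (K.toQuot (a F k)) = K.toQuot (a F (k + n)) := by
    intro k
    have s0 : ∀ x, modelMul F n b (modelC F n b) x = 0 →
        σ (fromModel h2 hn hb hb5 x) = fromModel h2 hn hb hb5 x := fun x hx =>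
      hσ.2.1 0 (by simp) _ (mem_axEig.2 (by rw [← fromModel_mul, hx, map_zero, zero_smul]))
    have s1 : σ (fromModel h2 hn hb hb5 (modelC F n b)) = fromModel h2 hn hb hb5 (modelC F n b) :=
      hσ.2.1 1 (by simp) _ (mem_axEig.2 (by rw [← fromModel_mul, modelMul_CC, one_smul]))
    have s2 : σ (fromModel h2 hn hb hb5 (modelD F n b k)) = -fromModel h2 hn hb hb5 (modelD F n b k) :=
      hσ.2.2 2 rfl _ (mem_axEig.2 (by rw [← fromModel_mul, modelMul_CD, map_smul]))
    have e := toModel_a_add (F := F) hb k 1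
    rw [mul_one, sgn_add, sgn_of_odd (i := n) (by exact_mod_cast hn)] at e
    rw [← fromModel_toModel h2 hn hb hb5, ← fromModel_toModel h2 hn hb hb5, e, toModel_a]
    simp only [map_sub, map_add, map_smul, s1, s2, s0 _ (modelMul_CW 0), s0 _ (modelMul_CZ _ 0)]
    module
  have hX' : (Set.range fun i : ℤ => K.toQuot (a F i)) ⊆ Set.range fun i : ℤ => K.toQuot (a F i) :=
    subset_rfl
  refine ⟨fromModel h2 hn hb hb5 (modelC F n b), ?_, hc, hcp, ?_, σ, hσ, ?_, ?_⟩
  · rw [hX]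
    rintro ⟨k, hk⟩
    dsimp only at hk
    rw [← fromModel_toModel h2 hn hb hb5, (fromModel h2 hn hb hb5).injective.eq_iff] at hk
    have h1 := DFunLike.congr_fun hk (.inr (.inl (k : ZMod n)))
    rw [toModel_a_apply_D, if_pos rfl, modelC, Finsupp.single_eq_of_ne (by simp),
      div_eq_zero_iff] at h1
    have := sgn_mul_self (F := F) k
    rw [h1.resolve_right h2, zero_mul] at this
    exact zero_ne_one this
  · rw [hX]
    intro g hg
    induction hg using Subgroup.closure_induction with
    | mem t ht =>
      obtain ⟨_, ⟨i, rfl⟩, ht⟩ := ht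
      -- This span consists of sums of eigenvectors for 1, 0 and 2, on which τ is the identity; it
      -- contains c by `modelC_mem`.
      have hfix : ∀ x ∈ Submodule.span F ({toModel F n b (a F i)} ∪ (gen0 F n b i ∪ gen2 F n b i)),
          t (fromModel h2 hn hb hb5 x) = fromModel h2 hn hb hb5 x := by
        intro x hx
        induction hx using Submodule.span_induction with
        | mem x hx =>
          have key : ∀ μ ∈ ({1, 0, 2} : Set F),
              modelMul F n b (toModel F n b (a F i)) x = μ • x →
              t (fromModel h2 hn hb hb5 x) = fromModel h2 hn hb hb5 x := fun μ hμ h =>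
            ht.2.1 μ hμ _ (mem_axEig.2 (by
              dsimp only
              rw [← fromModel_toModel h2 hn hb hb5, ← fromModel_mul, h, map_smul]))
          rcases hx with rfl | (⟨j, rfl⟩ | ⟨j, rfl⟩) | ⟨j, rfl⟩
          · refine key 1 (by simp) ?_
            rw [← toModel_mul h2 hb hb5, (isCoverImage_cover h2).A_idem h2, one_smul]
          · exact key 0 (by simp) (by rw [modelMul_AU h2 hb, zero_smul])
          · exact key 0 (by simp) (by rw [modelMul_AZ h2 hb, zero_smul])
          · exact key 2 (by simp) (modelMul_AV h2 hb i j)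
        | zero => rw [map_zero, map_zero]
        | add x y _ _ hx hy => rw [map_add, map_add, hx, hy]
        | smul c x _ hx => rw [map_smul, map_smul, hx]
      exact hfix _ (modelC_mem h2 i)
    | one => rfl
    | mul x y _ _ hx hy => rw [LinearEquiv.mul_apply, hy, hx]
    | inv x _ hx =>
      rw [show x⁻¹ = x.symm from rfl, LinearEquiv.symm_apply_eq, hx]
  · rw [hX, hI.miyOrbit_eq h2 hX' ⟨0, rfl⟩ ⟨1, rfl⟩ (hτ 0) (hτ 1) 0,
      hI.miyOrbit_eq h2 hX' ⟨0, rfl⟩ ⟨1, rfl⟩ (hτ 0) (hτ 1) 1]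
    obtain ⟨l, hl⟩ := hn
    ext x
    constructor
    · rintro ⟨_, ⟨m, rfl⟩, rfl⟩
      exact ⟨m + l, by rw [hσa]; congr 2; rw [hl]; push_cast; ring⟩
    · rintro ⟨m, rfl⟩
      exact ⟨_, ⟨m - l, rfl⟩, by rw [hσa]; congr 2; rw [hl]; push_cast; ring⟩
  · rw [hX, hI.miyOrbit_eq h2 hX' ⟨0, rfl⟩ ⟨1, rfl⟩ (hτ 0) (hτ 1) 0,
      hI.miyOrbit_eq h2 hX' ⟨0, rfl⟩ ⟨1, rfl⟩ (hτ 0) (hτ 1) 1]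
    obtain ⟨l, hl⟩ := hn
    ext x
    constructor
    · rintro ⟨_, ⟨m, rfl⟩, rfl⟩
      exact ⟨m + l + 1, by rw [hσa]; congr 2; rw [hl]; push_cast; ring⟩
    · rintro ⟨m, rfl⟩
      exact ⟨_, ⟨m - l - 1, rfl⟩, by rw [hσa]; congr 2; rw [hl]; push_cast; ring⟩

open Classical in
theorem finrank_modelIdeal (h2 : (2 : F) ≠ 0) (hn : Odd n) (hb : b → 3 ∣ n)
    (hb5 : b → (5 : F) = 0) : Module.finrank F (modelIdeal F n b h2 hb hb5).Quot
    = 1 + (n + (n / 2 + 1 + 2 * Fintype.card {u : Fin (n / 2 + 1) // b ∧ 3 ∣ u.val})) := by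
  rw [← (fromModel h2 hn hb hb5).finrank_eq, Module.finrank_finsupp_self]
  simp only [Fintype.card_sum, Fintype.card_prod, Fintype.card_unit, ZMod.card, Fintype.card_fin]
  congr

open Classical in
theorem card_multiples_three (N : ℕ) :
    Fintype.card {u : Fin (N + 1) // True ∧ 3 ∣ u.val} = N / 3 + 1 := by
  rw [← Fintype.card_fin (N / 3 + 1)]
  refine (Fintype.card_congr ⟨fun v => ⟨⟨3 * v.val, by omega⟩, trivial, dvd_mul_right _ _⟩,
    fun u => ⟨u.1.val / 3, by omega⟩, fun v => ?_, fun u => ?_⟩).symm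
  · ext; simp
  · ext
    have := u.2.2
    simp only
    omega

end ModelQuotient

end Highwater

namespace Highwater
-- Consequences of the axet X(2n) and of property (J) in an arbitrary quotient.
namespace IsCoverImage

variable {F Q : Type*} [Field F] [NonUnitalNonAssocCommRing Q] [Module F Q]
  [IsScalarTower F Q Q] [SMulCommClass F Q Q] {A S : ℤ → Q} {P : ZMod 3 → ℤ → Q}

theorem exists_isTau_of_hasAxet (h2 : (2 : F) ≠ 0) (h3 : (3 : F) ≠ 0) (h : IsCoverImage F A S P)
    {N : ℕ} (hax : HasAxet (2 : F) (1 / 2) (A 0) (A 1) N) :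
    axet₂ (2 : F) (1 / 2) (A 0) (A 1) = Set.range A ∧
      ∀ i, IsAxis (monsterLaw (2 : F) (1 / 2)) (A i) ∧
      IsPrimitiveAxis F (A i) ∧ ∃ t : Q ≃ₗ[F] Q, IsTau (2 : F) (1 / 2) (A i) t := by
  have hτ : ∀ x ∈ axet₂ (2 : F) (1 / 2) (A 0) (A 1), IsAxis (monsterLaw (2 : F) (1 / 2)) x ∧
      IsPrimitiveAxis F x ∧ ∃ t : Q ≃ₗ[F] Q, IsTau (2 : F) (1 / 2) x t := fun x hx =>
    ⟨(hax.2.1.2 x hx).1, (hax.2.1.2 x hx).2, (hax.2.1.2 x hx).1.exists_isTau (half_ne_one h2)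
      (one_div_ne_zero h2) (half_ne_two h2 h3)⟩
  have hX := h.axet₂_eq h2 (hτ _ (.inl ⟨1, one_mem _, rfl⟩)).2.2
    (hτ _ (.inr ⟨1, one_mem _, rfl⟩)).2.2
  exact ⟨hX, fun i => hτ _ (hX ▸ ⟨i, rfl⟩)⟩

/-- In a quotient with axet `X(N)`, the axes `a_k` are exactly `N`-periodic. -/
theorem A_eq_iff_of_hasAxet (h2 : (2 : F) ≠ 0) (h3 : (3 : F) ≠ 0) (h : IsCoverImage F A S P)
    {N : ℕ} (hax : HasAxet (2 : F) (1 / 2) (A 0) (A 1) N) (k l : ℤ) :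
    A k = A l ↔ (N : ℤ) ∣ k - l := by
  obtain ⟨hX, -⟩ := h.exists_isTau_of_hasAxet h2 h3 hax
  obtain ⟨-, -, e, he⟩ := hax
  have hmem : ∀ k, A k ∈ axet₂ (2 : F) (1 / 2) (A 0) (A 1) := fun k => hX ▸ ⟨k, rfl⟩
  let idx : ℤ → ZMod N := fun k => e.symm ⟨A k, hmem k⟩
  have hidx : ∀ k, (e (idx k) : Q) = A k := fun k => by simp [idx]
  have hinj : ∀ x y : ZMod N, (e x : Q) = e y → x = y := fun x y hxy =>
    e.injective (Subtype.ext hxy)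
  -- The reflection of the axet and the formula of `tau_apply` describe the action of the same
  -- involution. This recursion forces `idx` to be affine.
  have hrec : ∀ k i, idx (2 * k - i) = 2 * idx k - idx i := by
    intro k i
    obtain ⟨t, ht, hte⟩ := he (idx k)
    rw [hidx] at ht
    refine hinj _ _ ?_
    rw [← hte, hidx, hidx, h.tau_apply h2 ht]
  have hlin : ∀ k : ℤ, idx k = idx 0 + k * (idx 1 - idx 0) ∧
      idx (k + 1) = idx 0 + (k + 1) * (idx 1 - idx 0) := by
    intro k
    induction k using Int.induction_on with
    | zero => simp
    | succ k ih =>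
      refine ⟨by rw [ih.2]; push_cast; rfl, ?_⟩
      rw [show (k : ℤ) + 1 + 1 = 2 * (k + 1) - k by ring, hrec, ih.1, ih.2]
      push_cast
      ring
    | pred k ih =>
      have e1 : idx (-(k : ℤ) - 1) = idx 0 + ((-(k : ℤ) - 1 : ℤ) : ZMod N) * (idx 1 - idx 0) := by
        rw [show -(k : ℤ) - 1 = 2 * -(k : ℤ) - (-(k : ℤ) + 1) by ring, hrec, ih.1, ih.2]
        push_cast
        ring
      refine ⟨e1, ?_⟩
      rw [sub_add_cancel, ih.1]
      push_cast
      ring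
  -- Every vertex is the label of some a_m, so the slope of the affine map is a unit modulo `N`.
  obtain ⟨m, hm⟩ : ∃ m : ℤ, idx m = idx 0 + 1 := by
    have hx : (e (idx 0 + 1) : Q) ∈ Set.range A := hX ▸ (e (idx 0 + 1)).2
    obtain ⟨m, hm⟩ := hx
    exact ⟨m, hinj _ _ (by rw [hidx, hm])⟩
  have hu : (m : ZMod N) * (idx 1 - idx 0) = 1 := by
    rw [(hlin m).1] at hm
    exact add_left_cancel hm
  rw [← hidx k, ← hidx l, Subtype.coe_inj, e.injective.eq_iff, (hlin k).1, (hlin l).1,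
    ← ZMod.intCast_zmod_eq_zero_iff_dvd]
  push_cast
  constructor
  · intro hkl
    linear_combination (m : ZMod N) * hkl - (k - l : ZMod N) * hu
  · intro hkl
    linear_combination (idx 1 - idx 0) * hkl

theorem three_smul_P (h : IsCoverImage F A S P) (r : ZMod 3) (j : ℤ) : (3 : F) • P r j =
    (P (r - 1 + 1) j - P (r - 1 - 1) j) - (P (r + 1 + 1) j - P (r + 1 - 1) j) := by
  have e1 : ∀ x : ZMod 3, x + 1 + 1 = x - 1 := by decide
  have e2 : ∀ x : ZMod 3, x - 1 - 1 = x + 1 := by decide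
  rw [e1, e2, sub_add_cancel, add_sub_cancel_right]
  linear_combination (norm := module) h.P_sum r j

/-- Identities between the elements `S j + Z_{i,j}` for all `i` can be separated. -/
theorem separate (h3 : (3 : F) ≠ 0) (h : IsCoverImage F A S P) {ι : Type*} (J : Finset ι)
    (c : ι → F) (f : ι → ℤ) (hJ : ∀ r : ZMod 3,
      ∑ x ∈ J, c x • (S (f x) + (P (r + 1) (f x) - P (r - 1) (f x))) = 0) :
    ∑ x ∈ J, c x • S (f x) = 0 ∧ ∀ r, ∑ x ∈ J, c x • P r (f x) = 0 := by
  have hP : ∀ r, ∑ x ∈ J, c x • P r (f x) = 0 := by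
    intro r
    have := sub_eq_zero.2 ((hJ (r - 1)).trans (hJ (r + 1)).symm)
    refine smul_right_injective Q h3 ?_
    dsimp only
    rw [smul_zero, ← this, ← Finset.sum_sub_distrib, Finset.smul_sum]
    refine Finset.sum_congr rfl fun x _ => ?_
    rw [smul_comm, h.three_smul_P]
    module
  refine ⟨?_, hP⟩
  have := hJ 0
  simp only [smul_add, smul_sub, Finset.sum_add_distrib, Finset.sum_sub_distrib, hP] at this
  simpa using this

/-- The element s_j + z_{i,j} is an expression in a_i and a_{i-j}, hence periodic in j for each
fixed i; `separate` then splits off s and p. -/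
theorem periodic_of_A (h3 : (3 : F) ≠ 0) (h : IsCoverImage F A S P) {N : ℤ}
    (hA : ∀ k, A (k + N) = A k) (j : ℤ) : S (j + N) = S j ∧ ∀ r, P r (j + N) = P r j := by
  have key : ∀ (i j : ℤ), S j + (P (i + 1) j - P (i - 1) j)
      = A i * A (i - j) - (1 / 2 : F) • (A i + A (i - j)) := fun i j => by
    rw [h.mul_AA, sub_sub_cancel]; module
  have hsep := h.separate h3 (Finset.univ : Finset (Fin 2)) ![1, -1] ![j + N, j] ?_
  · simp only [Fin.sum_univ_two, Matrix.cons_val_zero, Matrix.cons_val_one, one_smul, neg_smul,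
      ← sub_eq_add_neg, sub_eq_zero] at hsep
    exact hsep
  · intro r
    obtain ⟨i, rfl⟩ := ZMod.intCast_surjective r
    simp only [Fin.sum_univ_two, Matrix.cons_val_zero, Matrix.cons_val_one, one_smul, neg_smul]
    rw [key, key, ← hA (i - (j + N)), show i - (j + N) + N = i - j by ring, add_neg_cancel]

/-- A shift by the period moves an index divisible by 3 to one that is not, where p vanishes. -/
theorem P_eq_zero_of_not_three_dvd (h3 : (3 : F) ≠ 0) (h : IsCoverImage F A S P) {N : ℤ}
    (hA : ∀ k, A (k + N) = A k) (hN : ¬ 3 ∣ N) (r : ZMod 3) (j : ℤ) : P r j = 0 := by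
  by_cases hj : (3 : ℤ) ∣ j
  · rw [← (h.periodic_of_A h3 hA j).2 r]
    exact h.P_eq_zero r (by omega)
  · exact h.P_eq_zero r hj

/-- The vector v + σv is twice the sum of the 1- and 0-parts of v, the former being a multiple of c
by primitivity; v - σv is twice the 2-part. -/
theorem mul_add_sigma {c v : Q} (hc : IsAxis (jordanLaw (2 : F)) c) (hcp : IsPrimitiveAxis F c)
    {σ : Q ≃ₗ[F] Q} (hσ : IsSigma (2 : F) c σ) :
    (∃ μ : F, c * (v + σ v) = μ • c) ∧ c * (v - σ v) = (2 : F) • (v - σ v) := by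
  have hv : v ∈ ⨆ x ∈ (jordanLaw (2 : F)).vals, axEig c x := hc.semisimple ▸ Submodule.mem_top
  simp only [jordanLaw, iSup_insert, iSup_singleton] at hv
  obtain ⟨x, hx, u, hu, rfl⟩ := Submodule.mem_sup.1 hv
  obtain ⟨y, hy, w, hw, rfl⟩ := Submodule.mem_sup.1 hu
  have e1 := hσ.2.1 1 (by simp) x hx
  have e0 := hσ.2.1 0 (by simp) y hy
  have e2 := hσ.2.2 2 rfl w hw
  have m0 := mem_axEig.1 hy
  have m2 := mem_axEig.1 hw
  have m1 := mem_axEig.1 hx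
  rw [hcp.2, Submodule.mem_span_singleton] at hx
  obtain ⟨κ, rfl⟩ := hx
  rw [map_add, map_add, e1, e0, e2]
  constructor
  · refine ⟨2 * κ, ?_⟩
    rw [show κ • c + (y + w) + (κ • c + (y + -w)) = (2 : F) • (κ • c + y) by module, mul_smul_comm,
      mul_add, m1, m0]
    module
  · rw [show κ • c + (y + w) - (κ • c + (y + -w)) = (2 : F) • w by module, mul_smul_comm, m2]

/-- A τ-fixed vector has no 1/2-part. On the 0- and 2-parts multiplication by x satisfies T² = 2T,
and on the 1-part, a multiple of x, the defect is again a multiple of x. -/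
theorem mul_mul_add_tau (h2 : (2 : F) ≠ 0) {x v : Q} (hx : IsAxis (monsterLaw (2 : F) (1 / 2)) x)
    (hxp : IsPrimitiveAxis F x) {t : Q ≃ₗ[F] Q} (ht : IsTau (2 : F) (1 / 2) x t) (hv : t v = v) :
    ∃ μ : F, x * (x * v) = (2 : F) • (x * v) - μ • x := by
  have hv' : v ∈ ⨆ y ∈ (monsterLaw (2 : F) (1 / 2)).vals, axEig x y :=
    hx.semisimple ▸ Submodule.mem_top
  simp only [monsterLaw, iSup_insert, iSup_singleton] at hv'
  obtain ⟨v1, m1, y, hy, rfl⟩ := Submodule.mem_sup.1 hv'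
  obtain ⟨v0, m0, y', hy', rfl⟩ := Submodule.mem_sup.1 hy
  obtain ⟨v2, m2, w, hw, rfl⟩ := Submodule.mem_sup.1 hy'
  have e1 := ht.2.1 1 (by simp) v1 m1
  have e0 := ht.2.1 0 (by simp) v0 m0
  have e2 := ht.2.1 2 (by simp) v2 m2
  have eh := ht.2.2 (1 / 2) rfl w hw
  rw [map_add, map_add, map_add, e1, e0, e2, eh] at hv
  have hw0 : w = 0 := by
    have : (2 : F) • w = 0 := by
      linear_combination (norm := module) -hv
    exact (smul_eq_zero.1 this).resolve_left h2
  subst hw0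
  have n1 := mem_axEig.1 m1
  have n0 := mem_axEig.1 m0
  have n2 := mem_axEig.1 m2
  rw [hxp.2, Submodule.mem_span_singleton] at m1
  obtain ⟨κ, rfl⟩ := m1
  refine ⟨κ, ?_⟩
  simp only [add_zero, mul_add, mul_smul_comm, n0, n2, hx.idem, zero_smul, zero_add]
  module

theorem P_intCast_add (h : IsCoverImage F A S P) (n i : ℤ) (x : ZMod 3) :
    P (((i + n : ℤ) : ZMod 3) + x) n = P (i + x) n := by
  by_cases hn : (3 : ℤ) ∣ n
  · have := (ZMod.intCast_zmod_eq_zero_iff_dvd n 3).2 hn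
    push_cast
    rw [this, add_zero]
  · rw [h.P_eq_zero _ hn, h.P_eq_zero _ hn]

theorem b_mul_b (h2 : (2 : F) ≠ 0) (h : IsCoverImage F A S P) {n : ℤ} (hS : S (n + n) = 0)
    (hP : ∀ r, P r (n + n) = 0) (r : ZMod 3) :
    (S n + (P (r + 1) n - P (r - 1) n)) * (S n + (P (r + 1) n - P (r - 1) n))
      = (3 / 2 : F) • (S n + (P (r + 1) n - P (r - 1) n)) := by
  have h4 := four_ne_zero_of_two h2
  have h8 := eight_ne_zero_of_two h2
  by_cases hn : (3 : ℤ) ∣ n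
  · have e1 : ∀ x : ZMod 3, -(x + 1 + (x + 1)) = x + 1 := by decide
    have e2 : ∀ x : ZMod 3, -(x + 1 + (x - 1)) = x := by decide
    have e3 : ∀ x : ZMod 3, -(x - 1 + (x + 1)) = x := by decide
    have e4 : ∀ x : ZMod 3, -(x - 1 + (x - 1)) = x - 1 := by decide
    have e5 : ∀ x : ZMod 3, x + 1 + 1 = x - 1 := by decide
    have e6 : ∀ x : ZMod 3, x - 1 - 1 = x + 1 := by decide
    have ps := h.P_sum r n
    simp only [add_mul, mul_add, sub_mul, mul_sub, h.mul_SS, h.mul_SP _ _ hn,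
      mul_comm (P _ _) (S _), h.mul_PP _ _ hn hn, sub_self, h.S_zero, h.P_zero, hS, hP, e1, e2, e3,
      e4, e5, e6, add_sub_cancel_right, sub_add_cancel]
    match_scalars <;> field_simp <;> ring
  · rw [h.P_eq_zero _ hn, h.P_eq_zero _ hn, sub_zero, add_zero, h.mul_SS, sub_self, h.S_zero, hS]
    match_scalars; field_simp; ring

/-- The axis `c` of property (J) is determined by the axes `a_i`. -/
theorem exists_axis_of_propertyJ (h2 : (2 : F) ≠ 0) (h3 : (3 : F) ≠ 0) (h : IsCoverImage F A S P)
    {n : ℕ} (hn : Odd n) (hax : HasAxet (2 : F) (1 / 2) (A 0) (A 1) (2 * n))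
    (hJ : PropertyJ (2 : F) (1 / 2) (A 0) (A 1)) :
    ∃ c : Q, (∀ i, c * A i = c + A i - A (i + n)) ∧
      ∀ i : ℤ, S n + (P (i + 1) n - P (i - 1) n) = -c + (1 / 2 : F) • (A i + A (i + n)) := by
  have h4 := four_ne_zero_of_two h2
  have h8 := eight_ne_zero_of_two h2
  obtain ⟨hX, haxis⟩ := h.exists_isTau_of_hasAxet h2 h3 hax
  have hA := h.A_eq_iff_of_hasAxet h2 h3 hax
  have hper : ∀ k, A (k + (2 * n : ℕ)) = A k := fun k => (hA _ _).2 (by simp)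
  obtain ⟨c, -, hc, hcp, hfix, σ, hσ, hσ0, hσ1⟩ := hJ
  rw [hX] at hfix
  rw [hX, h.miyOrbit_eq h2 subset_rfl ⟨0, rfl⟩ ⟨1, rfl⟩ (haxis 0).2.2 (haxis 1).2.2 0,
    h.miyOrbit_eq h2 subset_rfl ⟨0, rfl⟩ ⟨1, rfl⟩ (haxis 0).2.2 (haxis 1).2.2 1] at hσ0 hσ1
  have hτc : ∀ (i : ℤ) (t : Q ≃ₗ[F] Q), IsTau (2 : F) (1 / 2) (A i) t → t c = c := fun i t ht =>
    hfix t (Subgroup.subset_closure ⟨A i, ⟨i, rfl⟩, ht⟩)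
  -- As τ fixes c, it preserves the eigenspaces of c, and therefore commutes with σ_c.
  have hcomm : ∀ (i : ℤ) (t : Q ≃ₗ[F] Q), IsTau (2 : F) (1 / 2) (A i) t →
      ∀ v, t (σ v) = σ (t v) := by
    intro i t ht v
    have htc := hτc i t ht
    have hteig : ∀ (x : F) (v : Q), v ∈ axEig c x → t v ∈ axEig c x := fun x v hv => by
      rw [mem_axEig] at hv ⊢
      conv_lhs => rw [← htc]
      rw [← ht.1, hv, map_smul]
    have hv : v ∈ ⨆ x ∈ (jordanLaw (2 : F)).vals, axEig c x := hc.semisimple ▸ Submodule.mem_top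
    simp only [jordanLaw, iSup_insert, iSup_singleton] at hv
    obtain ⟨x, hx, u, hu, rfl⟩ := Submodule.mem_sup.1 hv
    obtain ⟨y, hy, w, hw, rfl⟩ := Submodule.mem_sup.1 hu
    simp only [map_add]
    rw [hσ.2.1 1 (by simp) x hx, hσ.2.1 0 (by simp) y hy, hσ.2.2 2 rfl w hw,
      hσ.2.1 1 (by simp) _ (hteig _ _ hx), hσ.2.1 0 (by simp) _ (hteig _ _ hy),
      hσ.2.2 2 rfl _ (hteig _ _ hw), map_neg]
  have hσA : ∀ i, σ (A i) = A (i + n) := by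
    intro i
    obtain ⟨m, hm, hmi⟩ : ∃ m, σ (A i) = A m ∧ Odd (m - i) := by
      rcases Int.even_or_odd' i with ⟨l, rfl | rfl⟩
      · have : σ (A (2 * l)) ∈ {x | ∃ m : ℤ, A (1 + 2 * m) = x} := by
          rw [← hσ0]
          exact ⟨_, ⟨l, rfl⟩, by rw [zero_add]⟩
        obtain ⟨m, hm⟩ := this
        exact ⟨_, hm.symm, ⟨m - l, by ring⟩⟩
      · have : σ (A (2 * l + 1)) ∈ {x | ∃ m : ℤ, A (0 + 2 * m) = x} := by
          rw [← hσ1]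
          exact ⟨_, ⟨l, rfl⟩, by rw [add_comm]⟩
        obtain ⟨m, hm⟩ := this
        exact ⟨_, hm.symm, ⟨m - l - 1, by ring⟩⟩
    obtain ⟨t, ht⟩ := (haxis i).2.2
    -- Thus τ_{a_i} fixes a_m = σ(a_i), so 2m ≡ 2i modulo 2n and n ∣ m - i. Since m - i is odd, m ≡
    -- i + n modulo 2n.
    have e1 := hcomm i t ht (A i)
    rw [h.tau_apply h2 ht, show 2 * i - i = i by ring, hm, h.tau_apply h2 ht, hA] at e1
    rw [hm, hA]
    obtain ⟨l, hl⟩ := e1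
    obtain ⟨q, hq⟩ := hmi
    obtain ⟨u, hu⟩ := hn
    have hl' : (n : ℤ) * l = i - m := by
      have : (2 : ℤ) * (n * l) = 2 * (i - m) := by push_cast at hl; linear_combination -hl
      exact mul_left_cancel₀ two_ne_zero this
    have hlodd : Odd l := by
      by_contra hne
      rw [Int.not_odd_iff_even] at hne
      have : Even (i - m) := hl' ▸ hne.mul_left _
      rw [show i - m = -(m - i) by ring, even_neg, hq] at this
      exact Int.not_even_two_mul_add_one q this
    obtain ⟨v, hv⟩ := hlodd
    refine ⟨-v - 1, ?_⟩
    push_cast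
    rw [hv] at hl'
    linear_combination hl'
  have hσc : σ c = c := hσ.2.1 1 (by simp) c (mem_axEig.2 (by rw [hc.idem, one_smul]))
  have hnn : ∀ i, A (i + n + n) = A i := fun i => by
    rw [← hper i]; congr 1; push_cast; ring
  have hmn : ∀ i, A (i - n) = A (i + n) := fun i => by
    rw [← hnn (i - n)]; congr 1; ring
  obtain ⟨hS2, hP2⟩ := h.periodic_of_A h3 hper 0
  rw [zero_add, h.S_zero, show ((2 * n : ℕ) : ℤ) = n + n by push_cast; ring] at hS2
  have hP2' : ∀ r, P r ((n : ℤ) + n) = 0 := fun r => by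
    have := hP2 r
    rwa [zero_add, h.P_zero, show ((2 * n : ℕ) : ℤ) = n + n by push_cast; ring] at this
  have hDne : ∀ i, A i - A (i + n) ≠ 0 := fun i e => by
    rw [sub_eq_zero, hA] at e
    obtain ⟨m, hm⟩ := e
    obtain ⟨u, hu⟩ := hn
    have hn0 : (n : ℤ) ≠ 0 := by omega
    have : (n : ℤ) * (2 * m) = n * (-1) := by push_cast at hm; linear_combination -hm
    have := mul_left_cancel₀ hn0 this
    omega
  have key : ∀ i : ℤ, c * A i = c + A i - A (i + n) ∧
      S n + (P (i + 1) n - P (i - 1) n) = -c + (1 / 2 : F) • (A i + A (i + n)) := by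
    intro i
    set x := A i with hx
    set y := A (i + n) with hy
    have hD : x - y ≠ 0 := hDne i
    set β := S n + (P ((i : ZMod 3) + 1) n - P (i - 1) n) with hβ
    have hxy : x * y = (1 / 2 : F) • (x + y) + β := by
      rw [hx, hy, h.mul_AA, show i - (i + (n : ℤ)) = -n by ring, h.S_neg, h.P_neg, h.P_neg, add_assoc]
    have hxβ : x * β = -(3 / 4 : F) • x + (3 / 4 : F) • y + (3 / 2 : F) • β := by
      rw [hx, hβ, h.A_mul_b, hmn]
      match_scalars <;> field_simp <;> ring
    have hyβ : y * β = -(3 / 4 : F) • y + (3 / 4 : F) • x + (3 / 2 : F) • β := by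
      have e := h.A_mul_b (i + n) n
      rw [h.P_intCast_add, sub_eq_add_neg ((i + n : ℤ) : ZMod 3), h.P_intCast_add,
        ← sub_eq_add_neg, add_sub_cancel_right, hnn, ← hβ, ← hx, ← hy] at e
      rw [e]
      match_scalars <;> field_simp <;> ring
    have hββ : β * β = (3 / 2 : F) • β := h.b_mul_b h2 hS2 hP2' _
    have hxx : x * x = x := h.A_idem h2 i
    have hyy : y * y = y := h.A_idem h2 _
    have hσx : σ x = y := hσA i
    have hσy : σ y = x := (hσA _).trans (hnn i)
    have hσβ : σ β = β := by
      have e : β = x * y - (1 / 2 : F) • (x + y) := by rw [hxy]; abel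
      rw [e, map_sub, hσ.1, map_smul, map_add, hσx, hσy, mul_comm y x, add_comm y x]
    obtain ⟨⟨μ', hμ'⟩, hcD⟩ := mul_add_sigma (v := x) hc hcp hσ
    rw [hσx] at hμ' hcD
    obtain ⟨lam, hlam⟩ : ∃ lam : F, μ' = 2 * lam := ⟨μ' / 2, by field_simp⟩
    have hcx : c * x = lam • c + x - y := by
      refine smul_right_injective Q h2 ?_
      dsimp only
      have e : (2 : F) • (c * x) = c * (x + y) + c * (x - y) := by
        rw [← mul_add, show x + y + (x - y) = (2 : F) • x by module, mul_smul_comm]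
      rw [e, hμ', hcD, hlam]
      module
    have hcy : c * y = lam • c + y - x := by
      have e : c * y = c * x - c * (x - y) := by rw [← mul_sub, sub_sub_cancel]
      rw [e, hcD, hcx]
      module
    obtain ⟨t, ht⟩ := (haxis i).2.2
    -- Expanding x(xc) with the known products turns this into an expression for β in terms of c, x
    -- and y.
    obtain ⟨μ, hμ⟩ := mul_mul_add_tau h2 (haxis i).1 (haxis i).2.1 ht (hτc i t ht)
    rw [← hx, mul_comm x c, hcx, mul_sub, mul_add, mul_smul_comm, mul_comm x c, hcx, hxx, hxy] at hμ
    have hβ1 : β = (lam * (lam - 2)) • c + (lam + μ - 3 / 2) • x + (3 / 2 - lam) • y := by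
      linear_combination (norm := (match_scalars <;> field_simp <;> ring)) -hμ
    -- The involution σ fixes β and c and exchanges x and y, so x and y have equal coefficients in
    -- β, because x ≠ y.
    have hμ3 : μ = 3 - 2 * lam := by
      have e := hσβ
      rw [hβ1, map_add, map_add, map_smul, map_smul, map_smul, hσc, hσx, hσy] at e
      have e' : (2 * lam + μ - 3) • (x - y) = 0 := by
        linear_combination (norm := (match_scalars <;> field_simp <;> ring)) -e
      have := (smul_eq_zero.1 e').resolve_right hD
      linear_combination this
    have hβ2 : β = (lam * (lam - 2)) • c + (3 / 2 - lam) • (x + y) := by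
      rw [hβ1, hμ3]
      match_scalars <;> field_simp <;> ring
    -- The product β(x - y) is -(3/2)(x - y) by the table and (2λ(λ - 2) + 3/2 - λ)(x - y) by the
    -- expression just found.
    have hl : (lam - 1) * (2 * lam - 3) = 0 := by
      have e1 : β * (x - y) = -(3 / 2 : F) • (x - y) := by
        rw [mul_sub, mul_comm, hxβ, mul_comm, hyβ]
        match_scalars <;> field_simp <;> ring
      have e2 : (x + y) * (x - y) = x - y := by
        rw [add_mul, mul_sub, mul_sub, hxx, hyy, mul_comm y x]
        abel
      rw [hβ2, add_mul, smul_mul_assoc, smul_mul_assoc, hcD, e2] at e1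
      have e3 : ((lam - 1) * (2 * lam - 3)) • (x - y) = 0 := by
        linear_combination (norm := (match_scalars <;> field_simp <;> ring)) e1
      exact (smul_eq_zero.1 e3).resolve_right hD
    rcases mul_eq_zero.1 hl with hl | hl
    · have : lam = 1 := by linear_combination hl
      subst this
      refine ⟨by rw [hcx, one_smul], ?_⟩
      rw [hβ2]
      match_scalars <;> field_simp <;> ring
    -- For λ = 3/2 one gets β = -(3/4)c, and β² = (3/2)β would give 27c = 0.
    · exfalso
      have hl' : lam = 3 / 2 := by field_simp; linear_combination hl
      have h16 : (16 : F) ≠ 0 := by rw [show (16 : F) = 4 * 4 by norm_num]; exact mul_ne_zero h4 h4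
      have e1 : β = -(3 / 4 : F) • c := by
        rw [hβ2, hl']
        match_scalars <;> field_simp <;> ring
      rw [e1, smul_mul_assoc, mul_smul_comm, hc.idem] at hββ
      have e2 : ((3 : F) * 3 * 3) • c = 0 := by
        linear_combination (norm := (match_scalars <;> field_simp <;> ring)) (16 : F) • hββ
      exact (smul_eq_zero.1 e2).elim (mul_ne_zero (mul_ne_zero h3 h3) h3) hcp.1
  exact ⟨c, fun i => (key i).1, fun i => (key i).2⟩

/-- The relations between the `s_j` and `p_{r,j}` forced by property (J). -/
theorem folding_relations (h2 : (2 : F) ≠ 0) (h3 : (3 : F) ≠ 0) (h : IsCoverImage F A S P)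
    {n : ℕ} {c : Q} (hmn : ∀ i, A (i - n) = A (i + n))
    (hcA : ∀ i, c * A i = c + A i - A (i + n))
    (hb : ∀ i : ℤ, S n + (P (i + 1) n - P (i - 1) n) = -c + (1 / 2 : F) • (A i + A (i + n)))
    (h5 : ∀ r j, (5 : F) • P r j = 0) (h0 : (∀ r j, P r j = 0) ∨ 3 ∣ n) (j : ℤ) :
    S j + S (j - n) = S n ∧ (3 ∣ j → ∀ r, P r j + P r (j - n) = P r n) := by
  have h4 := four_ne_zero_of_two h2
  have h8 := eight_ne_zero_of_two h2
  -- The product c a_k is computed twice: from `hcA`, and from the expression of c through a_i with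
  -- i = k - j. This choice of i makes the indices j and j - n appear.
  have main : ∀ k : ℤ, S j + S (j - n) + (P (k + 1) j - P (k - 1) j)
      + (P (k + 1) (j - n) - P (k - 1) (j - n)) = S n - (3 : F) • (P (k + 1) n - P (k - 1) n)
      + (2 : F) • (P ((k - j : ℤ) + 1) n - P ((k - j : ℤ) - 1) n)
      + (2 : F) • (P (-((k : ZMod 3) + (k - j : ℤ)) + 1) n
        - P (-((k : ZMod 3) + (k - j : ℤ)) - 1) n) := by
    intro k
    set i := k - j with hi
    have e1 : ∀ x y : ZMod 3, -(x + (y + 1)) = -(x + y) - 1 := by decide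
    have e2 : ∀ x y : ZMod 3, -(x + (y - 1)) = -(x + y) + 1 := by decide
    have hc : c = (1 / 2 : F) • (A i + A (i + n)) - (S n + (P (i + 1) n - P (i - 1) n)) := by
      rw [hb i]; abel
    have e3 := hcA k
    have e4 := hb k
    have e5 := hb i
    rw [mul_comm] at e3
    conv_lhs at e3 => rw [hc]
    rw [mul_sub, mul_smul_comm, mul_add, mul_add, mul_sub, h.mul_AA, h.mul_AA, h.mul_AS, h.mul_AP,
      h.mul_AP, e1, e2, hmn, show k - i = j by rw [hi]; ring,
      show k - (i + (n : ℤ)) = j - n by rw [hi]; ring] at e3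
    linear_combination (norm := (match_scalars <;> field_simp <;> ring))
      (2 : F) • e3 + e4 + e5
  -- For 3 ∣ j all three z_{·,n} have first index k, with total coefficient -3 + 2 + 2 = 1.
  -- Otherwise the last two have the two other first indices and sum to -2z_{k,n}, so -5z_{k,n} = 0
  -- remains.
  have main' : ∀ k : ZMod 3, S j + S (j - n) + (P (k + 1) j - P (k - 1) j)
      + (P (k + 1) (j - n) - P (k - 1) (j - n))
      = S n + (if 3 ∣ j then P (k + 1) n - P (k - 1) n else 0) := by
    intro k
    obtain ⟨k, rfl⟩ := ZMod.intCast_surjective k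
    rw [main k]
    by_cases hj : (3 : ℤ) ∣ j
    · have hj0 : (j : ZMod 3) = 0 := (ZMod.intCast_zmod_eq_zero_iff_dvd j 3).2 hj
      rw [if_pos hj]
      push_cast
      rw [hj0, sub_zero, neg_add_self_zmod_three]
      module
    · have hj0 : (j : ZMod 3) ≠ 0 := fun e => hj ((ZMod.intCast_zmod_eq_zero_iff_dvd j 3).1 e)
      rw [if_neg hj]
      have e : ∀ x y : ZMod 3, y ≠ 0 → (x - y = x - 1 ∧ -(x + (x - y)) = x + 1) ∨
        (x - y = x + 1 ∧ -(x + (x - y)) = x - 1) := by decide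
      have e1 : ∀ x : ZMod 3, x + 1 + 1 = x - 1 := by decide
      have e2 : ∀ x : ZMod 3, x - 1 - 1 = x + 1 := by decide
      have f1 := h5 (k + 1) n
      have f2 := h5 (k - 1) n
      push_cast
      rcases e k j hj0 with ⟨e3, e4⟩ | ⟨e3, e4⟩ <;> rw [e4, e3] <;>
        simp only [e1, e2, add_sub_cancel_right, sub_add_cancel] <;>
        linear_combination (norm := module) -f1 + f2
  by_cases hj : (3 : ℤ) ∣ j
  · have hsep := h.separate h3 (Finset.univ : Finset (Fin 3)) ![1, 1, -1] ![j, j - n, n] (fun r => ?_)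
    · simp only [Fin.sum_univ_three, Matrix.cons_val_zero, Matrix.cons_val_one, Matrix.cons_val,
        one_smul, neg_smul, ← sub_eq_add_neg, sub_eq_zero] at hsep
      exact ⟨hsep.1, fun _ => hsep.2⟩
    · have := main' r
      rw [if_pos hj] at this
      simp only [Fin.sum_univ_three, Matrix.cons_val_zero, Matrix.cons_val_one, Matrix.cons_val,
        one_smul, neg_smul]
      linear_combination (norm := module) this
  · refine ⟨?_, fun h' => absurd h' hj⟩
    have := main' 0
    rw [if_neg hj] at this
    have hP1 : ∀ r, P r j = 0 := fun r => h.P_eq_zero r hj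
    have hP2 : ∀ r, P r (j - n) = 0 := fun r => by
      rcases h0 with h0 | h0
      · exact h0 _ _
      · exact h.P_eq_zero r (by omega)
    simpa only [hP1, hP2, sub_zero, add_zero] using this

end IsCoverImage

end Highwater

namespace Highwater

/-! ### Universality of the model, and the final count. -/

section Universal

variable {F : Type*} [Field F] {n : ℕ} [NeZero n]

/-- The hypothesis says that G_j - G_n/2 changes sign under j ↦ j - n. As n is odd, so does (-1)^j,
hence the product descends to classes modulo n up to sign. The parameter d is 1 for s and 3 for p.
-/
theorem sgn_smul_absClass {M : Type*} [AddCommGroup M] [Module F M] (h2 : (2 : F) ≠ 0)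
    (hn : Odd n) {d : ℤ} (hd : d ∣ n) {G : ℤ → M} (hneg : ∀ j, G (-j) = G j)
    (hG : ∀ j, d ∣ j → G j + G (j - n) = G n) {j : ℤ} (hj : d ∣ j) :
    sgn F (absClass n j : ℕ) • (G (absClass n j : ℕ) - (1 / 2 : F) • G n)
      = sgn F j • (G j - (1 / 2 : F) • G n) := by
  have hper : ∀ j, d ∣ j → sgn F (j - n) • (G (j - n) - (1 / 2 : F) • G n)
      = sgn F j • (G j - (1 / 2 : F) • G n) := fun j hj => by
    rw [sgn_sub, sgn_of_odd (i := (n : ℤ)) (by exact_mod_cast hn)]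
    have e := hG j hj
    linear_combination (norm := (match_scalars <;> field_simp <;> ring)) (-sgn F j) • e
  have hmul : ∀ m j : ℤ, d ∣ j → sgn F (j + n * m) • (G (j + n * m) - (1 / 2 : F) • G n)
      = sgn F j • (G j - (1 / 2 : F) • G n) := by
    intro m j hj
    induction m using Int.induction_on with
    | zero => rw [mul_zero, add_zero]
    | succ m ih =>
      rw [← ih, ← hper _ (dvd_add hj (hd.mul_right _))]
      ring_nf
    | pred m ih =>
      rw [← ih, ← hper _ (dvd_add hj (hd.mul_right (-m : ℤ)))]
      ring_nf
  obtain ⟨m, hm | hm⟩ := exists_absClass_eq (n := n) j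
  · rw [hm, hmul m j hj]
  · rw [hm, hmul m _ (hj.neg_right), sgn_neg, hneg]

/-- An image of the cover in which the relations forced by property (J) hold is an image of the
model. -/
theorem exists_comp_toModel (h2 : (2 : F) ≠ 0) (hn : Odd n) {b : Prop} (hb : b → 3 ∣ n)
    {K : AlgIdeal F (Cover F)} {c : K.Quot}
    (h : IsCoverImage F (fun i => K.toQuot (a F i)) (fun j => K.toQuot (s F j.natAbs))
      (fun r j => K.toQuot (p F r j.natAbs)))
    (hP : ¬ b → ∀ r j, K.toQuot (p F r j) = 0)
    (hA : ∀ i, K.toQuot (a F (i + n + n)) = K.toQuot (a F i))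
    (hc : ∀ i : ℤ, K.toQuot (s F n) + (K.toQuot (p F (i + 1) n) - K.toQuot (p F (i - 1) n))
      = -c + (1 / 2 : F) • (K.toQuot (a F i) + K.toQuot (a F (i + n))))
    (hS : ∀ j : ℤ, K.toQuot (s F j.natAbs) + K.toQuot (s F (j - n).natAbs) = K.toQuot (s F n))
    (hPP : ∀ j : ℤ, 3 ∣ j → ∀ r, K.toQuot (p F r j.natAbs) + K.toQuot (p F r (j - n).natAbs)
      = K.toQuot (p F r n)) :
    ∃ ψ : Model F n b →ₗ[F] K.Quot, ψ ∘ₗ toModel F n b = K.toQuot := by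
  have h4 := four_ne_zero_of_two h2
  -- The images are those forced by inverting the formulas for `toModel`; they are given on
  -- representatives and shown below to be independent of them.
  let ψ : Model F n b →ₗ[F] K.Quot := Finsupp.linearCombination F fun
    | .inl _ => c
    | .inr (.inl x) => sgn F x.val • (K.toQuot (a F x.val) - K.toQuot (a F (x.val + n)))
    | .inr (.inr (.inl u)) => sgn F u.val • (K.toQuot (s F u.val) - (1 / 2 : F) • K.toQuot (s F n))
    | .inr (.inr (.inr (r, u))) =>
      sgn F u.1.val • (K.toQuot (p F r u.1.val) - (1 / 2 : F) • K.toQuot (p F r n))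
  have ψC : ψ (modelC F n b) = c := by
    rw [modelC, Finsupp.linearCombination_single, one_smul]
  have ψD : ∀ i : ℤ, ψ (modelD F n b i)
      = sgn F i • (K.toQuot (a F i) - K.toQuot (a F (i + n))) := by
    intro i
    rw [modelD, Finsupp.linearCombination_single, one_smul]
    dsimp only
    have hper : ∀ k : ℤ, sgn F (k + n) • (K.toQuot (a F (k + n)) - K.toQuot (a F (k + n + n)))
        = sgn F k • (K.toQuot (a F k) - K.toQuot (a F (k + n))) := fun k => by
      rw [sgn_add, sgn_of_odd (i := (n : ℤ)) (by exact_mod_cast hn), hA]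
      module
    obtain ⟨m, hm⟩ := exists_val_eq (n := n) i
    rw [hm]
    clear hm
    induction m using Int.induction_on with
    | zero => rw [mul_zero, add_zero]
    | succ m ih => rw [← ih, ← hper (i + n * m)]; ring_nf
    | pred m ih => rw [← ih, ← hper (i + n * (-m - 1))]; ring_nf
  have ψW : ∀ j : ℤ, ψ (modelW F n b j)
      = sgn F j • (K.toQuot (s F j.natAbs) - (1 / 2 : F) • K.toQuot (s F n)) := by
    intro j
    rw [modelW, Finsupp.linearCombination_single, one_smul]
    exact sgn_smul_absClass h2 hn (one_dvd _) (G := fun j => K.toQuot (s F j.natAbs)) h.S_neg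
      (fun j _ => hS j) (one_dvd j)
  have ψQ : ∀ (r : ZMod 3) (j : ℤ), 3 ∣ j → ψ (modelQ F n b r j)
      = sgn F j • (K.toQuot (p F r j.natAbs) - (1 / 2 : F) • K.toQuot (p F r n)) := by
    intro r j hj
    by_cases hb' : b
    · have h3n : (3 : ℤ) ∣ n := by exact_mod_cast hb hb'
      have hu : b ∧ 3 ∣ (absClass n j).val := ⟨hb', (three_dvd_absClass (hb hb') j).2 hj⟩
      have key : ∀ r : ZMod 3, sgn F (absClass n j : ℕ) • (K.toQuot (p F r (absClass n j).val)
          - (1 / 2 : F) • K.toQuot (p F r n))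
          = sgn F j • (K.toQuot (p F r j.natAbs) - (1 / 2 : F) • K.toQuot (p F r n)) := fun r =>
        sgn_smul_absClass h2 hn h3n (G := fun j => K.toQuot (p F r j.natAbs)) (h.P_neg r)
          (fun j hj => hPP j hj r) hj
      unfold modelQ
      rw [dif_pos hu]
      split_ifs with hr
      · rw [Finsupp.linearCombination_single, one_smul]
        exact key r
      · rw [not_not] at hr
        subst hr
        rw [map_sub, map_neg, Finsupp.linearCombination_single, Finsupp.linearCombination_single,
          one_smul, one_smul]
        dsimp only
        rw [key, key, p_zero_eq, p_zero_eq]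
        simp only [map_sub, map_neg]
        module
    · rw [modelQ_eq_zero_of_not hb', map_zero, hP hb', hP hb', smul_zero, sub_zero, smul_zero]
  refine ⟨ψ, (basis F).ext ?_⟩
  have s0 : K.toQuot (s F 0) = 0 := by rw [s_zero, map_zero]
  have p0 : ∀ r, K.toQuot (p F r 0) = 0 := fun r => by rw [p_zero, map_zero]
  rintro (i | j | ⟨r, k⟩)
  · change ψ (toModel F n b (a F i)) = K.toQuot (a F i)
    have e := hc i
    have hs := sgn_mul_self (F := F) i
    rw [toModel_a, modelZ, map_sub, map_sub, map_add, map_smul, map_smul, map_smul, map_sub, ψC, ψD,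
      ψW, ψQ _ _ (dvd_zero _), ψQ _ _ (dvd_zero _), Int.natAbs_zero, s0, p0, p0, sgn_zero, smul_smul,
      div_mul_eq_mul_div, hs]
    linear_combination (norm := (match_scalars <;> field_simp <;> ring)) e
  · rw [LinearMap.comp_apply, ← s_eq_basis j.2, ← Int.natAbs_natCast j.1, toModel_s, map_sub,
      map_smul, ψW, ψW, Int.natAbs_zero, s0, sgn_zero, smul_smul, sgn_mul_self]
    module
  · have hk : (3 : ℤ) ∣ (k.1 : ℤ) := by exact_mod_cast k.2.2
    rw [LinearMap.comp_apply, ← p_eq_basis r.2 k.2, ← Int.natAbs_natCast k.1, toModel_p _ hk,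
      map_sub, map_smul, ψQ _ _ hk, ψQ _ _ (dvd_zero _), Int.natAbs_zero, p0, sgn_zero, smul_smul,
      sgn_mul_self]
    module

theorem modelIdeal_le (h2 : (2 : F) ≠ 0) (h3 : (3 : F) ≠ 0) (hn : Odd n) {b : Prop}
    (hb : b → 3 ∣ n) (hb5 : b → (5 : F) = 0) {I K : AlgIdeal F (Cover F)}
    (hK : K ∈ idealsJ F (2 * n) I) (hP : ¬ b → ∀ r j, p F r j ∈ K.toSubmodule) :
    modelIdeal F n b h2 hb hb5 ≤ K := by
  obtain ⟨-, hax, hJ⟩ := hK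
  have h := (isCoverImage_cover h2).toQuot (K := K)
  have hP0 : ¬ b → ∀ r j, K.toQuot (p F r j) = 0 := fun hb' r j => K.toQuot_eq_zero.2 (hP hb' r j)
  have hA : ∀ i, K.toQuot (a F (i + n + n)) = K.toQuot (a F i) := fun i =>
    (h.A_eq_iff_of_hasAxet h2 h3 hax (i + n + n) i).2 (Dvd.intro 1 (by push_cast; ring))
  obtain ⟨c, hcA, hc⟩ := h.exists_axis_of_propertyJ h2 h3 hn hax hJ
  have hrel := h.folding_relations h2 h3 (n := n) (c := c)
    (fun i => by rw [← hA (i - n)]; ring_nf) hcA hc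
    (fun r j => by
      by_cases hb' : b
      · rw [hb5 hb', zero_smul]
      · rw [hP0 hb', smul_zero])
    (by
      by_cases hb' : b
      · exact .inr (hb hb')
      · exact .inl fun r j => hP0 hb' _ _)
  obtain ⟨ψ, hψ⟩ := exists_comp_toModel h2 hn hb h hP0 hA hc (fun j => (hrel j).1)
    (fun j => (hrel j).2)
  intro x hx
  have hx' : toModel F n b x = 0 := hx
  refine K.toQuot_eq_zero.1 ?_
  rw [← hψ, LinearMap.comp_apply, hx', map_zero]

theorem _root_.AlgIdeal.span_le {A : Type*} [NonUnitalNonAssocCommRing A] [Module F A] {X : Set A}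
    {I : AlgIdeal F A} : AlgIdeal.span F X ≤ I ↔ X ⊆ I.toSubmodule :=
  ⟨fun h _ hx => h (Submodule.mem_sInf.2 fun _ hp => hp.1 hx),
    fun h => sInf_le (show I.toSubmodule ∈ {p : Submodule F A | X ⊆ p ∧ ∀ x y : A, y ∈ p → x * y ∈ p}
      from ⟨h, I.mul_mem'⟩)⟩

theorem p_mem_of_highwaterIdeal_le {m : ℕ} {K : AlgIdeal F (Cover F)}
    (hK : highwaterIdeal F m ≤ K) (r : ZMod 3) (j : ℕ) : p F r j ∈ K.toSubmodule :=
  AlgIdeal.span_le.1 hK (.inl ⟨r, j, rfl⟩)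

theorem coverIdeal_le_highwaterIdeal (m : ℕ) : coverIdeal F m ≤ highwaterIdeal F m :=
  AlgIdeal.span_le.2 fun _ hx => AlgIdeal.span_le.1 le_rfl (.inr hx)

theorem coverIdeal_le_modelIdeal (h2 : (2 : F) ≠ 0) (hn : Odd n) {b : Prop} (hb : b → 3 ∣ n)
    (hb5 : b → (5 : F) = 0) : coverIdeal F (2 * n) ≤ modelIdeal F n b h2 hb hb5 := by
  refine AlgIdeal.span_le.2 ?_
  rintro _ rfl
  change toModel F n b _ = 0
  rw [map_sub, sub_eq_zero, toModel_a_eq_iff h2 hn hb, zero_sub, dvd_neg]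

theorem highwaterIdeal_le_modelIdeal (h2 : (2 : F) ≠ 0) (hn : Odd n) {b : Prop} (hb' : ¬ b)
    (hb : b → 3 ∣ n) (hb5 : b → (5 : F) = 0) :
    highwaterIdeal F (2 * n) ≤ modelIdeal F n b h2 hb hb5 := by
  refine AlgIdeal.span_le.2 (Set.union_subset ?_
    (AlgIdeal.span_le.1 (coverIdeal_le_modelIdeal h2 hn hb hb5)))
  rintro _ ⟨r, j, rfl⟩
  change toModel F n b _ = 0
  rw [← Int.natAbs_natCast j]
  by_cases hj : (3 : ℤ) ∣ j
  · rw [toModel_p r hj, modelQ_eq_zero_of_not hb', modelQ_eq_zero_of_not hb', smul_zero, sub_zero]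
  · exact toModel_p_of_not_dvd r hj

/-- If `3 ∤ n`, the quotients of the cover with axet `X(2n)` are quotients of the Highwater
algebra. -/
theorem idealsJ_coverIdeal (h2 : (2 : F) ≠ 0) (h3 : (3 : F) ≠ 0) (hn3 : ¬ 3 ∣ n) :
    idealsJ F (2 * n) (coverIdeal F (2 * n)) = idealsJ F (2 * n) (highwaterIdeal F (2 * n)) := by
  refine Set.Subset.antisymm ?_ fun K hK => ⟨(coverIdeal_le_highwaterIdeal _).trans hK.1, hK.2⟩
  rintro K ⟨hK, hax, hJ⟩
  refine ⟨AlgIdeal.span_le.2 (Set.union_subset ?_ (AlgIdeal.span_le.1 hK)), hax, hJ⟩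
  have h := (isCoverImage_cover h2).toQuot (K := K)
  rintro _ ⟨r, j, rfl⟩
  exact K.toQuot_eq_zero.1 (h.P_eq_zero_of_not_three_dvd h3 (N := (2 * n : ℕ))
    (fun k => (h.A_eq_iff_of_hasAxet h2 h3 hax _ _).2 (by simp)) (by omega) r j)

theorem isLeast_modelIdeal (h2 : (2 : F) ≠ 0) (h3 : (3 : F) ≠ 0) (hn : Odd n) {b : Prop}
    (hb : b → 3 ∣ n) (hb5 : b → (5 : F) = 0) {I : AlgIdeal F (Cover F)}
    (hI : I ≤ modelIdeal F n b h2 hb hb5) (hP : ¬ b → highwaterIdeal F (2 * n) ≤ I) :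
    IsLeast (idealsJ F (2 * n) I) (modelIdeal F n b h2 hb hb5) :=
  ⟨⟨hI, hasAxet_modelIdeal h2 hn hb hb5 h3, propertyJ_modelIdeal h2 hn hb hb5 h3⟩,
    fun _ hK => modelIdeal_le h2 h3 hn hb hb5 hK fun hb' =>
      p_mem_of_highwaterIdeal_le ((hP hb').trans hK.1)⟩

theorem natCeil_div_two (hn : Odd n) : ⌈(n : ℚ) / 2⌉₊ = n / 2 + 1 := by
  obtain ⟨k, rfl⟩ := hn
  rw [show (2 * k + 1) / 2 = k by omega, Nat.ceil_eq_iff (by omega)]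
  push_cast
  constructor <;> linarith

theorem natCeil_div_six (hn : Odd n) (h3 : 3 ∣ n) : ⌈(n : ℚ) / 6⌉₊ = n / 2 / 3 + 1 := by
  obtain ⟨k, rfl⟩ : ∃ k, n = 6 * k + 3 := by
    obtain ⟨l, hl⟩ := hn
    exact ⟨n / 6, by omega⟩
  rw [show (6 * k + 3) / 2 / 3 = k by omega, Nat.ceil_eq_iff (by omega)]
  push_cast
  constructor <;> linarith

end Universal

end Highwater

end

theorem mainTheorem5 {F : Type*} [Field F] (h2 : (2 : F) ≠ 0) (h3 : (3 : F) ≠ 0)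
    (n : ℕ) (hn : Odd n) :
    ∃ K : AlgIdeal F (Highwater.Cover F),
      IsLeast (Highwater.idealsJ F (2 * n) (Highwater.highwaterIdeal F (2 * n))) K ∧
      Module.finrank F K.Quot = n + ⌈(n : ℚ) / 2⌉₊ + 1 ∧
      (ringChar F = 5 →
        ∃ K' : AlgIdeal F (Highwater.Cover F),
          IsLeast (Highwater.idealsJ F (2 * n) (Highwater.coverIdeal F (2 * n))) K' ∧
          (¬ 3 ∣ n → K' = K) ∧
          (3 ∣ n → Module.finrank F K'.Quot =
            n + ⌈(n : ℚ) / 2⌉₊ + 2 * ⌈(n : ℚ) / 6⌉₊ + 1)) := by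
  classical
  have : NeZero n := ⟨hn.pos.ne'⟩
  -- The model without any q, that is `b := False`, makes the conditions on 3 and 5 vacuous.
  have hK := Highwater.isLeast_modelIdeal h2 h3 hn False.elim False.elim
    (Highwater.highwaterIdeal_le_modelIdeal h2 hn not_false False.elim False.elim) fun _ => le_rfl
  refine ⟨_, hK, ?_, fun h5 => ?_⟩
  · rw [Highwater.finrank_modelIdeal h2 hn, Highwater.natCeil_div_two hn]
    simp only [false_and, Fintype.card_eq_zero]
    omega
  · have h5' : (5 : F) = 0 := by
      have := ringChar.Nat.cast_ringChar (R := F)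
      rw [h5] at this
      exact_mod_cast this
    by_cases hn3 : 3 ∣ n
    · refine ⟨_, Highwater.isLeast_modelIdeal h2 h3 hn (b := True) (fun _ => hn3) (fun _ => h5')
        (Highwater.coverIdeal_le_modelIdeal h2 hn _ _) fun h => absurd trivial h,
        fun h => absurd hn3 h, fun _ => ?_⟩
      rw [Highwater.finrank_modelIdeal h2 hn, Highwater.natCeil_div_two hn,
        Highwater.natCeil_div_six hn hn3]
      have := Highwater.card_multiples_three (n / 2)
      simp only [true_and] at this ⊢
      omega
    · refine ⟨_, ?_, fun _ => rfl, fun h => absurd h hn3⟩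
      rw [Highwater.idealsJ_coverIdeal h2 h3 hn3]
      exact hK
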